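/- Logarithms are to the base $2$. For a function $f$, $\tilde O(f)$ denotes $O(f\cdot\mathrm{poly}(\log f))$. For $n>1$ put $s=\lceil 2\log\log n\rceil$, and let $\nu_2(m)$ be the exponent of the exact power of $2$ dividing $m$. Running times are those of programs for a random access machine on natural numbers, under the logarithmic cost criterion: an instruction is charged the bit lengths of the register addresses and of the numbers it handles, and a multiplication or a division of numbers with $l$ bits altogether is charged $O(l(\log l)^2)$. There are a function $g$ with $g(n)=\tilde O((\log n)^4)$ and two programs, a test $B$ and a test $A$, such that the following holds. (1) Let $n\equiv -1 \pmod 4$ be a positive integer, $k=\nu_2(n+1)$, $u$ an integer with $1\le u\le k+1$, and $\alpha\in\mathbb Z[i]$ with $\alpha^{(n^2-1)/2^u}\equiv -1 \pmod n$. Given $n$, $u$ and the residue of $\alpha$ modulo $n$, the program $B$ decides correctly whether $n$ is prime, in time at most $$2^{2u}\cdot 2^{\max(s+2(u-1)-k,\,0)}\cdot g(n).$$ (2) Let $n\equiv 1 \pmod 4$, $n>1$, $k=\nu_2(n-1)$, $u$ an integer with $1\le u\le k$, and $a\in\mathbb Z$ with $a^{(n-1)/2^u}\equiv -1 \pmod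 n$. Given $n$, $u$ and the residue of $a$ modulo $n$, the program $A$ decides correctly whether $n$ is prime, in time at most $$2^{2(u-1)}\cdot 2^{\max(s+2(u-1)-k,\,0)}\cdot g(n).$$ Thus, as functions of $n$, $k$ and $u$, the time bound for the test $B$ is four times the time bound for the corresponding test $A$ for $n\equiv 1\pmod 4$. -/

import Mathlib

/-! Random access machines under the logarithmic cost criterion. -/

namespace RAM

/-- Instructions of a random access machine. Register `r` holds the natural number `R[r]`. -/
inductive Instr where
  /-- `R[d] := c` -/
  | const (d c : ℕ)
  /-- `R[d] := R[a]` -/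
  | copy (d a : ℕ)
  /-- `R[d] := R[a] + R[b]` -/
  | add (d a b : ℕ)
  /-- `R[d] := max (R[a] - R[b]) 0` -/
  | sub (d a b : ℕ)
  /-- `R[d] := R[a] * R[b]` -/
  | mul (d a b : ℕ)
  /-- `R[d] := ⌊R[a] / R[b]⌋` (and `0` if `R[b] = 0`) -/
  | div (d a b : ℕ)
  /-- `R[d] := R[R[a]]` -/
  | load (d a : ℕ)
  /-- `R[R[a]] := R[b]` -/
  | store (a b : ℕ)
  /-- go to instruction number `l` -/
  | jump (l : ℕ)
  /-- go to instruction number `l` if `R[a] = 0`, else to the next instruction -/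
  | jumpZero (a l : ℕ)

/-- A program is a finite list of instructions, numbered from `0`. -/
abbrev Program := List Instr

/-- A configuration: the number of the next instruction, and the contents of the registers. -/
structure Config where
  pc : ℕ
  mem : ℕ → ℕ

/-- The length of `x` in binary (with length `1` for `x = 0`). -/
def len (x : ℕ) : ℕ := Nat.log 2 x + 1

/-- What is charged for multiplying or dividing numbers of `l` bits altogether:
`l * (log l)^2`, which up to a constant factor is at least the number of bit operations
that these take by the fast Fourier transform. -/
def mulCost (l : ℕ) : ℕ := l * len l ^ 2

namespace Instr

/-- The effect of one instruction. -/
def exec : Instr → Config → Config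
  | const d c, C => ⟨C.pc + 1, Function.update C.mem d c⟩
  | copy d a, C => ⟨C.pc + 1, Function.update C.mem d (C.mem a)⟩
  | add d a b, C => ⟨C.pc + 1, Function.update C.mem d (C.mem a + C.mem b)⟩
  | sub d a b, C => ⟨C.pc + 1, Function.update C.mem d (C.mem a - C.mem b)⟩
  | mul d a b, C => ⟨C.pc + 1, Function.update C.mem d (C.mem a * C.mem b)⟩
  | div d a b, C => ⟨C.pc + 1, Function.update C.mem d (C.mem a / C.mem b)⟩
  | load d a, C => ⟨C.pc + 1, Function.update C.mem d (C.mem (C.mem a))⟩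
  | store a b, C => ⟨C.pc + 1, Function.update C.mem (C.mem a) (C.mem b)⟩
  | jump l, C => ⟨l, C.mem⟩
  | jumpZero a l, C => ⟨if C.mem a = 0 then l else C.pc + 1, C.mem⟩

/-- The cost of one instruction executed on the memory `m`: the lengths of all the register
addresses and of all the numbers involved, and for multiplication and division
also the bit cost of the operation. -/
def cost : Instr → (ℕ → ℕ) → ℕ
  | const d c, _ => len d + len c
  | copy d a, m => len d + len a + len (m a)
  | add d a b, m => len d + len a + len b + len (m a) + len (m b)
  | sub d a b, m => len d + len a + len b + len (m a) + len (m b)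
  | mul d a b, m => len d + len a + len b + mulCost (len (m a) + len (m b))
  | div d a b, m => len d + len a + len b + mulCost (len (m a) + len (m b))
  | load d a, m => len d + len a + len (m a) + len (m (m a))
  | store a b, m => len a + len b + len (m a) + len (m b)
  | jump _, _ => 1
  | jumpZero a _, m => len a + len (m a)

end Instr

/-- `Runs P C t C'`: started in `C`, the program `P` halts (that is, leaves the range of its
instruction numbers) in `C'`, and the instructions executed cost `t` in total. -/
inductive Runs (P : Program) : Config → ℕ → Config → Prop
  | halt (C : Config) (h : P[C.pc]? = none) : Runs P C 0 C
  | step (C : Config) (I : Instr) (t : ℕ) (C' : Config) (h : P[C.pc]? = some I)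
      (hr : Runs P (I.exec C) t C') : Runs P C (I.cost C.mem + t) C'

/-- The initial configuration: the input `x₀, x₁, …, xᵣ` is in the registers `0, 1, …, r`, and
all other registers hold `0`. -/
def init (input : List ℕ) : Config := ⟨0, fun i => input.getD i 0⟩

/-- On the given input, `P` halts at total cost at most `T`, and its answer in register `0` is
`1` if `p` holds and `0` if `p` does not hold. -/
def DecidesWithin (P : Program) (input : List ℕ) (p : Prop) (T : ℝ) : Prop :=
  ∃ (t : ℕ) (C : Config), Runs P (init input) t C ∧ (t : ℝ) ≤ T ∧
    (p → C.mem 0 = 1) ∧ (¬ p → C.mem 0 = 0)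

end RAM

/-- `g` is `Õ(f)`, that is, `O(f · poly(log f))`. -/
def IsSoftO (g f : ℕ → ℝ) : Prop :=
  ∃ c : ℕ, Asymptotics.IsBigO Filter.atTop g (fun n => f n * Real.log (f n) ^ c)

/-- `s = ⌈2 log log n⌉`, with logarithms to the base `2`. -/
noncomputable def sParam (n : ℕ) : ℤ := ⌈2 * Real.logb 2 (Real.logb 2 n)⌉

/-- `n ≡ 1 (mod 4)`, `n > 1`, `k = ν₂(n - 1)`, `1 ≤ u ≤ k`, and `a ^ ((n - 1) / 2 ^ u) ≡ -1 (mod n)`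
for the integer `a`. -/
def HypA (n k u : ℕ) (a : ℤ) : Prop :=
  1 < n ∧ n ≡ 1 [MOD 4] ∧ k = padicValNat 2 (n - 1) ∧ 1 ≤ u ∧ u ≤ k ∧
    a ^ ((n - 1) / 2 ^ u) ≡ -1 [ZMOD n]

/-- `n ≡ -1 (mod 4)`, `k = ν₂(n + 1)`, `1 ≤ u ≤ k + 1`, and
`α ^ ((n ^ 2 - 1) / 2 ^ u) ≡ -1 (mod n)` in `ℤ[i]` for the Gaussian integer `α`. -/
def HypB (n k u : ℕ) (α : GaussianInt) : Prop :=
  (n : ℤ) ≡ -1 [ZMOD 4] ∧ k = padicValNat 2 (n + 1) ∧ 1 ≤ u ∧ u ≤ k + 1 ∧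
    (n : GaussianInt) ∣ α ^ ((n ^ 2 - 1) / 2 ^ u) - (-1)

/-! Put N = n, h = 1 for the test `A` and N = n², h = 2 for the test `B`, and write N = 2^K·m + 1
with m odd, so that α^(m·2^(K-u)) ≡ -1 modulo n. Let L be the bit length of n, κ = K+1-u, and let D
= 2^S be the least power of two with D ≥ 2^u·16L². If n ≤ D, trial division is cheap enough.
Otherwise n is accepted when it is no perfect power and (X+e)^N = X^N + e holds modulo n and (X^D -
α)(X^D - ᾱ) for max(⌊D/2^κ⌋, 1) numbers e ≤ D whose 2^κ-th powers differ modulo every prime factor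
of n. A prime n passes: the identities are Frobenius (`linearTest_of_prime`), and enough e exist
because an element of a field has at most 2^κ roots of order 2^κ (`le_of_prime`).

Soundness is an argument of AKS type (`BinomialTest.false_of_two_prime_factors`). An accepted
composite n has two prime factors p ≠ r. In the algebraic closure of 𝔽_p let A be the image of α and
ζ^D = A. A power γ of A has order 2^t with t = min(κ, S). Replacing z by z/γ^j turns the identity
for e into one for eγ^j, so that few tests yield D elements d with (z+d)^N = z^N + d at all D-th
roots z of A. The exponents with this property are closed under products; they contain N and p^h,
hence also (n/p)^h. Let T be the number of elements ζ^(((n/p)^i p^j)^h). By the pigeonhole principle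
two different exponents of size at most n^(h√T) agree at ζ, while the 2^(T-1) products of factors ζ
+ d, for the subsets of T-1 elements d, are distinct roots of the difference of the two monomials;
so 2^(T-1) ≤ n^(h√T) (`card_le_of_introspective`). On the other hand ζ^m has order 2^(S+K-u+1), and
ν₂(N^d - 1) = K + ν₂(d) forces T ≥ 2^(S+1-u) ≥ 32L² (`orbit_injective`). These two estimates
contradict each other (`pow_lt_two_pow`).

For the running time, a polynomial is packed into one integer (Kronecker substitution) and its
coefficients are reduced by divide and conquer, so that one product costs DL up to logarithms
(`mulMod_spec`). A test takes O(L) products, D = O(2^u·L²), and there are O(2^max(s+2(u-1)-k, 0))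
tests. With Y = u + O(log L) as a bound for all logarithms this gives 2^u·L⁴·Y³ times the number of
tests. Since (u+1)³ = O(2^u), the contribution of u to Y³ fits into the factor 2^(2(u-1)), and the
rest is polylogarithmic (`cost_le`). The programs are written in a small structured language whose
compiler into machine code is proved correct with costs (`Big.steps`). -/

set_option linter.constructorNameAsVariable false

namespace RAM

/-! ### A small structured language over scalar variables and arrays -/

/-- The scalar variables of the structured language. -/
inductive Var where
  | i0 | i1 | i2 | i3 | n | u | re | im | ex | one
  | len | kk | pw | uu | kap | kp | dd | vv | ee | ww
  | c1 | c2 | c3 | c4 | xx | bad | i | g | t | t1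
  | t2 | t3 | q | h | x | y | z | acc | bas | m
  | j | r | b | f | cnt | pr | e | xn | found | o
  deriving DecidableEq

/-- The arrays of the structured language. -/
inductive Arr where
  | V | Q | H | S
  deriving DecidableEq

def Var.idx : Var → ℕ := Var.ctorIdx
def Arr.idx : Arr → ℕ := Arr.ctorIdx

theorem Var.idx_lt (x : Var) : x.idx < 62 := by cases x <;> decide

theorem Var.idx_inj {x y : Var} (h : x.idx = y.idx) : x = y := by
  have hx : Var.ofNat x.idx = x := by cases x <;> rfl
  have hy : Var.ofNat y.idx = y := by cases y <;> rfl
  rw [← hx, ← hy, h]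

theorem Arr.idx_lt (x : Arr) : x.idx < 4 := by cases x <;> decide
theorem Arr.idx_inj {x y : Arr} (h : x.idx = y.idx) : x = y := by
  cases x <;> cases y <;> first | rfl | (exact absurd h (by decide))

/-- A state of the structured language. -/
structure St where
  v : Var → ℕ
  a : Arr → ℕ → ℕ

/-- Elementary assignments. -/
inductive Prim where
  | const (d : Var) (c : ℕ)
  | copy (d x : Var)
  | add (d x y : Var)
  | sub (d x y : Var)
  | mul (d x y : Var)
  | div (d x y : Var)
  | get (d : Var) (r : Arr) (i : Var)
  | put (r : Arr) (i x : Var)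

namespace St

def setv (σ : St) (d : Var) (c : ℕ) : St := ⟨Function.update σ.v d c, σ.a⟩
def seta (σ : St) (r : Arr) (i c : ℕ) : St :=
  ⟨σ.v, Function.update σ.a r (Function.update (σ.a r) i c)⟩

@[simp] theorem setv_v (σ : St) (d : Var) (c : ℕ) (x : Var) :
    (σ.setv d c).v x = if x = d then c else σ.v x := by
  simp [setv, Function.update_apply]
@[simp] theorem setv_a (σ : St) (d : Var) (c : ℕ) : (σ.setv d c).a = σ.a := rfl
@[simp] theorem seta_v (σ : St) (r : Arr) (i c : ℕ) : (σ.seta r i c).v = σ.v := rfl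
@[simp] theorem seta_a (σ : St) (r : Arr) (i c : ℕ) (s : Arr) :
    (σ.seta r i c).a s = if s = r then Function.update (σ.a r) i c else σ.a s := by
  simp only [seta, Function.update_apply]

end St

namespace Prim

/-- The effect of an elementary assignment. -/
@[simp] def exec : Prim → St → St
  | const d c, σ => σ.setv d c
  | copy d x, σ => σ.setv d (σ.v x)
  | add d x y, σ => σ.setv d (σ.v x + σ.v y)
  | sub d x y, σ => σ.setv d (σ.v x - σ.v y)
  | mul d x y, σ => σ.setv d (σ.v x * σ.v y)
  | div d x y, σ => σ.setv d (σ.v x / σ.v y)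
  | get d r i, σ => σ.setv d (σ.a r (σ.v i))
  | put r i x, σ => σ.seta r (σ.v i) (σ.v x)

/-- The numbers handled have at most `b` bits. -/
@[simp] def Small (b : ℕ) : Prim → St → Prop
  | const _ c, _ => c < 2 ^ b
  | copy _ x, σ => σ.v x < 2 ^ b
  | add _ x y, σ => σ.v x < 2 ^ b ∧ σ.v y < 2 ^ b
  | sub _ x y, σ => σ.v x < 2 ^ b ∧ σ.v y < 2 ^ b
  | mul _ x y, σ => σ.v x < 2 ^ b ∧ σ.v y < 2 ^ b
  | div _ x y, σ => σ.v x < 2 ^ b ∧ σ.v y < 2 ^ b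
  | get _ r i, σ => σ.v i < 2 ^ b ∧ σ.a r (σ.v i) < 2 ^ b
  | put _ i x, σ => σ.v i < 2 ^ b ∧ σ.v x < 2 ^ b

/-- The variables assigned to. -/
def wr : Prim → List Var
  | const d _ | copy d _ | add d _ _ | sub d _ _ | mul d _ _ | div d _ _ | get d _ _ => [d]
  | put _ _ _ => []

/-- The arrays assigned to. -/
def awr : Prim → List Arr
  | put r _ _ => [r]
  | _ => []

/-- The translation into machine instructions. Registers `62` and `63` are auxiliary, and entry `i` of
array `r` is in register `64 + 4 * i + r`. -/
def compile : Prim → List Instr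
  | const d c => [.const d.idx c]
  | copy d x => [.copy d.idx x.idx]
  | add d x y => [.add d.idx x.idx y.idx]
  | sub d x y => [.sub d.idx x.idx y.idx]
  | mul d x y => [.mul d.idx x.idx y.idx]
  | div d x y => [.div d.idx x.idx y.idx]
  | get d r i => [.add 62 i.idx i.idx, .add 62 62 62, .const 63 (64 + r.idx), .add 62 62 63,
      .load d.idx 62]
  | put r i x => [.add 62 i.idx i.idx, .add 62 62 62, .const 63 (64 + r.idx), .add 62 62 63,
      .store 62 x.idx]

end Prim

/-- The memory `m` represents the state `σ`. -/
def Rel (σ : St) (m : ℕ → ℕ) : Prop :=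
  (∀ x : Var, m x.idx = σ.v x) ∧ ∀ (r : Arr) (i : ℕ), m (64 + 4 * i + r.idx) = σ.a r i

theorem Rel.update {σ : St} {m : ℕ → ℕ} (h : Rel σ m) (d : Var) (c : ℕ) :
    Rel (σ.setv d c) (Function.update m d.idx c) := by
  refine ⟨fun x => ?_, fun r i => ?_⟩
  · by_cases hx : x = d
    · simp [hx]
    · have : x.idx ≠ d.idx := fun e => hx (Var.idx_inj e)
      simp [hx, this, h.1]
  · have := d.idx_lt
    rw [Function.update_of_ne (by omega)]
    exact h.2 r i

theorem Rel.scratch {σ : St} {m : ℕ → ℕ} (h : Rel σ m) (d c : ℕ) (hd : 62 ≤ d) (hd' : d < 64) :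
    Rel σ (Function.update m d c) := by
  refine ⟨fun x => ?_, fun r i => ?_⟩
  · have := x.idx_lt
    rw [Function.update_of_ne (by omega)]
    exact h.1 x
  · rw [Function.update_of_ne (by omega)]
    exact h.2 r i

theorem Rel.updatea {σ : St} {m : ℕ → ℕ} (h : Rel σ m) (r : Arr) (i c : ℕ) :
    Rel (σ.seta r i c) (Function.update m (64 + 4 * i + r.idx) c) := by
  refine ⟨fun x => ?_, fun s j => ?_⟩
  · have := x.idx_lt
    rw [Function.update_of_ne (by omega)]
    exact h.1 x
  · have h1 := r.idx_lt
    have h2 := s.idx_lt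
    by_cases hs : s = r
    · subst hs
      by_cases hj : j = i
      · simp [hj]
      · rw [Function.update_of_ne (by omega)]
        simp [hj, h.2]
    · have : s.idx ≠ r.idx := fun e => hs (Arr.idx_inj e)
      rw [Function.update_of_ne (by omega)]
      simp [hs, h.2]

/-! ### Execution and cost of the compiled elementary assignments. -/

/-- Finite runs of a program. -/
inductive Steps (P : Program) : Config → ℕ → Config → Prop
  | refl (C : Config) : Steps P C 0 C
  | step (C : Config) (I : Instr) (t : ℕ) (C' : Config) (h : P[C.pc]? = some I)
      (hr : Steps P (I.exec C) t C') : Steps P C (I.cost C.mem + t) C'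

theorem Steps.trans {P : Program} {C C' C'' : Config} {t t' : ℕ} (h : Steps P C t C')
    (h' : Steps P C' t' C'') : Steps P C (t + t') C'' := by
  induction h with
  | refl C => simpa using h'
  | step C I t C' h hr ih => rw [add_assoc]; exact .step _ _ _ _ h (ih h')

theorem Steps.one {P : Program} {C : Config} (I : Instr) (h : P[C.pc]? = some I) :
    Steps P C (I.cost C.mem) (I.exec C) := .step _ _ _ _ h (.refl _)

theorem Steps.runs {P : Program} {C C' : Config} {t : ℕ} (h : Steps P C t C')
    (h' : P[C'.pc]? = none) : Runs P C t C' := by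
  induction h with
  | refl C => exact .halt _ h'
  | step C I t C' h hr ih => exact .step _ _ _ _ h (ih h')

/-- The code `l` stands in `P` from instruction number `pos` on. -/
def CodeAt (P : Program) (pos : ℕ) (l : List Instr) : Prop :=
  ∀ i, (hi : i < l.length) → P[pos + i]? = some l[i]

theorem CodeAt.left {P : Program} {pos : ℕ} {l l' : List Instr} (h : CodeAt P pos (l ++ l')) :
    CodeAt P pos l := fun i hi => by
  have := h i (by simp; omega)
  rwa [List.getElem_append_left hi] at this

theorem CodeAt.right {P : Program} {pos : ℕ} {l l' : List Instr} (h : CodeAt P pos (l ++ l')) :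
    CodeAt P (pos + l.length) l' := fun i hi => by
  have := h (l.length + i) (by simp; omega)
  rw [List.getElem_append_right (by omega)] at this
  simpa [add_assoc] using this

theorem CodeAt.head {P : Program} {pos : ℕ} {I : Instr} {l : List Instr} (h : CodeAt P pos (I :: l)) :
    P[pos]? = some I := h 0 (by simp)

theorem CodeAt.tail {P : Program} {pos : ℕ} {I : Instr} {l : List Instr} (h : CodeAt P pos (I :: l)) :
    CodeAt P (pos + 1) l := CodeAt.right (l := [I]) h

theorem len_le {x b : ℕ} (h : x < 2 ^ b) : len x ≤ b + 1 := by
  unfold len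
  rcases Nat.eq_zero_or_pos x with rfl | hx
  · simp
  · have := (Nat.log_lt_iff_lt_pow (by norm_num) hx.ne').2 h
    omega

theorem len_mono {x y : ℕ} (h : x ≤ y) : len x ≤ len y :=
  Nat.add_le_add_right (Nat.log_mono_right h) 1

theorem mulCost_mono {x y : ℕ} (h : x ≤ y) : mulCost x ≤ mulCost y :=
  Nat.mul_le_mul h (Nat.pow_le_pow_left (len_mono h) 2)

theorem lt_two_pow_len (x : ℕ) : x < 2 ^ len x := Nat.lt_pow_succ_log_self (by norm_num) x

theorem two_pow_len_le {x : ℕ} (h : x ≠ 0) : 2 ^ (len x - 1) ≤ x := Nat.pow_log_le_self 2 h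

/-- A bound for the cost of one elementary assignment that handles numbers of at most `b` bits;
the number `Y` is to exceed the logarithm of `b`. -/
def unit (Y b : ℕ) : ℕ := 200 * (b + 1) * Y ^ 2

theorem unit_mono (Y : ℕ) {b b' : ℕ} (h : b ≤ b') : unit Y b ≤ unit Y b' := by
  unfold unit; gcongr

/-- Both factors together have at most 2(c+1) bits, and the length of that number is at most `len c
+ 2`. In this way a single number Y replaces the logarithms in all cost bounds. -/
theorem mulCost_le {a b c Y : ℕ} (ha : a < 2 ^ c) (hb : b < 2 ^ c) (hY : len c + 2 ≤ Y) :
    mulCost (len a + len b) ≤ 2 * (c + 1) * Y ^ 2 := by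
  have h1 := len_le ha
  have h2 := len_le hb
  refine (mulCost_mono (show len a + len b ≤ 2 * (c + 1) by omega)).trans ?_
  unfold mulCost
  refine Nat.mul_le_mul_left _ (Nat.pow_le_pow_left (le_trans ?_ hY) 2)
  have h3 := lt_two_pow_len c
  have : 2 * (c + 1) < 2 ^ (len c + 1 + 1 ) := by
    rw [pow_succ, pow_succ]; have : 1 ≤ 2 ^ len c := Nat.one_le_two_pow
    omega
  have h4 : len (2 * (c + 1)) ≤ len (2 ^ (len c + 1)) := by
    apply len_mono; rw [pow_succ]; omega
  refine h4.trans ?_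
  simp [len]

theorem len_idx (x : Var) : len x.idx ≤ 6 := by
  have := len_le (x := x.idx) (b := 6) (by have := x.idx_lt; omega)
  refine (len_mono (show x.idx ≤ 63 by have := x.idx_lt; omega)).trans ?_
  decide

/-- The memory after the execution of a jump-free code. -/
def memAfter : List Instr → (ℕ → ℕ) → ℕ → ℕ
  | [], m => m
  | I :: l, m => memAfter l (I.exec ⟨0, m⟩).mem

/-- The cost of the execution of a jump-free code. -/
def costOf : List Instr → (ℕ → ℕ) → ℕ
  | [], _ => 0
  | I :: l, m => I.cost m + costOf l (I.exec ⟨0, m⟩).mem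

/-- The instruction is no jump. -/
def Instr.Straight : Instr → Prop
  | .jump _ => False
  | .jumpZero _ _ => False
  | _ => True

theorem Steps.straight {P : Program} (l : List Instr) (hl : ∀ I ∈ l, I.Straight) :
    ∀ (pos : ℕ) (m : ℕ → ℕ), CodeAt P pos l →
      Steps P ⟨pos, m⟩ (costOf l m) ⟨pos + l.length, memAfter l m⟩ := by
  induction l with
  | nil => intro pos m _; exact .refl _
  | cons I l ih =>
    intro pos m h
    have hI : I.exec ⟨pos, m⟩ = ⟨pos + 1, (I.exec ⟨0, m⟩).mem⟩ := by
      have := hl I (by simp)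
      cases I <;> simp_all [Instr.exec, Instr.Straight]
    have h2 := ih (fun J hJ => hl J (by simp [hJ])) (pos + 1) (I.exec ⟨0, m⟩).mem h.tail
    have h1 := Steps.step (P := P) ⟨pos, m⟩ I ⟨pos + (I :: l).length, memAfter (I :: l) m⟩ h.head
      (t := costOf l (I.exec ⟨0, m⟩).mem) (by
        rw [hI]; simpa [memAfter, add_assoc, add_comm 1] using h2)
    exact h1

theorem Prim.straight (p : Prim) : ∀ I ∈ p.compile, I.Straight := by
  cases p <;> simp [Prim.compile, Instr.Straight]

theorem Prim.rel (p : Prim) {σ : St} {m : ℕ → ℕ} (h : Rel σ m) :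
    Rel (p.exec σ) (memAfter p.compile m) := by
  -- Doubling the index twice and adding `64 + r.idx` builds the address in register `62`. Only the
  -- auxiliary registers change, so the same state is still represented.
  have haddr : ∀ (r : Arr) (i : Var), ∃ m', Rel σ m' ∧ m' 62 = 64 + 4 * σ.v i + r.idx ∧
      ∀ l, memAfter ([.add 62 i.idx i.idx, .add 62 62 62, .const 63 (64 + r.idx), .add 62 62 63] ++ l) m
        = memAfter l m' := by
    intro r i
    refine ⟨_, ?_, ?_, fun l => rfl⟩
    · simp only [Instr.exec]
      exact (((h.scratch 62 _ (by norm_num) (by norm_num)).scratch 62 _ (by norm_num)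
        (by norm_num)).scratch 63 _ (by norm_num) (by norm_num)).scratch 62 _ (by norm_num) (by norm_num)
    · simp [Instr.exec, h.1]; ring
  cases p with
  | const d c => exact h.update d c
  | copy d x => simpa [compile, memAfter, Instr.exec, h.1] using h.update d (σ.v x)
  | add d x y => simpa [compile, memAfter, Instr.exec, h.1] using h.update d (σ.v x + σ.v y)
  | sub d x y => simpa [compile, memAfter, Instr.exec, h.1] using h.update d (σ.v x - σ.v y)
  | mul d x y => simpa [compile, memAfter, Instr.exec, h.1] using h.update d (σ.v x * σ.v y)
  | div d x y => simpa [compile, memAfter, Instr.exec, h.1] using h.update d (σ.v x / σ.v y)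
  | get d r i =>
    obtain ⟨m', h1, h2, h3⟩ := haddr r i
    have := h3 [.load d.idx 62]
    simp only [compile, exec]
    simp only [List.cons_append, List.nil_append] at this
    rw [this]
    simp only [memAfter, Instr.exec, h2]
    rw [h1.2]
    exact h1.update d _
  | put r i x =>
    obtain ⟨m', h1, h2, h3⟩ := haddr r i
    have := h3 [.store 62 x.idx]
    simp only [compile, exec]
    simp only [List.cons_append, List.nil_append] at this
    rw [this]
    simp only [memAfter, Instr.exec, h2]
    rw [h1.1]
    exact h1.updatea r _ _

/-- Only multiplication and division need the factor Y². The constant 200 of `unit` is chosen to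
cover the five instructions of an array access, whose addresses are a few bits longer than the
index. -/
theorem Prim.costOf_le (p : Prim) {σ : St} {m : ℕ → ℕ} (h : Rel σ m) {b Y : ℕ} (hp : p.Small b σ)
    (hY : len b + 2 ≤ Y) : costOf p.compile m ≤ unit Y b := by
  have hY1 : b + 1 ≤ (b + 1) * Y ^ 2 := Nat.le_mul_of_pos_right _ (pow_pos (by omega) 2)
  have hu : unit Y b = 200 * ((b + 1) * Y ^ 2) := by unfold unit; ring
  have h62 : len 62 = 6 := by decide
  have h63 : len 63 = 6 := by decide
  have haddr : ∀ (r : Arr) (i : Var), σ.v i < 2 ^ b → ∃ m', Rel σ m' ∧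
      m' 62 = 64 + 4 * σ.v i + r.idx ∧ ∀ l,
      costOf ([.add 62 i.idx i.idx, .add 62 62 62, .const 63 (64 + r.idx), .add 62 62 63] ++ l) m
        ≤ 150 + 10 * b + costOf l m' := by
    intro r i hi
    refine ⟨memAfter [.add 62 i.idx i.idx, .add 62 62 62, .const 63 (64 + r.idx), .add 62 62 63] m,
      ?_, ?_, fun l => ?_⟩
    rotate_left 2
    · show _ + (_ + (_ + (_ + _))) ≤ _
      rw [← add_assoc, ← add_assoc, ← add_assoc]
      refine Nat.add_le_add_right ?_ _
      have hr := r.idx_lt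
      have e1 := len_le hi
      have e2 : len (σ.v i + σ.v i) ≤ b + 2 := len_le (by rw [pow_succ]; omega)
      have e3 : len (σ.v i + σ.v i + (σ.v i + σ.v i)) ≤ b + 3 :=
        len_le (by rw [pow_succ, pow_succ]; omega)
      have e4 : len (64 + r.idx) ≤ 7 := 
        (len_mono (show 64 + r.idx ≤ 67 by omega)).trans (by decide)
      have := len_idx i
      simp [Instr.exec, Instr.cost, h.1, h62, h63]
      omega
    · simp only [memAfter, Instr.exec]
      exact (((h.scratch 62 _ (by norm_num) (by norm_num)).scratch 62 _ (by norm_num)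
        (by norm_num)).scratch 63 _ (by norm_num) (by norm_num)).scratch 62 _ (by norm_num) (by norm_num)
    · simp [memAfter, Instr.exec, h.1]; ring
  cases p with
  | const d c =>
    have := len_idx d; have := len_le hp
    simp only [compile, costOf, Instr.cost]; omega
  | copy d x =>
    have := len_idx d; have := len_idx x; have := len_le hp
    simp only [compile, costOf, Instr.cost, h.1]; omega
  | add d x y =>
    have := len_idx d; have := len_idx x; have := len_idx y
    have := len_le hp.1; have := len_le hp.2
    simp only [compile, costOf, Instr.cost, h.1]; omega
  | sub d x y =>
    have := len_idx d; have := len_idx x; have := len_idx y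
    have := len_le hp.1; have := len_le hp.2
    simp only [compile, costOf, Instr.cost, h.1]; omega
  | mul d x y =>
    have := len_idx d; have := len_idx x; have := len_idx y
    have h1 := mulCost_le hp.1 hp.2 hY
    rw [mul_assoc] at h1
    simp only [compile, costOf, Instr.cost, h.1]; omega
  | div d x y =>
    have := len_idx d; have := len_idx x; have := len_idx y
    have h1 := mulCost_le hp.1 hp.2 hY
    rw [mul_assoc] at h1
    simp only [compile, costOf, Instr.cost, h.1]; omega
  | get d r i =>
    obtain ⟨m', h1, h2, h3⟩ := haddr r i hp.1
    have h4 := h3 [.load d.idx 62]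
    simp only [List.cons_append, List.nil_append] at h4
    simp only [compile]
    refine h4.trans ?_
    have hr := r.idx_lt
    have e1 : len (64 + 4 * σ.v i + r.idx) ≤ b + 8 := len_le (by
      have := hp.1; have := Nat.one_le_two_pow (n := b)
      rw [pow_add]; omega)
    have e2 := len_le hp.2
    have := len_idx d
    simp only [costOf, Instr.cost, h2, h1.2, h62]
    omega
  | put r i x =>
    obtain ⟨m', h1, h2, h3⟩ := haddr r i hp.1
    have h4 := h3 [.store 62 x.idx]
    simp only [List.cons_append, List.nil_append] at h4
    simp only [compile]
    refine h4.trans ?_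
    have hr := r.idx_lt
    have e1 : len (64 + 4 * σ.v i + r.idx) ≤ b + 8 := len_le (by
      have := hp.1; have := Nat.one_le_two_pow (n := b)
      rw [pow_add]; omega)
    have e2 := len_le hp.2
    have := len_idx x
    simp only [costOf, Instr.cost, h2, h1.1, h62]
    omega

end RAM

/-! ### Structured programs and the correctness of their compilation. -/

namespace RAM

/-- Structured programs. -/
inductive Stmt where
  | prims (l : List Prim)
  | seq (s t : Stmt)
  /-- if `x ≠ 0` then `s` else `t` -/
  | ite (x : Var) (s t : Stmt)
  /-- while `x ≠ 0` do `s` -/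
  | loop (x : Var) (s : Stmt)

infixr:67 " ;; " => Stmt.seq

/-- The effect of a list of elementary assignments. -/
@[simp] def runs : List Prim → St → St
  | [], σ => σ
  | p :: l, σ => runs l (p.exec σ)

/-- All numbers handled have at most `b` bits. -/
@[simp] def Smalls (b : ℕ) : List Prim → St → Prop
  | [], _ => True
  | p :: l, σ => p.Small b σ ∧ Smalls b l (p.exec σ)

/-- `Big Y s σ t σ'`: started in `σ`, the program `s` halts in `σ'` at a cost of at most `t`. -/
inductive Big (Y : ℕ) : Stmt → St → ℕ → St → Prop
  | prims (l : List Prim) (σ : St) (b : ℕ) (hb : len b + 2 ≤ Y) (h : Smalls b l σ) :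
      Big Y (.prims l) σ (l.length * unit Y b) (runs l σ)
  | seq {s t : Stmt} {σ σ' σ'' : St} {k k' : ℕ} (h : Big Y s σ k σ') (h' : Big Y t σ' k' σ'') :
      Big Y (s ;; t) σ (k + k') σ''
  | ite_pos {x : Var} {s t : Stmt} {σ σ' : St} {k : ℕ} (hx : σ.v x ≠ 0) (h : Big Y s σ k σ') :
      Big Y (.ite x s t) σ (k + (len (σ.v x) + 7)) σ'
  | ite_neg {x : Var} {s t : Stmt} {σ σ' : St} {k : ℕ} (hx : σ.v x = 0) (h : Big Y t σ k σ') :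
      Big Y (.ite x s t) σ (k + (len (σ.v x) + 7)) σ'
  | loop_end {x : Var} {s : Stmt} {σ : St} (hx : σ.v x = 0) :
      Big Y (.loop x s) σ (len (σ.v x) + 7) σ
  | loop_step {x : Var} {s : Stmt} {σ σ' σ'' : St} {k k' : ℕ} (hx : σ.v x ≠ 0)
      (h : Big Y s σ k σ') (h' : Big Y (.loop x s) σ' k' σ'') :
      Big Y (.loop x s) σ (k + (len (σ.v x) + 7) + k') σ''

namespace Stmt

/-- The number of machine instructions. -/
def size : Stmt → ℕ
  | prims l => (l.flatMap Prim.compile).length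
  | seq s t => s.size + t.size
  | ite _ s t => s.size + t.size + 2
  | loop _ s => s.size + 2

/-- The translation into machine code that starts at instruction number `pos`. -/
def compile : Stmt → ℕ → List Instr
  | prims l, _ => l.flatMap Prim.compile
  | seq s t, pos => s.compile pos ++ t.compile (pos + s.size)
  | ite x s t, pos => .jumpZero x.idx (pos + s.size + 2) ::
      (s.compile (pos + 1) ++ .jump (pos + s.size + t.size + 2) :: t.compile (pos + s.size + 2))
  | loop x s, pos => .jumpZero x.idx (pos + s.size + 2) :: (s.compile (pos + 1) ++ [.jump pos])

theorem length_compile (s : Stmt) : ∀ pos, (s.compile pos).length = s.size := by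
  induction s with
  | prims l => intro; rfl
  | seq s t hs ht => intro; simp [compile, size, hs, ht]
  | ite x s t hs ht => intro; simp [compile, size, hs, ht]; omega
  | loop x s hs => intro; simp [compile, size, hs]

/-- The variables assigned to. -/
def wr : Stmt → List Var
  | prims l => l.flatMap Prim.wr
  | seq s t => s.wr ++ t.wr
  | ite _ s t => s.wr ++ t.wr
  | loop _ s => s.wr

/-- The arrays assigned to. -/
def awr : Stmt → List Arr
  | prims l => l.flatMap Prim.awr
  | seq s t => s.awr ++ t.awr
  | ite _ s t => s.awr ++ t.awr
  | loop _ s => s.awr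

end Stmt

theorem prims_steps {P : Program} {Y : ℕ} {b : ℕ} (hb : len b + 2 ≤ Y) (l : List Prim) :
    ∀ (σ : St) (pos : ℕ) (m : ℕ → ℕ), Smalls b l σ → CodeAt P pos (l.flatMap Prim.compile) →
      Rel σ m → ∃ t m', t ≤ l.length * unit Y b ∧
        Steps P ⟨pos, m⟩ t ⟨pos + (l.flatMap Prim.compile).length, m'⟩ ∧ Rel (runs l σ) m' := by
  induction l with
  | nil => intro σ pos m _ _ h; exact ⟨0, m, by simp, .refl _, h⟩
  | cons p l ih =>
    intro σ pos m hs hc h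
    rw [List.flatMap_cons] at hc
    have h1 := Steps.straight _ p.straight pos m hc.left
    obtain ⟨t, m', ht, h2, h3⟩ := ih (p.exec σ) _ _ hs.2 hc.right (p.rel h)
    refine ⟨costOf p.compile m + t, m', ?_, ?_, h3⟩
    rotate_left
    · have := h1.trans h2
      rw [List.flatMap_cons, List.length_append, ← add_assoc]
      exact this
    · have := p.costOf_le h hs.1 hb
      rw [List.length_cons, add_mul]; omega

/-- Induction on the derivation. The summand 7 charged with each guard covers the address of the
tested variable, at most six bits, and the jump over the other branch or back to the guard. -/
theorem Big.steps {Y : ℕ} {s : Stmt} {σ σ' : St} {k : ℕ} (h : Big Y s σ k σ') :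
    ∀ {P : Program} {pos : ℕ} {m : ℕ → ℕ}, CodeAt P pos (s.compile pos) → Rel σ m →
      ∃ t m', t ≤ k ∧ Steps P ⟨pos, m⟩ t ⟨pos + s.size, m'⟩ ∧ Rel σ' m' := by
  induction h with
  | prims l σ b hb h =>
    intro P pos m hc hr
    exact prims_steps hb l σ pos m h hc hr
  | @seq s t σ σ' σ'' k k' _ _ ih ih' =>
    intro P pos m hc hr
    obtain ⟨t1, m1, h1, h2, h3⟩ := ih hc.left hr
    have hc' := hc.right
    rw [Stmt.length_compile] at hc'
    obtain ⟨t2, m2, h4, h5, h6⟩ := ih' hc' h3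
    refine ⟨t1 + t2, m2, by omega, ?_, h6⟩
    have := h2.trans h5
    rwa [add_assoc] at this
  | @ite_pos x s t σ σ' k hx _ ih =>
    intro P pos m hc hr
    obtain ⟨t1, m1, h1, h2, h3⟩ := ih hc.tail.left hr
    have hc' := hc.tail.right
    rw [Stmt.length_compile] at hc'
    have hxm : m x.idx ≠ 0 := by rw [hr.1]; exact hx
    have s1 := Steps.one (C := ⟨pos, m⟩) _ hc.head
    have s2 := Steps.one (C := ⟨pos + 1 + s.size, m1⟩) _ hc'.head
    simp only [Instr.exec, hxm, if_false] at s1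
    simp only [Instr.exec] at s2
    rw [show pos + s.size + t.size + 2 = pos + (Stmt.ite x s t).size by simp only [Stmt.size]; omega]
      at s2
    refine ⟨_, m1, ?_, (s1.trans h2).trans s2, h3⟩
    · have := len_idx x
      simp only [Instr.cost, hr.1]; omega
  | @ite_neg x s t σ σ' k hx _ ih =>
    intro P pos m hc hr
    have hc' := hc.tail.right.tail
    rw [Stmt.length_compile] at hc'
    have hxm : m x.idx = 0 := by rw [hr.1]; exact hx
    have s1 := Steps.one (C := ⟨pos, m⟩) _ hc.head
    have e : pos + 1 + s.size + 1 = pos + s.size + 2 := by omega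
    rw [e] at hc'
    obtain ⟨t1, m1, h1, h2, h3⟩ := ih hc' hr
    simp only [Instr.exec, hxm, if_true] at s1
    rw [show pos + s.size + 2 + t.size = pos + (Stmt.ite x s t).size by simp only [Stmt.size]; omega]
      at h2
    refine ⟨_, m1, ?_, s1.trans h2, h3⟩
    · have := len_idx x
      simp only [Instr.cost, hr.1]; omega
  | @loop_end x s σ hx =>
    intro P pos m hc hr
    have hxm : m x.idx = 0 := by rw [hr.1]; exact hx
    have s1 := Steps.one (C := ⟨pos, m⟩) _ hc.head
    simp only [Instr.exec, hxm, if_true] at s1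
    refine ⟨_, m, ?_, s1, hr⟩
    have := len_idx x
    simp only [Instr.cost, hr.1]; omega
  | @loop_step x s σ σ' σ'' k k' hx _ _ ih ih' =>
    intro P pos m hc hr
    obtain ⟨t1, m1, h1, h2, h3⟩ := ih hc.tail.left hr
    have hc' := hc.tail.right
    rw [Stmt.length_compile] at hc'
    have hxm : m x.idx ≠ 0 := by rw [hr.1]; exact hx
    have s1 := Steps.one (C := ⟨pos, m⟩) _ hc.head
    have s2 := Steps.one (C := ⟨pos + 1 + s.size, m1⟩) _ hc'.head
    simp only [Instr.exec, hxm, if_false] at s1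
    simp only [Instr.exec] at s2
    obtain ⟨t2, m2, h4, h5, h6⟩ := ih' hc h3
    refine ⟨_, m2, ?_, ((s1.trans h2).trans s2).trans h5, h6⟩
    have := len_idx x
    simp only [Instr.cost, hr.1]; omega

/-- The states `σ` and `σ'` agree on what `s` does not assign to. -/
def Fr (s : Stmt) (σ σ' : St) : Prop :=
  (∀ x, x ∉ s.wr → σ'.v x = σ.v x) ∧ ∀ r, r ∉ s.awr → σ'.a r = σ.a r

theorem Fr.refl (s : Stmt) (σ : St) : Fr s σ σ := ⟨fun _ _ => rfl, fun _ _ => rfl⟩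

theorem Fr.trans {s : Stmt} {σ σ' σ'' : St} (h : Fr s σ σ') (h' : Fr s σ' σ'') : Fr s σ σ'' :=
  ⟨fun x hx => (h'.1 x hx).trans (h.1 x hx), fun r hr => (h'.2 r hr).trans (h.2 r hr)⟩

theorem runs_frame (l : List Prim) : ∀ σ, Fr (.prims l) σ (runs l σ) := by
  induction l with
  | nil => intro σ; exact .refl _ _
  | cons p l ih =>
    intro σ
    have := ih (p.exec σ)
    refine ⟨fun x hx => ?_, fun r hr => ?_⟩
    · simp only [Stmt.wr, List.flatMap_cons, List.mem_append, not_or] at hx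
      rw [runs, this.1 x hx.2]
      have h1 := hx.1
      cases p <;> simp_all [Prim.wr]
    · simp only [Stmt.awr, List.flatMap_cons, List.mem_append, not_or] at hr
      rw [runs, this.2 r hr.2]
      have h1 := hr.1
      cases p <;> simp_all [Prim.awr]

theorem Big.frame {Y : ℕ} {s : Stmt} {σ σ' : St} {k : ℕ} (h : Big Y s σ k σ') : Fr s σ σ' := by
  induction h with
  | prims l σ b hb h => exact runs_frame l σ
  | seq _ _ ih ih' =>
    refine ⟨fun x hx => ?_, fun r hr => ?_⟩
    · simp only [Stmt.wr, List.mem_append, not_or] at hx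
      rw [ih'.1 x hx.2, ih.1 x hx.1]
    · simp only [Stmt.awr, List.mem_append, not_or] at hr
      rw [ih'.2 r hr.2, ih.2 r hr.1]
  | ite_pos hx _ ih =>
    refine ⟨fun x hx => ih.1 x ?_, fun r hr => ih.2 r ?_⟩
    · simp only [Stmt.wr, List.mem_append, not_or] at hx; exact hx.1
    · simp only [Stmt.awr, List.mem_append, not_or] at hr; exact hr.1
  | ite_neg hx _ ih =>
    refine ⟨fun x hx => ih.1 x ?_, fun r hr => ih.2 r ?_⟩
    · simp only [Stmt.wr, List.mem_append, not_or] at hx; exact hx.2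
    · simp only [Stmt.awr, List.mem_append, not_or] at hr; exact hr.2
  | loop_end hx => exact .refl _ _
  | loop_step hx _ _ ih ih' => exact Fr.trans (s := .loop _ _) ih ih'

/-! ### Program logic with running times. -/

/-- Started in `σ`, the program `s` halts at a cost of at most `T` in a state with `Q`, and the state is
changed only where `s` assigns to. -/
def WP (Y : ℕ) (s : Stmt) (T : ℕ) (Q : St → Prop) (σ : St) : Prop :=
  ∃ t σ', Big Y s σ t σ' ∧ t ≤ T ∧ Q σ'

variable {Y : ℕ}

/-- The frame `Fr` is available when the postcondition is weakened, so specifications need not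
mention the variables that a program leaves alone. -/
theorem WP.mono {s : Stmt} {T T' : ℕ} {Q Q' : St → Prop} {σ : St} (h : WP Y s T Q σ)
    (hT : T ≤ T') (hQ : ∀ σ', Fr s σ σ' → Q σ' → Q' σ') : WP Y s T' Q' σ := by
  obtain ⟨t, σ', h1, h2, h3⟩ := h
  exact ⟨t, σ', h1, h2.trans hT, hQ _ h1.frame h3⟩

theorem WP.prims {l : List Prim} {Q : St → Prop} {σ : St} (b : ℕ) (hb : len b + 2 ≤ Y)
    (h : Smalls b l σ) (hQ : Q (runs l σ)) : WP Y (.prims l) (l.length * unit Y b) Q σ :=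
  ⟨_, _, .prims l σ b hb h, le_rfl, hQ⟩

theorem WP.seq {s t : Stmt} {T T' : ℕ} {R Q : St → Prop} {σ : St} (h : WP Y s T R σ)
    (h' : ∀ σ', Fr s σ σ' → R σ' → WP Y t T' Q σ') : WP Y (s ;; t) (T + T') Q σ := by
  obtain ⟨k, σ', h1, h2, h3⟩ := h
  obtain ⟨k', σ'', h4, h5, h6⟩ := h' σ' h1.frame h3
  exact ⟨_, _, .seq h1 h4, by omega, h6⟩

theorem WP.ite {x : Var} {s t : Stmt} {T c : ℕ} {Q : St → Prop} {σ : St}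
    (hc : len (σ.v x) + 7 ≤ c)
    (h : σ.v x ≠ 0 → WP Y s T Q σ) (h' : σ.v x = 0 → WP Y t T Q σ) :
    WP Y (.ite x s t) (T + c) Q σ := by
  by_cases hx : σ.v x = 0
  · obtain ⟨k, σ', h1, h2, h3⟩ := h' hx
    exact ⟨_, _, .ite_neg hx h1, by omega, h3⟩
  · obtain ⟨k, σ', h1, h2, h3⟩ := h hx
    exact ⟨_, _, .ite_pos hx h1, by omega, h3⟩

/-- The rule for loops; `j` bounds the number of iterations that remain. -/
theorem WP.loop {x : Var} {s : Stmt} {c : ℕ} {T : ℕ → ℕ} {I : ℕ → St → Prop} {Q : St → Prop}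
    {σ₀ : St} 
    (hI : ∀ j σ, Fr s σ₀ σ → I j σ → len (σ.v x) + 7 ≤ c ∧ (σ.v x = 0 → Q σ) ∧
      (σ.v x ≠ 0 → ∃ j', j = j' + 1 ∧ WP Y s (T j') (I j') σ)) :
    ∀ (j : ℕ) (σ : St), Fr s σ₀ σ → I j σ →
      WP Y (.loop x s) (∑ i ∈ Finset.range j, (T i + c) + c) Q σ := by
  intro j
  induction j with
  | zero =>
    intro σ hF h
    obtain ⟨h1, h2, h3⟩ := hI 0 σ hF h
    by_cases hx : σ.v x = 0
    · exact ⟨_, _, .loop_end hx, by simpa using h1, h2 hx⟩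
    · obtain ⟨j', hj, _⟩ := h3 hx
      omega
  | succ j ih =>
    intro σ hF h
    obtain ⟨h1, h2, h3⟩ := hI _ σ hF h
    by_cases hx : σ.v x = 0
    · exact ⟨_, _, .loop_end hx, by omega, h2 hx⟩
    · obtain ⟨j', hj, k, σ', h4, h5, h6⟩ := h3 hx
      obtain rfl : j = j' := by omega
      obtain ⟨k', σ'', h7, h8, h9⟩ := ih σ' (hF.trans h4.frame) h6
      refine ⟨_, _, .loop_step hx h4 h7, ?_, h9⟩
      rw [Finset.sum_range_succ]; omega

/-- The rule for loops that count from `a` up to `b`. -/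
theorem WP.forUp {x : Var} {s : Stmt} {a b c : ℕ} {T : ℕ → ℕ} {J : ℕ → St → Prop} {σ₀ : St}
    (hab : a ≤ b) (h0 : J a σ₀) (hc : len (b - a) + 7 ≤ c)
    (hg : ∀ i σ, J i σ → σ.v x = b - i)
    (hJ : ∀ i σ, a ≤ i → i < b → Fr s σ₀ σ → J i σ → WP Y s (T i) (J (i + 1)) σ) :
    WP Y (.loop x s) (∑ i ∈ Finset.Ico a b, (T i + c) + c) (J b) σ₀ := by
  -- `WP.loop` counts the iterations that remain, so the invariant with j left is `J (b - j)`, and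
  -- the sum of the costs is reversed afterwards.
  have key := WP.loop (Y := Y) (x := x) (s := s) (c := c) (T := fun j => T (b - 1 - j)) (Q := J b)
    (I := fun j σ => j ≤ b - a ∧ J (b - j) σ) (σ₀ := σ₀) ?_ (b - a) σ₀ (.refl _ _)
    ⟨le_rfl, by rwa [show b - (b - a) = a by omega]⟩
  · refine key.mono ?_ (fun _ _ h => h)
    refine Nat.add_le_add_right (le_of_eq ?_) _
    rw [Finset.sum_Ico_eq_sum_range, ← Finset.sum_range_reflect]
    refine Finset.sum_congr rfl fun i hi => ?_
    rw [Finset.mem_range] at hi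
    rw [show b - 1 - (b - a - 1 - i) = a + i by omega]
  · rintro j σ hF ⟨hj, h⟩
    have hx := hg _ _ h
    refine ⟨?_, fun h1 => ?_, fun h1 => ⟨j - 1, by omega, ?_⟩⟩
    · refine le_trans (Nat.add_le_add_right (len_mono ?_) _) hc
      omega
    · rw [show b - j = b by omega] at h
      exact h
    · have := hJ (b - j) σ (by omega) (by omega) hF h
      rw [show b - 1 - (j - 1) = b - j by omega]
      refine this.mono le_rfl fun σ' _ h' => ⟨by omega, ?_⟩
      rwa [show b - (j - 1) = b - j + 1 by omega]

theorem WP.assign {l : List Prim} {T : ℕ} {Q : St → Prop} {σ : St} (b : ℕ) (hb : len b + 2 ≤ Y)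
    (hT : l.length * unit Y b ≤ T) (h : Smalls b l σ) (hQ : Q (runs l σ)) : WP Y (.prims l) T Q σ :=
  (WP.prims b hb h hQ).mono hT fun _ _ h => h

theorem WP.comp {s t : Stmt} {U : ℕ} {Q : St → Prop} {σ : St} (T T' : ℕ) (R : St → Prop)
    (hT : T + T' ≤ U) (h : WP Y s T R σ) (h' : ∀ σ', Fr s σ σ' → R σ' → WP Y t T' Q σ') :
    WP Y (s ;; t) U Q σ :=
  (h.seq h').mono hT fun _ _ h => h

theorem WP.count {x : Var} {s : Stmt} {U : ℕ} {Q : St → Prop} {σ : St} (a b c : ℕ) (T : ℕ → ℕ)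
    (J : ℕ → St → Prop) (hT : ∑ i ∈ Finset.Ico a b, (T i + c) + c ≤ U) (hab : a ≤ b)
    (hc : len (b - a) + 7 ≤ c) (h0 : J a σ) (hg : ∀ i σ, J i σ → σ.v x = b - i)
    (hJ : ∀ i σ', a ≤ i → i < b → Fr s σ σ' → J i σ' → WP Y s (T i) (J (i + 1)) σ')
    (hQ : ∀ σ', Fr s σ σ' → J b σ' → Q σ') : WP Y (.loop x s) U Q σ :=
  (WP.forUp hab h0 hc hg hJ).mono hT hQ

/-- The state in which the variables `i0, …, i3` hold the input, and all else is `0`. -/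
def St.start (input : List ℕ) : St := ⟨fun x => input.getD x.idx 0, fun _ _ => 0⟩

/-- At most four inputs lie in the registers of `i0`, …, `i3`, far below the arrays, which therefore
start out as zero. The answer is read from `i0`, which is register `0`. -/
theorem WP.decides {s : Stmt} {T : ℕ} {input : List ℕ} {p : Prop} (hl : input.length ≤ 4)
    (h : WP Y s T (fun σ => (p → σ.v .i0 = 1) ∧ (¬ p → σ.v .i0 = 0)) (.start input)) :
    DecidesWithin (s.compile 0) input p T := by
  obtain ⟨k, σ', h1, h2, h3⟩ := h
  have hr : Rel (.start input) (init input).mem := by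
    refine ⟨fun x => rfl, fun r i => ?_⟩
    simp only [init, St.start]
    rw [List.getD_eq_default _ _ (by omega)]
  obtain ⟨t, m', h4, h5, h6⟩ := h1.steps (P := s.compile 0) (pos := 0)
    (fun i hi => by simp) hr
  refine ⟨t, ⟨0 + s.size, m'⟩, h5.runs ?_, by exact_mod_cast h4.trans h2, ?_, ?_⟩
  · rw [← Stmt.length_compile s 0]; simp
  · intro hp; have := h6.1 .i0; exact this.trans (h3.1 hp)
  · intro hp; have := h6.1 .i0; exact this.trans (h3.2 hp)

end RAM

namespace RAM

/-! ### Reduction of the digits of a number by divide and conquer -/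

/-- The number with digits `c 0, …, c (l - 1)` in base `W`. -/
def digitSum (W : ℕ) (c : ℕ → ℕ) (l : ℕ) : ℕ := ∑ j ∈ Finset.range l, c j * W ^ j

theorem digitSum_lt {W : ℕ} {c : ℕ → ℕ} {l : ℕ} (h : ∀ j < l, c j < W) : digitSum W c l < W ^ l := by
  induction l with
  | zero => simp [digitSum]
  | succ l ih =>
    have h1 := ih fun j hj => h j (by omega)
    have h2 : (c l + 1) * W ^ l ≤ W * W ^ l := Nat.mul_le_mul_right _ (h l (by omega))
    rw [digitSum, Finset.sum_range_succ]
    rw [digitSum] at h1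
    rw [pow_succ]; linarith

theorem digitSum_add (W : ℕ) (c : ℕ → ℕ) (l l' : ℕ) :
    digitSum W c (l + l') = digitSum W c l + W ^ l * digitSum W (fun j => c (l + j)) l' := by
  rw [digitSum, Finset.sum_range_add, digitSum, digitSum, Finset.mul_sum]
  congr 1
  refine Finset.sum_congr rfl fun j _ => ?_
  rw [pow_add]; ring

theorem digitSum_congr {W : ℕ} {c c' : ℕ → ℕ} {l : ℕ} (h : ∀ j < l, c j = c' j) :
    digitSum W c l = digitSum W c' l :=
  Finset.sum_congr rfl fun j hj => by rw [h j (Finset.mem_range.1 hj)]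

theorem digitSum_injective {W : ℕ} {c c' : ℕ → ℕ} {l : ℕ} (h : ∀ j < l, c j < W) (h' : ∀ j < l, c' j < W)
    (H : digitSum W c l = digitSum W c' l) : ∀ j < l, c j = c' j := by
  induction l with
  | zero => intro j hj; omega
  | succ l ih =>
    have h1 := digitSum_lt fun j hj => h j (Nat.lt_succ_of_lt hj)
    have h2 := digitSum_lt fun j hj => h' j (Nat.lt_succ_of_lt hj)
    have e : ∀ c : ℕ → ℕ, digitSum W c (l + 1) = digitSum W c l + W ^ l * c l := fun c => by
      rw [digitSum, Finset.sum_range_succ, digitSum, mul_comm (W ^ l)]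
    rw [e, e] at H
    have hpos : 0 < W ^ l := by omega
    have hm := congrArg (· % W ^ l) H
    simp only [Nat.add_mul_mod_self_left, Nat.mod_eq_of_lt h1, Nat.mod_eq_of_lt h2] at hm
    rw [hm] at H
    have hl : c l = c' l := Nat.eq_of_mul_eq_mul_left hpos (Nat.add_left_cancel H)
    intro j hj
    rcases Nat.lt_succ_iff_lt_or_eq.1 hj with h3 | rfl
    · exact ih (fun j hj => h j (by omega)) (fun j hj => h' j (by omega)) hm j h3
    · exact hl

/-- The divisor at node `i` of the binary tree with `2 ^ e` leaves; the children of node `i` are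
`2 * i` and `2 * i + 1`. -/
def nodeBase (W e i : ℕ) : ℕ := W ^ 2 ^ (e - 1 - Nat.log 2 i)

/-- The part of the number with digits `c` that belongs to node `i`. -/
def nodeVal (W e : ℕ) (c : ℕ → ℕ) (i : ℕ) : ℕ :=
  digitSum W (fun j => c (i * 2 ^ (e - Nat.log 2 i) - 2 ^ e + j)) (2 ^ (e - Nat.log 2 i))

theorem log_two_mul {i : ℕ} (hi : 0 < i) : Nat.log 2 (2 * i) = Nat.log 2 i + 1 := by
  rw [mul_comm]; exact Nat.log_mul_base (by norm_num) hi.ne'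

theorem log_two_mul_add_one {i : ℕ} (hi : 0 < i) : Nat.log 2 (2 * i + 1) = Nat.log 2 i + 1 := by
  have h : (2 * i + 1) / 2 = i := by omega
  rw [Nat.log_of_one_lt_of_le (by norm_num) (by omega), h]

theorem log_lt_of_lt {i e : ℕ} (hi : 0 < i) (hie : i < 2 ^ e) : Nat.log 2 i < e :=
  (Nat.log_lt_iff_lt_pow (by norm_num) hi.ne').2 hie

theorem log_of_leaf {i e : ℕ} (hi : 2 ^ e ≤ i) (hi' : i < 2 * 2 ^ e) : Nat.log 2 i = e := by
  refine (Nat.log_eq_iff (Or.inr ⟨by norm_num, ?_⟩)).2 ⟨hi, by rw [pow_succ]; omega⟩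
  have := Nat.one_le_two_pow (n := e); omega

theorem nodeBase_leaf {W e i : ℕ} (he : 2 ^ e ≤ 2 * i) (hie : i < 2 ^ e) :
    nodeBase W e i = W := by
  have h1 : Nat.log 2 i = e - 1 := by
    have hi : 0 < i := by have := Nat.one_le_two_pow (n := e); omega
    have h2 := log_two_mul hi
    rw [log_of_leaf he (by omega)] at h2
    omega
  rw [nodeBase, h1, Nat.sub_self, pow_zero, pow_one]

theorem nodeBase_inner {W e i : ℕ} (hi : 0 < i) (hie : 2 * i < 2 ^ e) :
    nodeBase W e i = nodeBase W e (2 * i) * nodeBase W e (2 * i) := by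
  have h2 := log_lt_of_lt (by omega) hie
  rw [log_two_mul hi] at h2
  rw [nodeBase, nodeBase, log_two_mul hi, ← pow_add, ← two_mul, ← pow_succ']
  congr 2; omega

/-- A node owns a block of consecutive digits, and its divisor is W to half the length of the block.
So the remainder belongs to the left child and the quotient to the right child. -/
theorem nodeVal_split {W e : ℕ} {c : ℕ → ℕ} {i : ℕ} (hi : 0 < i) (hie : i < 2 ^ e) :
    nodeVal W e c i = nodeVal W e c (2 * i) + nodeBase W e i * nodeVal W e c (2 * i + 1) := by
  have hl := log_lt_of_lt hi hie
  have hp : 2 ^ (e - Nat.log 2 i) = 2 ^ (e - 1 - Nat.log 2 i) + 2 ^ (e - 1 - Nat.log 2 i) := by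
    rw [← two_mul, ← pow_succ']; congr 1; omega
  have hle : 2 ^ e ≤ i * 2 ^ (e - Nat.log 2 i) := by
    calc 2 ^ e = 2 ^ Nat.log 2 i * 2 ^ (e - Nat.log 2 i) := by rw [← pow_add]; congr 1; omega
      _ ≤ _ := Nat.mul_le_mul_right _ (Nat.pow_log_le_self 2 hi.ne')
  rw [nodeVal, hp, digitSum_add, nodeVal, nodeVal, log_two_mul hi, log_two_mul_add_one hi, nodeBase,
    show e - (Nat.log 2 i + 1) = e - 1 - Nat.log 2 i by omega]
  rw [hp] at hle
  generalize 2 ^ (e - 1 - Nat.log 2 i) = P at *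
  congr 2
  · rw [show i * (P + P) = 2 * i * P by ring]
  · congr 1
    funext j
    congr 1
    rw [show (2 * i + 1) * P = i * (P + P) + P by ring]
    omega

theorem nodeVal_one (W e : ℕ) (c : ℕ → ℕ) : nodeVal W e c 1 = digitSum W c (2 ^ e) := by
  simp [nodeVal]

theorem nodeVal_leaf {W e : ℕ} {c : ℕ → ℕ} {i : ℕ} (hi : 2 ^ e ≤ i) (hi' : i < 2 * 2 ^ e) :
    nodeVal W e c i = c (i - 2 ^ e) := by
  simp [nodeVal, log_of_leaf hi hi', digitSum]

theorem nodeVal_lt {W e : ℕ} {c : ℕ → ℕ} (hc : ∀ j < 2 ^ e, c j < W) {i : ℕ} (hi : 0 < i)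
    (hi' : i < 2 * 2 ^ e) : nodeVal W e c i < W ^ 2 ^ (e - Nat.log 2 i) := by
  refine digitSum_lt fun j hj => hc _ ?_
  have hl : Nat.log 2 i ≤ e := by
    have := log_lt_of_lt (e := e + 1) hi (by rw [pow_succ]; omega); omega
  have h1 : i + 1 ≤ 2 ^ (Nat.log 2 i + 1) := Nat.lt_pow_succ_log_self (by norm_num) i
  have h2 : (i + 1) * 2 ^ (e - Nat.log 2 i) ≤ 2 * 2 ^ e := by
    refine (Nat.mul_le_mul_right _ h1).trans (le_of_eq ?_)
    rw [← pow_add, ← pow_succ']; congr 1; omega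
  have h3 : 2 ^ (e - Nat.log 2 i) ≤ 2 ^ e := Nat.pow_le_pow_right (by norm_num) (Nat.sub_le _ _)
  rw [add_mul] at h2
  omega

theorem nodeVal_lt_nodeBase {W e : ℕ} {c : ℕ → ℕ} (hc : ∀ j < 2 ^ e, c j < W) {i : ℕ} (hi : 0 < i)
    (hi' : i < 2 ^ e) : nodeVal W e c (2 * i) < nodeBase W e i := by
  have := nodeVal_lt hc (i := 2 * i) (by omega) (by omega)
  rwa [log_two_mul hi, show e - (Nat.log 2 i + 1) = e - 1 - Nat.log 2 i by omega] at this

theorem nodeVal_div {W e : ℕ} {c : ℕ → ℕ} (hc : ∀ j < 2 ^ e, c j < W) {i : ℕ} (hi : 0 < i)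
    (hi' : i < 2 ^ e) : nodeVal W e c i / nodeBase W e i = nodeVal W e c (2 * i + 1) := by
  have h := nodeVal_lt_nodeBase hc hi hi'
  rw [nodeVal_split hi hi', Nat.add_mul_div_left _ _ (by omega), Nat.div_eq_of_lt h, zero_add]

theorem nodeVal_sub {W e : ℕ} {c : ℕ → ℕ} {i : ℕ} (hi : 0 < i) (hi' : i < 2 ^ e) :
    nodeVal W e c i - nodeVal W e c (2 * i + 1) * nodeBase W e i = nodeVal W e c (2 * i) := by
  rw [nodeVal_split hi hi', mul_comm (nodeBase W e i), Nat.add_sub_cancel]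

/-- Each level of the tree carries 2^e digits in total. Hence splitting a number into its digits
costs only a factor e over its length, whereas removing the digits one by one would cost a factor
2^e. -/
theorem sum_two_pow_sub_log (e l : ℕ) (hl : l ≤ e) :
    ∑ i ∈ Finset.Ico 1 (2 ^ l), 2 ^ (e - Nat.log 2 i) = l * 2 ^ e := by
  induction l with
  | zero => simp
  | succ l ih =>
    rw [← Finset.sum_Ico_consecutive _ (Nat.one_le_two_pow (n := l))
      (Nat.pow_le_pow_right (by norm_num) (Nat.le_succ l)), ih (by omega)]
    have : ∀ i ∈ Finset.Ico (2 ^ l) (2 ^ (l + 1)), 2 ^ (e - Nat.log 2 i) = 2 ^ (e - l) := by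
      intro i hi
      rw [Finset.mem_Ico] at hi
      rw [log_of_leaf hi.1 (by rw [← pow_succ']; exact hi.2)]
    rw [Finset.sum_congr rfl this, Finset.sum_const, Nat.card_Ico, smul_eq_mul, add_mul, one_mul]
    congr 1
    rw [show 2 ^ (l + 1) - 2 ^ l = 2 ^ l by rw [pow_succ]; omega, ← pow_add]
    congr 1; omega

end RAM

/-! ### Reduction of the coefficients of a packed polynomial. -/

namespace RAM

/-- The parameters of the polynomial arithmetic: the modulus `n`, the number `2 ^ e` of digits of a packed
polynomial, the base `W < 2 ^ w`, and the coefficients for the reduction. -/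
structure Par where
  n : ℕ
  e : ℕ
  W : ℕ
  w : ℕ
  c1 : ℕ
  c2 : ℕ
  c3 : ℕ
  c4 : ℕ

/-- With D = 2^(e-1) the modulus is X^(2D) - c3·X^D - c1, and then X^(3D) is congruent to c4·X^D +
c2; this is the meaning of `c2_eq` and `c4_eq`. The base W is so large that a product of two
polynomials, folded with these coefficients, has digits without carries. -/
structure Par.Ok (p : Par) (Y : ℕ) : Prop where
  n_pos : 0 < p.n
  e_pos : 0 < p.e
  W_eq : p.W = 8 * 2 ^ p.e * p.n ^ 3
  W_lt : p.W < 2 ^ p.w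
  c1_le : p.c1 ≤ p.n
  c2_le : p.c2 ≤ p.n
  c3_le : p.c3 ≤ p.n
  c4_le : p.c4 ≤ p.n
  c2_eq : (p.c2 : ZMod p.n) = p.c3 * p.c1
  c4_eq : (p.c4 : ZMod p.n) = p.c3 ^ 2 + p.c1
  len_le : len (2 * p.w * 2 ^ p.e) + 2 ≤ Y

/-- The constants of the polynomial arithmetic are in place. -/
structure Env (p : Par) (σ : St) : Prop where
  n : σ.v .n = p.n
  ee : σ.v .ee = 2 ^ p.e
  dd : σ.v .dd = 2 ^ (p.e - 1)
  ww : σ.v .ww = p.W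
  one : σ.v .one = 1
  c1 : σ.v .c1 = p.c1
  c2 : σ.v .c2 = p.c2
  c3 : σ.v .c3 = p.c3
  c4 : σ.v .c4 = p.c4
  xx : σ.v .xx = p.W ^ 2 ^ (p.e - 1)
  Q : ∀ i, 0 < i → i < 2 ^ p.e → σ.a .Q i = nodeBase p.W p.e i

def envVars : List Var := [.n, .ee, .dd, .ww, .one, .c1, .c2, .c3, .c4, .xx]

theorem Env.frame {p : Par} {σ σ' : St} {s : Stmt} (h : Env p σ) (hF : Fr s σ σ')
    (hv : ∀ x ∈ envVars, x ∉ s.wr) (hq : Arr.Q ∉ s.awr) : Env p σ' := by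
  have e : ∀ x ∈ envVars, σ'.v x = σ.v x := fun x hx => hF.1 x (hv x hx)
  simp only [envVars, List.forall_mem_cons, List.not_mem_nil, false_imp_iff, implies_true, and_true] at e
  obtain ⟨h1, h2, h3, h4, h5, h6, h7, h8, h9, h10⟩ := e
  exact ⟨h1.trans h.n, h2.trans h.ee, h3.trans h.dd, h4.trans h.ww, h5.trans h.one, h6.trans h.c1,
    h7.trans h.c2, h8.trans h.c3, h9.trans h.c4, h10.trans h.xx, fun i hi hi' => by
      rw [hF.2 _ hq, h.Q i hi hi']⟩

variable {Y : ℕ} {p : Par}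

namespace Par.Ok

variable (hp : p.Ok Y)
include hp

theorem W_pos : 0 < p.W := by rw [hp.W_eq]; have := hp.n_pos; positivity

theorem n_le_W : p.n ≤ p.W := by
  rw [hp.W_eq]
  have h1 : 1 ≤ p.n ^ 2 := Nat.one_le_pow _ _ hp.n_pos
  have h2 : 1 ≤ 2 ^ p.e := Nat.one_le_two_pow
  calc p.n = 1 * 1 * (p.n * 1) := by ring
    _ ≤ 8 * 2 ^ p.e * (p.n * p.n ^ 2) := by gcongr; norm_num
    _ = _ := by ring

theorem E_le_W : 4 * 2 ^ p.e ≤ p.W := by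
  rw [hp.W_eq]
  refine le_trans ?_ (Nat.le_mul_of_pos_right _ (pow_pos hp.n_pos 3))
  omega

theorem w_pos : 0 < p.w := by
  rcases Nat.eq_zero_or_pos p.w with h | h
  · have := hp.W_lt; have := hp.W_pos; rw [h] at *; simp at *; omega
  · exact h

theorem pow_W_le (l : ℕ) : p.W ^ l ≤ 2 ^ (p.w * l) := by
  rw [pow_mul]; exact Nat.pow_le_pow_left hp.W_lt.le _

theorem len_le_of_le {b : ℕ} (hb : b ≤ 2 * p.w * 2 ^ p.e) : len b + 2 ≤ Y :=
  (Nat.add_le_add_right (len_mono hb) 2).trans hp.len_le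

theorem Y_pos : 0 < Y := by have := hp.len_le; omega

/-- The product w·e·2^e·Y² is the unit of account of the polynomial arithmetic: a packed polynomial
has about w·2^e bits, the tree has e levels, and Y² pays for fast multiplication. -/
theorem one_le_cost : 1 ≤ p.w * p.e * 2 ^ p.e * Y ^ 2 :=
  Nat.mul_pos (Nat.mul_pos (Nat.mul_pos hp.w_pos hp.e_pos) (by positivity)) (pow_pos hp.Y_pos 2)

theorem unit_le : unit Y (2 * p.w * 2 ^ p.e) ≤ 600 * (p.w * p.e * 2 ^ p.e * Y ^ 2) := by
  have h1 := hp.e_pos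
  have h2 : 1 ≤ p.w * 2 ^ p.e := Nat.mul_pos hp.w_pos (by positivity)
  calc unit Y (2 * p.w * 2 ^ p.e) = 200 * (2 * (p.w * 2 ^ p.e) + 1) * Y ^ 2 := by unfold unit; ring
    _ ≤ 200 * (2 * (p.w * 2 ^ p.e) + p.w * 2 ^ p.e) * Y ^ 2 := by gcongr
    _ = 600 * (p.w * 1 * 2 ^ p.e * Y ^ 2) := by ring
    _ ≤ _ := by gcongr; exact h1

theorem card_mul_unit_le : 2 ^ p.e * unit Y p.w ≤ 400 * (p.w * p.e * 2 ^ p.e * Y ^ 2) := by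
  have h1 := hp.e_pos
  have h2 := hp.w_pos
  calc 2 ^ p.e * unit Y p.w = 200 * (p.w + 1) * 2 ^ p.e * Y ^ 2 := by unfold unit; ring
    _ ≤ 200 * (p.w + p.w) * 2 ^ p.e * Y ^ 2 := by gcongr; exact h2
    _ = 400 * (p.w * 1 * 2 ^ p.e * Y ^ 2) := by ring
    _ ≤ _ := by gcongr; exact h1

theorem card_mul_add_le : 2 ^ p.e * (p.w + 8) ≤ 9 * (p.w * p.e * 2 ^ p.e * Y ^ 2) := by
  have h1 := hp.e_pos
  have h2 := hp.w_pos
  have h3 : 1 ≤ Y ^ 2 := pow_pos hp.Y_pos 2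
  calc 2 ^ p.e * (p.w + 8) ≤ 2 ^ p.e * (p.w + 8 * p.w) := by gcongr; omega
    _ = 9 * (p.w * 1 * 2 ^ p.e * 1) := by ring
    _ ≤ _ := by gcongr; exact h1

theorem add_le : p.w + 8 ≤ 9 * (p.w * p.e * 2 ^ p.e * Y ^ 2) :=
  (Nat.le_mul_of_pos_left _ (by positivity)).trans hp.card_mul_add_le

theorem sum_unit_le : ∑ i ∈ Finset.Ico 1 (2 ^ p.e), unit Y (p.w * 2 ^ (p.e - Nat.log 2 i)) ≤
    400 * (p.w * p.e * 2 ^ p.e * Y ^ 2) := by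
  have h1 := hp.e_pos
  have h2 := hp.w_pos
  have h3 : 1 ≤ 2 ^ p.e := Nat.one_le_two_pow
  unfold unit
  rw [← Finset.sum_mul, ← Finset.mul_sum, Finset.sum_add_distrib, ← Finset.mul_sum, sum_two_pow_sub_log _ _ le_rfl,
    Finset.sum_const, Nat.card_Ico, smul_eq_mul, mul_one]
  calc 200 * (p.w * (p.e * 2 ^ p.e) + (2 ^ p.e - 1)) * Y ^ 2
      ≤ 200 * (p.w * (p.e * 2 ^ p.e) + p.w * (p.e * 2 ^ p.e)) * Y ^ 2 := by
        gcongr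
        calc 2 ^ p.e - 1 ≤ 1 * (1 * 2 ^ p.e) := by omega
          _ ≤ p.w * (p.e * 2 ^ p.e) := by gcongr <;> assumption
    _ = _ := by ring

end Par.Ok

/-- Splits the number `t` into its digits. -/
def splitDigits : Stmt :=
  .prims [.put .V .one .t, .copy .i .one, .sub .g .ee .i] ;;
  .loop .g (.prims [.get .x .V .i, .get .q .Q .i, .div .h .x .q, .mul .y .h .q, .sub .y .x .y, .add .j .i .i,
    .put .V .j .y, .add .j .j .one, .put .V .j .h, .add .i .i .one, .sub .g .ee .i])

theorem splitDigits_spec (hp : p.Ok Y) {c : ℕ → ℕ} (hc : ∀ j < 2 ^ p.e, c j < p.W) {σ : St} (hE : Env p σ)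
    (ht : σ.v .t = digitSum p.W c (2 ^ p.e)) :
    WP Y splitDigits (8000 * (p.w * p.e * 2 ^ p.e * Y ^ 2))
      (fun σ' => ∀ i, 2 ^ p.e ≤ i → i < 2 * 2 ^ p.e → σ'.a .V i = c (i - 2 ^ p.e)) σ := by
  have hEpos : 1 ≤ 2 ^ p.e := Nat.one_le_two_pow
  have hEw : 4 * 2 ^ p.e < 2 ^ p.w := hp.E_le_W.trans_lt hp.W_lt
  have hpw : ∀ l, 2 ^ p.w ≤ 2 ^ (p.w * 2 ^ l) := fun l =>
    Nat.pow_le_pow_right (by norm_num) (Nat.le_mul_of_pos_right _ (by positivity))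
  have hwpos := hp.w_pos
  have hlen : len (2 ^ p.e - 1) + 7 ≤ p.w + 8 := by
    have := len_le (x := 2 ^ p.e - 1) (b := p.w) (by omega); omega
  refine WP.comp (3 * unit Y (2 * p.w * 2 ^ p.e)) (∑ i ∈ Finset.Ico 1 (2 ^ p.e),
      (11 * unit Y (p.w * 2 ^ (p.e - Nat.log 2 i)) + (p.w + 8)) + (p.w + 8))
    (fun σ1 => σ1.v .i = 1 ∧ σ1.v .g = 2 ^ p.e - 1 ∧ σ1.a .V 1 = digitSum p.W c (2 ^ p.e)) ?_
    (WP.assign (2 * p.w * 2 ^ p.e) (hp.len_le_of_le le_rfl) le_rfl ?_ ?_) ?_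
  · rw [Finset.sum_add_distrib, ← Finset.mul_sum, Finset.sum_const, Nat.card_Ico, smul_eq_mul]
    have h1 := hp.unit_le
    have h2 := hp.sum_unit_le
    have h3 := hp.card_mul_add_le
    have h4 := hp.add_le
    have h5 : (2 ^ p.e - 1) * (p.w + 8) ≤ 2 ^ p.e * (p.w + 8) := Nat.mul_le_mul_right _ (Nat.sub_le _ _)
    linarith
  · have htlt : σ.v .t < 2 ^ (2 * p.w * 2 ^ p.e) := ht ▸ (digitSum_lt hc).trans_le
      ((hp.pow_W_le _).trans (Nat.pow_le_pow_right (by norm_num) (by gcongr; omega)))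
    have := hpw p.e
    have h2 : 2 ^ (p.w * 2 ^ p.e) ≤ 2 ^ (2 * p.w * 2 ^ p.e) :=
      Nat.pow_le_pow_right (by norm_num) (by gcongr; omega)
    simp [hE.one, hE.ee]
    omega
  · simp [hE.one, hE.ee, ht]
  rintro σ1 hF1 ⟨h1, h2, h3⟩
  have hE1 : Env p σ1 := hE.frame hF1 (by decide) (by decide)
  -- The tree is stored like a heap. Before node i is treated, the entries i, …, 2i-1 form the
  -- current frontier; at i = 2^e the frontier consists of the leaves.
  refine WP.count 1 (2 ^ p.e) _ _ (fun i σ' => σ'.v .i = i ∧ σ'.v .g = 2 ^ p.e - i ∧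
      ∀ j, i ≤ j → j < 2 * i → σ'.a .V j = nodeVal p.W p.e c j) le_rfl hEpos hlen ?_ (fun i σ' h => h.2.1) ?_ ?_
  · refine ⟨h1, h2, fun j hj hj' => ?_⟩
    obtain rfl : j = 1 := by omega
    rw [h3, nodeVal_one]
  · rintro i σ2 hi hi' hF2 ⟨h4, h5, h6⟩
    have hE2 : Env p σ2 := hE1.frame hF2 (by decide) (by decide)
    have hdiv := nodeVal_div hc hi hi'
    have hsub := nodeVal_sub (W := p.W) (c := c) hi hi'
    refine WP.assign _ (hp.len_le_of_le ?_) le_rfl ?_ ?_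
    · rw [mul_assoc 2, mul_comm 2, mul_assoc]
      gcongr
      exact (Nat.pow_le_pow_right (by norm_num) (Nat.sub_le _ _)).trans (Nat.le_mul_of_pos_right _ (by norm_num))
    · have hV := (nodeVal_lt hc hi (by omega)).trans_le (hp.pow_W_le _)
      have hQ : nodeBase p.W p.e i < 2 ^ (p.w * 2 ^ (p.e - Nat.log 2 i)) := by
        refine (hp.pow_W_le _).trans_lt (Nat.pow_lt_pow_right (by norm_num) ?_)
        have := log_lt_of_lt hi hi'
        gcongr <;> omega
      have hmul : nodeVal p.W p.e c (2 * i + 1) * nodeBase p.W p.e i ≤ nodeVal p.W p.e c i := by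
        rw [nodeVal_split hi hi', mul_comm]; omega
      have hle : nodeVal p.W p.e c (2 * i + 1) ≤ nodeVal p.W p.e c i := hdiv ▸ Nat.div_le_self _ _
      have hle' : nodeVal p.W p.e c (2 * i) ≤ nodeVal p.W p.e c i := hsub ▸ Nat.sub_le _ _
      have := hpw (p.e - Nat.log 2 i)
      simp [hE2.one, hE2.ee, h4, h6 i le_rfl (by omega), hE2.Q i (by omega) hi', hdiv, hsub]
      omega
    · simp [hE2.one, hE2.ee, h4, h6 i le_rfl (by omega), hE2.Q i (by omega) hi', hdiv, hsub]
      intro j hj hj'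
      rw [← two_mul]
      by_cases hj1 : j = 2 * i + 1
      · simp [hj1]
      by_cases hj2 : j = 2 * i
      · simp [hj2]
      rw [Function.update_of_ne hj1, Function.update_of_ne hj2, h6 j hj.le (by omega)]
  · rintro σ2 hF2 ⟨h4, h5, h6⟩ i hi hi'
    rw [h6 i hi hi', nodeVal_leaf hi hi']

/-- Replaces the digits by their residues modulo `n`. -/
def reduceDigits : Stmt :=
  .prims [.copy .i .ee, .add .r .ee .ee, .sub .g .r .i] ;;
  .loop .g (.prims [.get .x .V .i, .div .h .x .n, .mul .h .h .n, .sub .x .x .h, .put .V .i .x,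
    .add .i .i .one, .sub .g .r .i])

theorem reduceDigits_spec (hp : p.Ok Y) {c : ℕ → ℕ} (hc : ∀ j < 2 ^ p.e, c j < p.W) {σ : St} (hE : Env p σ)
    (hV : ∀ i, 2 ^ p.e ≤ i → i < 2 * 2 ^ p.e → σ.a .V i = c (i - 2 ^ p.e)) :
    WP Y reduceDigits (8000 * (p.w * p.e * 2 ^ p.e * Y ^ 2))
      (fun σ' => ∀ i, 2 ^ p.e ≤ i → i < 2 * 2 ^ p.e → σ'.a .V i = c (i - 2 ^ p.e) % p.n) σ := by
  have hEpos : 1 ≤ 2 ^ p.e := Nat.one_le_two_pow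
  have hEw : 4 * 2 ^ p.e < 2 ^ p.w := hp.E_le_W.trans_lt hp.W_lt
  have hnw : p.n < 2 ^ p.w := hp.n_le_W.trans_lt hp.W_lt
  have hwpos := hp.w_pos
  have hwb : len p.w + 2 ≤ Y := hp.len_le_of_le (by nlinarith)
  have hlen : len (2 * 2 ^ p.e - 2 ^ p.e) + 7 ≤ p.w + 8 := by
    have := len_le (x := 2 * 2 ^ p.e - 2 ^ p.e) (b := p.w) (by omega); omega
  refine WP.comp (3 * unit Y p.w) (∑ i ∈ Finset.Ico (2 ^ p.e) (2 * 2 ^ p.e),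
      (7 * unit Y p.w + (p.w + 8)) + (p.w + 8))
    (fun σ1 => σ1.v .i = 2 ^ p.e ∧ σ1.v .r = 2 * 2 ^ p.e ∧ σ1.v .g = 2 * 2 ^ p.e - 2 ^ p.e ∧ σ1.a .V = σ.a .V) ?_
    (WP.assign p.w hwb le_rfl ?_ ?_) ?_
  · rw [Finset.sum_const, Nat.card_Ico, smul_eq_mul, show 2 * 2 ^ p.e - 2 ^ p.e = 2 ^ p.e by omega]
    have h1 := hp.card_mul_unit_le
    have h3 := hp.card_mul_add_le
    have h4 := hp.add_le
    have h5 : 1 * unit Y p.w ≤ 2 ^ p.e * unit Y p.w := Nat.mul_le_mul_right _ hEpos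
    linarith
  · simp [hE.ee]; omega
  · simp [hE.ee]; omega
  rintro σ1 hF1 ⟨h1, h2, h3, hV1⟩
  have hE1 : Env p σ1 := hE.frame hF1 (by decide) (by decide)
  refine WP.count (2 ^ p.e) (2 * 2 ^ p.e) _ _ (fun i σ' => σ'.v .i = i ∧ σ'.v .g = 2 * 2 ^ p.e - i ∧
      ∀ j, 2 ^ p.e ≤ j → j < 2 * 2 ^ p.e → σ'.a .V j = if j < i then c (j - 2 ^ p.e) % p.n else c (j - 2 ^ p.e))
      le_rfl (by omega) hlen ?_ (fun i σ' h => h.2.1) ?_ ?_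
  · refine ⟨h1, h3, fun j hj hj' => ?_⟩
    rw [hV1, hV j hj hj', if_neg (by omega)]
  · rintro i σ2 hi hi' hF2 ⟨h4, h5, h6⟩
    have hE2 : Env p σ2 := hE1.frame hF2 (by decide) (by decide)
    have hr2 : σ2.v .r = 2 * 2 ^ p.e := (hF2.1 .r (by decide)).trans h2
    have hVi : σ2.a .V i = c (i - 2 ^ p.e) := by rw [h6 i hi hi', if_neg (by omega)]
    have hci : c (i - 2 ^ p.e) < 2 ^ p.w := (hc _ (by omega)).trans hp.W_lt
    have hdm := Nat.div_add_mod (c (i - 2 ^ p.e)) p.n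
    rw [mul_comm] at hdm
    have hdiv := Nat.div_le_self (c (i - 2 ^ p.e)) p.n
    refine WP.assign _ hwb le_rfl ?_ ?_
    · simp [hE2.one, hE2.n, h4, hr2, hVi]
      omega
    · simp [hE2.one, hE2.n, h4, hr2, hVi]
      intro j hj hj'
      by_cases hj1 : j = i
      · subst hj1
        simp
        omega
      · rw [Function.update_of_ne hj1, h6 j hj hj']
        by_cases hj2 : j < i
        · rw [if_pos hj2, if_pos (by omega)]
        · rw [if_neg hj2, if_neg (by omega)]
  · rintro σ2 hF2 ⟨h4, h5, h6⟩ i hi hi'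
    rw [h6 i hi hi', if_pos hi']

/-- Puts the digits together again. -/
def joinDigits : Stmt :=
  .prims [.sub .i .ee .one] ;;
  .loop .i (.prims [.add .j .i .i, .get .x .V .j, .add .j .j .one, .get .y .V .j, .get .q .Q .i, .mul .y .y .q,
    .add .x .x .y, .put .V .i .x, .sub .i .i .one]) ;;
  .prims [.get .t .V .one]

theorem joinDigits_spec (hp : p.Ok Y) {c : ℕ → ℕ} (hc : ∀ j < 2 ^ p.e, c j < p.W) {σ : St} (hE : Env p σ)
    (hV : ∀ i, 2 ^ p.e ≤ i → i < 2 * 2 ^ p.e → σ.a .V i = c (i - 2 ^ p.e)) :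
    WP Y joinDigits (8000 * (p.w * p.e * 2 ^ p.e * Y ^ 2))
      (fun σ' => σ'.v .t = digitSum p.W c (2 ^ p.e)) σ := by
  have hEpos : 1 ≤ 2 ^ p.e := Nat.one_le_two_pow
  have hEw : 4 * 2 ^ p.e < 2 ^ p.w := hp.E_le_W.trans_lt hp.W_lt
  have hpw : ∀ l, 2 ^ p.w ≤ 2 ^ (p.w * 2 ^ l) := fun l =>
    Nat.pow_le_pow_right (by norm_num) (Nat.le_mul_of_pos_right _ (by positivity))
  have hwpos := hp.w_pos
  have hwb : len p.w + 2 ≤ Y := hp.len_le_of_le (by nlinarith)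
  have hlen : len (2 ^ p.e - 1) + 7 ≤ p.w + 8 := by
    have := len_le (x := 2 ^ p.e - 1) (b := p.w) (by omega); omega
  -- The tree is now traversed upwards: step k treats node 2^e - k. Reflecting the index gives the
  -- same total as for the descent.
  have hsum : ∑ i ∈ Finset.Ico 1 (2 ^ p.e), (9 * unit Y (p.w * 2 ^ (p.e - Nat.log 2 (2 ^ p.e - i))) + (p.w + 8)) =
      ∑ i ∈ Finset.Ico 1 (2 ^ p.e), (9 * unit Y (p.w * 2 ^ (p.e - Nat.log 2 i)) + (p.w + 8)) := by
    refine Finset.sum_nbij' (fun i => 2 ^ p.e - i) (fun i => 2 ^ p.e - i) ?_ ?_ ?_ ?_ (fun _ _ => rfl) <;>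
      · intro i hi
        simp only [Finset.mem_Ico] at *
        omega
  refine WP.comp (unit Y p.w) ((∑ i ∈ Finset.Ico 1 (2 ^ p.e),
      (9 * unit Y (p.w * 2 ^ (p.e - Nat.log 2 i)) + (p.w + 8)) + (p.w + 8)) + unit Y (2 * p.w * 2 ^ p.e))
    (fun σ1 => σ1.v .i = 2 ^ p.e - 1 ∧ σ1.a .V = σ.a .V) ?_
    (WP.assign p.w hwb (by simp) ?_ ?_) ?_
  · rw [Finset.sum_add_distrib, ← Finset.mul_sum, Finset.sum_const, Nat.card_Ico, smul_eq_mul]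
    have h1 := hp.unit_le
    have h2 := hp.sum_unit_le
    have h3 := hp.card_mul_add_le
    have h4 := hp.add_le
    have h5 : (2 ^ p.e - 1) * (p.w + 8) ≤ 2 ^ p.e * (p.w + 8) := Nat.mul_le_mul_right _ (Nat.sub_le _ _)
    have h6 := hp.card_mul_unit_le
    have h7 : 1 * unit Y p.w ≤ 2 ^ p.e * unit Y p.w := Nat.mul_le_mul_right _ hEpos
    linarith
  · simp [hE.ee, hE.one]; omega
  · simp [hE.ee, hE.one]
  rintro σ1 hF1 ⟨h1, hV1⟩
  have hE1 : Env p σ1 := hE.frame hF1 (by decide) (by decide)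
  refine WP.comp _ _ (fun σ3 => σ3.a .V 1 = digitSum p.W c (2 ^ p.e)) le_rfl (WP.count 1 (2 ^ p.e) _
      (fun i => 9 * unit Y (p.w * 2 ^ (p.e - Nat.log 2 (2 ^ p.e - i)))) (fun i σ' => σ'.v .i = 2 ^ p.e - i ∧
      ∀ j, 2 ^ p.e - i < j → j ≤ 2 * (2 ^ p.e - i) + 1 → σ'.a .V j = nodeVal p.W p.e c j)
      (by rw [hsum]) hEpos hlen ?_ (fun i σ' h => h.1) ?_ ?_) ?_
  · refine ⟨h1, fun j hj hj' => ?_⟩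
    rw [hV1, hV j (by omega) (by omega), nodeVal_leaf (by omega) (by omega)]
  · rintro k σ2 hk hk' hF2 ⟨h4, h6⟩
    have hE2 : Env p σ2 := hE1.frame hF2 (by decide) (by decide)
    obtain ⟨i, hi⟩ : ∃ i, i = 2 ^ p.e - k := ⟨_, rfl⟩
    rw [← hi] at h4 h6 ⊢
    have hi0 : 0 < i := by omega
    have hi' : i < 2 ^ p.e := by omega
    have hsplit := nodeVal_split (W := p.W) (c := c) hi0 hi'
    rw [two_mul] at hsplit
    refine WP.assign _ (hp.len_le_of_le ?_) le_rfl ?_ ?_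
    · rw [mul_assoc 2, mul_comm 2, mul_assoc]
      gcongr
      exact (Nat.pow_le_pow_right (by norm_num) (Nat.sub_le _ _)).trans (Nat.le_mul_of_pos_right _ (by norm_num))
    · have hV := (nodeVal_lt hc hi0 (by omega)).trans_le (hp.pow_W_le _)
      have hQ : nodeBase p.W p.e i < 2 ^ (p.w * 2 ^ (p.e - Nat.log 2 i)) := by
        refine (hp.pow_W_le _).trans_lt (Nat.pow_lt_pow_right (by norm_num) ?_)
        have := log_lt_of_lt hi0 hi'
        gcongr <;> omega
      have hle : nodeVal p.W p.e c (i + i + 1) ≤ nodeVal p.W p.e c i := by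
        rw [← two_mul, ← nodeVal_div hc hi0 hi']; exact Nat.div_le_self _ _
      have := hpw (p.e - Nat.log 2 i)
      have hcomm := mul_comm (nodeVal p.W p.e c (i + i + 1)) (nodeBase p.W p.e i)
      simp [hE2.one, h4, h6 (i + i) (by omega) (by omega), h6 (i + i + 1) (by omega) (by omega),
        hE2.Q i (by omega) hi']
      omega
    · simp [hE2.one, h4, h6 (i + i) (by omega) (by omega), h6 (i + i + 1) (by omega) (by omega),
        hE2.Q i (by omega) hi', mul_comm _ (nodeBase p.W p.e i)]
      refine ⟨by omega, fun j hj hj' => ?_⟩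
      rw [← hsplit]
      by_cases hj1 : j = i
      · simp [hj1]
      · rw [Function.update_of_ne hj1, h6 j (by omega) (by omega)]
  · rintro σ2 hF2 ⟨h4, h6⟩
    rw [h6 1 (by omega) (by omega), nodeVal_one]
  · intro σ3 hF3 h3
    have hE3 : Env p σ3 := hE1.frame hF3 (by decide) (by decide)
    have hlt : digitSum p.W c (2 ^ p.e) < 2 ^ (2 * p.w * 2 ^ p.e) := (digitSum_lt hc).trans_le
      ((hp.pow_W_le _).trans (Nat.pow_le_pow_right (by norm_num) (by gcongr; omega)))
    refine WP.assign (2 * p.w * 2 ^ p.e) (hp.len_le_of_le le_rfl) (by simp) ?_ ?_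
    · simp [hE3.one, h3, hlt, hwpos.ne']
    · simp [hE3.one, h3]

/-- Replaces the digits of the number `t` by their residues modulo `n`. -/
def normDigits : Stmt := splitDigits ;; reduceDigits ;; joinDigits

theorem normDigits_spec (hp : p.Ok Y) {c : ℕ → ℕ} (hc : ∀ j < 2 ^ p.e, c j < p.W) {σ : St} (hE : Env p σ)
    (ht : σ.v .t = digitSum p.W c (2 ^ p.e)) :
    WP Y normDigits (24000 * (p.w * p.e * 2 ^ p.e * Y ^ 2))
      (fun σ' => σ'.v .t = digitSum p.W (fun j => c j % p.n) (2 ^ p.e)) σ := by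
  refine WP.comp _ (16000 * (p.w * p.e * 2 ^ p.e * Y ^ 2)) _ ?_ (splitDigits_spec hp hc hE ht)
    fun σ1 hF1 h1 => ?_
  · linarith
  have hE1 := hE.frame hF1 (by decide) (by decide)
  refine WP.comp _ (8000 * (p.w * p.e * 2 ^ p.e * Y ^ 2)) _ ?_ (reduceDigits_spec hp hc hE1 h1)
    fun σ2 hF2 h2 => ?_
  · linarith
  have hE2 := hE1.frame hF2 (by decide) (by decide)
  exact joinDigits_spec hp (c := fun j => c j % p.n) (fun j hj => (Nat.mod_le _ _).trans_lt (hc j hj)) hE2 h2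

end RAM

/-! ### Multiplication of polynomials by Kronecker substitution. -/

namespace RAM

open Polynomial

variable {Y : ℕ} {p : Par}

/-- The polynomial modulo `n` with coefficients `c 0, …, c (l - 1)`. -/
noncomputable def polyOf (n : ℕ) (c : ℕ → ℕ) (l : ℕ) : (ZMod n)[X] :=
  ∑ j ∈ Finset.range l, C (c j : ZMod n) * X ^ j

theorem polyOf_add (n : ℕ) (c : ℕ → ℕ) (l l' : ℕ) :
    polyOf n c (l + l') = polyOf n c l + X ^ l * polyOf n (fun j => c (l + j)) l' := by
  rw [polyOf, Finset.sum_range_add, polyOf, polyOf, Finset.mul_sum]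
  congr 1
  refine Finset.sum_congr rfl fun j _ => ?_
  rw [pow_add]; ring

theorem coeff_polyOf (n : ℕ) (c : ℕ → ℕ) (l j : ℕ) :
    (polyOf n c l).coeff j = if j < l then (c j : ZMod n) else 0 := by
  simp [polyOf, finsetSum_coeff, coeff_X_pow]

theorem degree_polyOf_lt (n : ℕ) (c : ℕ → ℕ) (l : ℕ) : (polyOf n c l).degree < l := by
  rw [degree_lt_iff_coeff_zero]
  intro j hj
  rw [coeff_polyOf, if_neg (by omega)]

/-- The modulus of the polynomial arithmetic. -/
noncomputable def Par.modulus (p : Par) : (ZMod p.n)[X] :=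
  X ^ 2 ^ p.e - C (p.c3 : ZMod p.n) * X ^ 2 ^ (p.e - 1) - C (p.c1 : ZMod p.n)

theorem Par.Ok.half_lt (hp : p.Ok Y) : 2 ^ (p.e - 1) < 2 ^ p.e :=
  Nat.pow_lt_pow_right (by norm_num) (Nat.sub_lt hp.e_pos one_pos)

theorem Par.Ok.two_mul_half (hp : p.Ok Y) : 2 ^ p.e = 2 ^ (p.e - 1) + 2 ^ (p.e - 1) := by
  rw [← two_mul, ← pow_succ', Nat.sub_add_cancel hp.e_pos]

theorem Par.Ok.modulus_tail_degree (hp : p.Ok Y) :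
    (C (p.c3 : ZMod p.n) * X ^ 2 ^ (p.e - 1) + C (p.c1 : ZMod p.n)).degree < ((2 ^ p.e : ℕ) : WithBot ℕ) := by
  refine (degree_add_le _ _).trans_lt (max_lt ?_ ?_)
  · exact (degree_C_mul_X_pow_le _ _).trans_lt (by exact_mod_cast hp.half_lt)
  · exact degree_C_le.trans_lt (by exact_mod_cast Nat.two_pow_pos p.e)

theorem Par.modulus_eq (p : Par) : p.modulus = X ^ 2 ^ p.e -
    (C (p.c3 : ZMod p.n) * X ^ 2 ^ (p.e - 1) + C (p.c1 : ZMod p.n)) := by rw [modulus, sub_sub]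

theorem Par.Ok.monic (hp : p.Ok Y) : p.modulus.Monic := by
  rw [p.modulus_eq]
  exact monic_X_pow_sub (by
    have := hp.modulus_tail_degree
    exact this)

theorem Par.Ok.degree (hp : p.Ok Y) [Nontrivial (ZMod p.n)] : p.modulus.degree = (2 ^ p.e : ℕ) := by
  rw [p.modulus_eq, degree_sub_eq_left_of_degree_lt]
  · exact degree_X_pow _
  · rw [degree_X_pow]; exact hp.modulus_tail_degree

/-- The number that represents a polynomial modulo `n` of degree less than `2 ^ e`. -/
def Par.pack (p : Par) (f : (ZMod p.n)[X]) : ℕ := digitSum p.W (fun j => (f.coeff j).val) (2 ^ p.e)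

theorem Par.Ok.val_lt (hp : p.Ok Y) (a : ZMod p.n) : a.val < p.n := by
  have : NeZero p.n := ⟨hp.n_pos.ne'⟩
  exact ZMod.val_lt a

/-- Because of this a polynomial identity can be tested by comparing two integers. -/
theorem Par.Ok.pack_injective (hp : p.Ok Y) {f g : (ZMod p.n)[X]} (hf : f.degree < (2 ^ p.e : ℕ))
    (hg : g.degree < (2 ^ p.e : ℕ)) (h : p.pack f = p.pack g) : f = g := by
  have : NeZero p.n := ⟨hp.n_pos.ne'⟩
  ext j
  by_cases hj : j < 2 ^ p.e
  · exact ZMod.val_injective _ (digitSum_injective (fun j _ => (hp.val_lt _).trans_le hp.n_le_W)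
      (fun j _ => (hp.val_lt _).trans_le hp.n_le_W) h j hj)
  · rw [(degree_lt_iff_coeff_zero _ _).1 hf j (by omega), (degree_lt_iff_coeff_zero _ _).1 hg j (by omega)]

theorem Par.Ok.pack_lt (hp : p.Ok Y) (f : (ZMod p.n)[X]) : p.pack f < p.W ^ 2 ^ p.e :=
  digitSum_lt fun _ _ => (hp.val_lt _).trans_le hp.n_le_W

theorem Par.pack_polyOf (p : Par) (c : ℕ → ℕ) :
    p.pack (polyOf p.n c (2 ^ p.e)) = digitSum p.W (fun j => c j % p.n) (2 ^ p.e) :=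
  digitSum_congr fun j hj => by rw [coeff_polyOf, if_pos hj, ZMod.val_natCast]

/-- The lift of a polynomial to natural numbers. -/
noncomputable def natLift {n : ℕ} (f : (ZMod n)[X]) (l : ℕ) : ℕ[X] :=
  ∑ j ∈ Finset.range l, C (f.coeff j).val * X ^ j

theorem coeff_natLift {n : ℕ} (f : (ZMod n)[X]) (l j : ℕ) :
    (natLift f l).coeff j = if j < l then (f.coeff j).val else 0 := by
  simp [natLift, finsetSum_coeff, coeff_X_pow]

theorem eval_natLift {n : ℕ} (f : (ZMod n)[X]) (l W : ℕ) :
    (natLift f l).eval W = digitSum W (fun j => (f.coeff j).val) l := by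
  simp [natLift, eval_finsetSum, digitSum]

theorem map_natLift {n : ℕ} [NeZero n] {f : (ZMod n)[X]} {l : ℕ} (hf : f.degree < l) :
    (natLift f l).map (Nat.castRingHom (ZMod n)) = f := by
  ext j
  rw [coeff_map, coeff_natLift]
  split_ifs with h
  · simp
  · rw [(degree_lt_iff_coeff_zero _ _).1 hf j (by omega)]; simp

/-- The digits of the product of two packed polynomials. -/
noncomputable def prodDigits {n : ℕ} (f g : (ZMod n)[X]) (l k : ℕ) : ℕ := (natLift f l * natLift g l).coeff k

/-- A coefficient of the product is a sum of k+1 ≤ 2l terms, each at most n². -/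
theorem prodDigits_le {n : ℕ} [NeZero n] (f g : (ZMod n)[X]) (l k : ℕ) (hk : k < 2 * l) :
    prodDigits f g l k ≤ 2 * l * n ^ 2 := by
  rw [prodDigits, coeff_mul]
  refine (Finset.sum_le_sum (g := fun _ => n ^ 2) fun x _ => ?_).trans ?_
  · rw [pow_two, coeff_natLift, coeff_natLift]
    refine Nat.mul_le_mul ?_ ?_ <;> split_ifs <;> first | exact (ZMod.val_lt _).le | exact Nat.zero_le _
  · rw [Finset.sum_const, smul_eq_mul, Finset.Nat.card_antidiagonal]; gcongr; omega

theorem natDegree_natLift_lt {n : ℕ} (f : (ZMod n)[X]) {l : ℕ} (hl : 0 < l) : (natLift f l).natDegree < l := by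
  refine (Nat.lt_iff_le_pred hl).2 (natDegree_le_iff_coeff_eq_zero.2 fun j hj => ?_)
  rw [coeff_natLift, if_neg (by omega)]

/-- Evaluation at W is multiplicative, so one multiplication of integers performs the whole
multiplication of polynomials. -/
theorem digitSum_prodDigits {n : ℕ} (f g : (ZMod n)[X]) {l : ℕ} (hl : 0 < l) (W : ℕ) :
    digitSum W (prodDigits f g l) (l + l) =
      digitSum W (fun j => (f.coeff j).val) l * digitSum W (fun j => (g.coeff j).val) l := by
  rw [← eval_natLift, ← eval_natLift, ← eval_mul, eval_eq_sum_range' (n := l + l)]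
  · rfl
  · have := natDegree_natLift_lt f hl
    have := natDegree_natLift_lt g hl
    exact natDegree_mul_le.trans_lt (by omega)

theorem polyOf_prodDigits {n : ℕ} [NeZero n] {f g : (ZMod n)[X]} {l : ℕ} (hl : 0 < l) (hf : f.degree < l)
    (hg : g.degree < l) : polyOf n (prodDigits f g l) (l + l) = f * g := by
  nth_rewrite 2 [← map_natLift hf]
  nth_rewrite 2 [← map_natLift hg]
  rw [← Polynomial.map_mul]
  ext k
  rw [coeff_polyOf, coeff_map]
  split_ifs with h
  · rfl
  · have := natDegree_natLift_lt f hl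
    have := natDegree_natLift_lt g hl
    rw [coeff_eq_zero_of_natDegree_lt (natDegree_mul_le.trans_lt (by omega : _ < k))]
    simp

/-- The digits after the reduction of a product modulo the modulus. -/
def Par.foldDigits (p : Par) (c : ℕ → ℕ) (j : ℕ) : ℕ :=
  if j < 2 ^ (p.e - 1) then
    c j + p.c1 * c (2 ^ p.e + j) + p.c2 * c (2 ^ p.e + 2 ^ (p.e - 1) + j)
  else c j + p.c3 * c (2 ^ (p.e - 1) + j) + p.c4 * c (2 ^ p.e + j)

theorem digitSum_foldDigits (hp : p.Ok Y) (c : ℕ → ℕ) {D : ℕ} (hD : D = 2 ^ (p.e - 1)) :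
    digitSum p.W (p.foldDigits c) (2 ^ p.e) =
      digitSum p.W c D + p.c1 * digitSum p.W (fun j => c (D + D + j)) D +
        p.c2 * digitSum p.W (fun j => c (D + D + (D + j))) D +
      p.W ^ D * (digitSum p.W (fun j => c (D + j)) D + p.c3 * digitSum p.W (fun j => c (D + D + j)) D +
        p.c4 * digitSum p.W (fun j => c (D + D + (D + j))) D) := by
  have hE : 2 ^ p.e = D + D := hD ▸ hp.two_mul_half
  rw [hE, digitSum_add]
  congr 1
  · simp only [digitSum, Finset.mul_sum, ← Finset.sum_add_distrib]
    refine Finset.sum_congr rfl fun j hj => ?_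
    rw [Finset.mem_range] at hj
    rw [Par.foldDigits, hE, ← hD, if_pos hj, add_assoc (D + D)]
    ring
  · congr 1
    simp only [digitSum, Finset.mul_sum, ← Finset.sum_add_distrib]
    refine Finset.sum_congr rfl fun j hj => ?_
    rw [Par.foldDigits, hE, ← hD, if_neg (by omega), ← add_assoc D D j]
    ring

theorem polyOf_foldDigits (hp : p.Ok Y) (c : ℕ → ℕ) {D : ℕ} (hD : D = 2 ^ (p.e - 1)) :
    polyOf p.n (p.foldDigits c) (2 ^ p.e) =
      polyOf p.n c D + C (p.c1 : ZMod p.n) * polyOf p.n (fun j => c (D + D + j)) D +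
        C (p.c2 : ZMod p.n) * polyOf p.n (fun j => c (D + D + (D + j))) D +
      X ^ D * (polyOf p.n (fun j => c (D + j)) D + C (p.c3 : ZMod p.n) * polyOf p.n (fun j => c (D + D + j)) D +
        C (p.c4 : ZMod p.n) * polyOf p.n (fun j => c (D + D + (D + j))) D) := by
  have hE : 2 ^ p.e = D + D := hD ▸ hp.two_mul_half
  rw [hE, polyOf_add]
  congr 1
  · simp only [polyOf, Finset.mul_sum, ← Finset.sum_add_distrib]
    refine Finset.sum_congr rfl fun j hj => ?_
    rw [Finset.mem_range] at hj
    rw [Par.foldDigits, hE, ← hD, if_pos hj, add_assoc (D + D)]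
    push_cast
    simp only [C_add, C_mul]
    ring
  · congr 1
    simp only [polyOf, Finset.mul_sum, ← Finset.sum_add_distrib]
    refine Finset.sum_congr rfl fun j hj => ?_
    rw [Par.foldDigits, hE, ← hD, if_neg (by omega), ← add_assoc D D j]
    push_cast
    simp only [C_add, C_mul]
    ring

/-- Cut the coefficients into blocks B₀, …, B₃ of length D. The quotient is B₂ + B₃·(X^D + c3), and
the remainder is determined by the uniqueness of division by a monic polynomial. -/
theorem polyOf_modByMonic (hp : p.Ok Y) [Nontrivial (ZMod p.n)] (c : ℕ → ℕ) :
    polyOf p.n c (2 ^ p.e + 2 ^ p.e) %ₘ p.modulus = polyOf p.n (p.foldDigits c) (2 ^ p.e) := by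
  obtain ⟨D, hD⟩ : ∃ D, D = 2 ^ (p.e - 1) := ⟨_, rfl⟩
  have hE : 2 ^ p.e = D + D := hD ▸ hp.two_mul_half
  have hcomp : ∀ j, D + (D + (D + j)) = D + D + (D + j) := fun j => by ring
  have h2 : (C (p.c2 : ZMod p.n)) = C (p.c3 : ZMod p.n) * C (p.c1 : ZMod p.n) := by rw [hp.c2_eq, C_mul]
  have h4 : (C (p.c4 : ZMod p.n)) = C (p.c3 : ZMod p.n) ^ 2 + C (p.c1 : ZMod p.n) := by
    rw [hp.c4_eq, C_add, C_pow]
  refine (div_modByMonic_unique (polyOf p.n (fun j => c (D + D + j)) D +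
    polyOf p.n (fun j => c (D + D + (D + j))) D * (X ^ D + C (p.c3 : ZMod p.n))) _ hp.monic ⟨?_, ?_⟩).2
  · rw [polyOf_foldDigits hp c hD, hE, polyOf_add _ _ (D + D) (D + D), polyOf_add _ c D D, polyOf_add _ _ D D,
      Par.modulus, hE, ← hD, h2, h4, pow_add]
    ring
  · rw [hp.degree]; exact degree_polyOf_lt _ _ _

/-- Multiplies the polynomials represented by `a` and `b`; the result is in `t`. -/
def mulMod (a b : Var) : Stmt :=
  .prims [.mul .t a b, .div .h .t .xx, .mul .y .h .xx, .sub .x .t .y,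
    .div .q .h .xx, .mul .y .q .xx, .sub .y .h .y, .div .z .q .xx, .mul .h .z .xx, .sub .h .q .h,
    .mul .t1 .c1 .h, .add .x .x .t1, .mul .t1 .c2 .z, .add .x .x .t1,
    .mul .t1 .c3 .h, .add .y .y .t1, .mul .t1 .c4 .z, .add .y .y .t1,
    .mul .y .y .xx, .add .t .x .y] ;; normDigits

/-- Each digit is at most 2·2^e·n²·(1 + 2n), which is at most 5·2^e·n³ for n ≥ 2; the factor 8 in W
leaves room for this. -/
theorem foldDigits_lt (hp : p.Ok Y) (hn : 2 ≤ p.n) {c : ℕ → ℕ}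
    (hc : ∀ k < 2 * 2 ^ p.e, c k ≤ 2 * 2 ^ p.e * p.n ^ 2) (j : ℕ) (hj : j < 2 ^ p.e) : p.foldDigits c j < p.W := by
  have hE := hp.two_mul_half
  have h1 : p.n ^ 2 * 2 ≤ p.n ^ 3 := by rw [pow_succ p.n 2]; gcongr
  have hb : ∀ a b x y z, a ≤ p.n → b ≤ p.n → x ≤ 2 * 2 ^ p.e * p.n ^ 2 → y ≤ 2 * 2 ^ p.e * p.n ^ 2 →
      z ≤ 2 * 2 ^ p.e * p.n ^ 2 → x + a * y + b * z < p.W := by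
    intro a b x y z ha hb hx hy hz
    have h2 : a * y ≤ p.n * (2 * 2 ^ p.e * p.n ^ 2) := Nat.mul_le_mul ha hy
    have h3 : b * z ≤ p.n * (2 * 2 ^ p.e * p.n ^ 2) := Nat.mul_le_mul hb hz
    have h4 : p.n * (2 * 2 ^ p.e * p.n ^ 2) = 2 * (2 ^ p.e * p.n ^ 3) := by ring
    have h5 : p.W = 8 * (2 ^ p.e * p.n ^ 3) := by rw [hp.W_eq]; ring
    have h6 : 2 * 2 ^ p.e * p.n ^ 2 ≤ 2 ^ p.e * p.n ^ 3 := by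
      calc 2 * 2 ^ p.e * p.n ^ 2 = 2 ^ p.e * (p.n ^ 2 * 2) := by ring
        _ ≤ _ := Nat.mul_le_mul_left _ h1
    have h7 : 0 < 2 ^ p.e * p.n ^ 3 := by have := hp.n_pos; positivity
    omega
  unfold Par.foldDigits
  split_ifs with h
  · exact hb _ _ _ _ _ hp.c1_le hp.c2_le (hc _ (by omega)) (hc _ (by omega)) (hc _ (by omega))
  · exact hb _ _ _ _ _ hp.c3_le hp.c4_le (hc _ (by omega)) (hc _ (by omega)) (hc _ (by omega))

/-- With U = W^D, every number that occurs in `mulMod` is below U⁴, hence has at most twice the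
length of a packed polynomial. The products are estimated first and then replaced by variables,
which leaves linear arithmetic. -/
theorem mulMod_small {n c1 c2 c3 c4 U a b B0 B1 B2 B3 M : ℕ} (hn : 0 < n) (h1 : c1 ≤ n) (h2 : c2 ≤ n)
    (h3 : c3 ≤ n) (h4 : c4 ≤ n) (hU : 2 * n + 1 ≤ U) (ha : a < U * U) (hb : b < U * U) (hB0 : B0 < U) (hB1 : B1 < U)
    (hB2 : B2 < U) (hB3 : B3 < U) (hM : U * U * (U * U) ≤ M) :
    (a < M ∧ b < M) ∧ (B0 + U * B1 + U * U * (B2 + U * B3) < M ∧ U < M) ∧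
      (B1 + U * (B2 + U * B3) < M ∧ U < M) ∧
      (B0 + U * B1 + U * U * (B2 + U * B3) < M ∧ (B1 + U * (B2 + U * B3)) * U < M) ∧
      (B1 + U * (B2 + U * B3) < M ∧ U < M) ∧ (B2 + U * B3 < M ∧ U < M) ∧
      (B1 + U * (B2 + U * B3) < M ∧ (B2 + U * B3) * U < M) ∧ (B2 + U * B3 < M ∧ U < M) ∧ (B3 < M ∧ U < M) ∧
      (B2 + U * B3 < M ∧ B3 * U < M) ∧ (c1 < M ∧ B2 < M) ∧ (B0 < M ∧ c1 * B2 < M) ∧ (c2 < M ∧ B3 < M) ∧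
      (B0 + c1 * B2 < M ∧ c2 * B3 < M) ∧ (c3 < M ∧ B2 < M) ∧ (B1 < M ∧ c3 * B2 < M) ∧ (c4 < M ∧ B3 < M) ∧
      (B1 + c3 * B2 < M ∧ c4 * B3 < M) ∧ (B1 + c3 * B2 + c4 * B3 < M ∧ U < M) ∧
      B0 + c1 * B2 + c2 * B3 < M ∧ (B1 + c3 * B2 + c4 * B3) * U < M := by
  have k1 : c1 * B2 ≤ n * U := Nat.mul_le_mul h1 hB2.le
  have k2 : c2 * B3 ≤ n * U := Nat.mul_le_mul h2 hB3.le
  have k3 : c3 * B2 ≤ n * U := Nat.mul_le_mul h3 hB2.le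
  have k4 : c4 * B3 ≤ n * U := Nat.mul_le_mul h4 hB3.le
  have u1 : U + 2 * (n * U) ≤ U * U := by
    calc U + 2 * (n * U) = (2 * n + 1) * U := by ring
      _ ≤ _ := Nat.mul_le_mul_right _ hU
  have u2 : U * U ≤ U * U * U := Nat.le_mul_of_pos_right _ (by omega)
  have u3 : U * U * U * 2 ≤ U * U * (U * U) := by
    rw [← mul_assoc]; exact Nat.mul_le_mul_left _ (by omega)
  have u4 : U ≤ U * U := Nat.le_mul_of_pos_right _ (by omega)
  have q3 : B2 + U * B3 < U * U := by
    calc B2 + U * B3 < U + U * B3 := by omega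
      _ = U * (B3 + 1) := by ring
      _ ≤ _ := Nat.mul_le_mul_left _ hB3
  have q2 : B1 + U * (B2 + U * B3) < U * U * U := by
    calc B1 + U * (B2 + U * B3) < U + U * (B2 + U * B3) := by omega
      _ = (B2 + U * B3 + 1) * U := by ring
      _ ≤ _ := Nat.mul_le_mul_right _ q3
  have q1 : B0 + U * B1 + U * U * (B2 + U * B3) < U * U * (U * U) := by
    calc B0 + U * B1 + U * U * (B2 + U * B3) < U + U * B1 + U * U * (B2 + U * B3) := by omega
      _ = (B1 + U * (B2 + U * B3) + 1) * U := by ring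
      _ ≤ U * U * U * U := Nat.mul_le_mul_right _ q2
      _ = _ := by ring
  have q0 : (B1 + U * (B2 + U * B3)) * U ≤ B0 + U * B1 + U * U * (B2 + U * B3) := by
    calc _ = U * B1 + U * U * (B2 + U * B3) := by ring
      _ ≤ _ := by omega
  have r2 : (B2 + U * B3) * U ≤ B1 + U * (B2 + U * B3) := by rw [mul_comm]; omega
  have r3 : B3 * U ≤ B2 + U * B3 := by rw [mul_comm]; omega
  have r4 : (B1 + c3 * B2 + c4 * B3) * U ≤ U * U * U := Nat.mul_le_mul_right _ (by omega)
  have hpos : 0 < U * U * U := by have : 0 < U := by omega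
                                  positivity
  generalize U * U * (U * U) = U4 at *
  generalize U * U * U = U3 at *
  generalize (B1 + c3 * B2 + c4 * B3) * U = z1 at *
  generalize (B1 + U * (B2 + U * B3)) * U = z2 at *
  generalize (B2 + U * B3) * U = z3 at *
  generalize B0 + U * B1 + U * U * (B2 + U * B3) = z4 at *
  generalize B1 + U * (B2 + U * B3) = z5 at *
  generalize B2 + U * B3 = z6 at *
  generalize B3 * U = z7 at *
  generalize U * U = U2 at *
  generalize n * U = z8 at *
  generalize c1 * B2 = y1 at *
  generalize c2 * B3 = y2 at *
  generalize c3 * B2 = y3 at *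
  generalize c4 * B3 = y4 at *
  omega

theorem mulMod_spec (hp : p.Ok Y) (hn : 2 ≤ p.n) {f g : (ZMod p.n)[X]} (hf : f.degree < (2 ^ p.e : ℕ))
    (hg : g.degree < (2 ^ p.e : ℕ)) {σ : St} (hE : Env p σ) {a b : Var} (ha : σ.v a = p.pack f)
    (hb : σ.v b = p.pack g) :
    WP Y (mulMod a b) (36000 * (p.w * p.e * 2 ^ p.e * Y ^ 2))
      (fun σ' => σ'.v .t = p.pack (f * g %ₘ p.modulus)) σ := by
  have : NeZero p.n := ⟨hp.n_pos.ne'⟩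
  have : Fact (1 < p.n) := ⟨hn⟩
  have hE0 : 0 < 2 ^ p.e := by positivity
  obtain ⟨D, hD⟩ : ∃ D, D = 2 ^ (p.e - 1) := ⟨_, rfl⟩
  have hEE : 2 ^ p.e = D + D := hD ▸ hp.two_mul_half
  set c := prodDigits f g (2 ^ p.e) with hcdef
  have hc : ∀ k < 2 * 2 ^ p.e, c k ≤ 2 * 2 ^ p.e * p.n ^ 2 := fun k hk => prodDigits_le f g _ k hk
  have hcW : ∀ k < 2 * 2 ^ p.e, c k < p.W := fun k hk => by
    have h1 := hc k hk
    have h2 : 2 * 2 ^ p.e * p.n ^ 2 < 8 * 2 ^ p.e * p.n ^ 3 := by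
      have : p.n ^ 2 ≤ p.n ^ 3 := Nat.pow_le_pow_right hp.n_pos (by norm_num)
      have h3 : 0 < p.n ^ 3 := pow_pos hp.n_pos 3
      nlinarith
    rw [← hp.W_eq] at h2
    omega
  have hfold := foldDigits_lt hp hn hc
  have hres : p.pack (f * g %ₘ p.modulus) = digitSum p.W (fun j => p.foldDigits c j % p.n) (2 ^ p.e) := by
    rw [← polyOf_prodDigits hE0 hf hg, polyOf_modByMonic hp, Par.pack_polyOf]
  rw [hres]
  refine WP.comp (20 * unit Y (2 * p.w * 2 ^ p.e)) (24000 * (p.w * p.e * 2 ^ p.e * Y ^ 2))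
    (fun σ1 => σ1.v .t = digitSum p.W (p.foldDigits c) (2 ^ p.e)) ?_
    (WP.assign (2 * p.w * 2 ^ p.e) (hp.len_le_of_le le_rfl) le_rfl ?_ ?_) ?_
  · have := hp.unit_le; linarith
  rotate_right
  · intro σ1 hF1 h1
    exact normDigits_spec hp hfold (hE.frame hF1 (by simp [envVars, Stmt.wr, Prim.wr])
      (by simp [Stmt.awr, Prim.awr])) h1
  all_goals
    have hX : σ.v .xx = p.W ^ D := by rw [hE.xx, hD]
    have hprod : σ.v a * σ.v b = digitSum p.W c (D + D + (D + D)) := by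
      rw [ha, hb, Par.pack, Par.pack, ← digitSum_prodDigits f g hE0, ← hcdef, hEE]
    rw [digitSum_add _ _ (D + D) (D + D), digitSum_add _ c D D, digitSum_add _ _ D D, pow_add] at hprod
    have hfd := digitSum_foldDigits hp c hD
    have hlt : ∀ s, s + D ≤ 2 * 2 ^ p.e → digitSum p.W (fun j => c (s + j)) D < p.W ^ D := fun s hs =>
      digitSum_lt fun j hj => hcW _ (by omega)
    have hB0 := hlt 0 (by omega)
    have hB1 := hlt D (by omega)
    have hB2 := hlt (D + D) (by omega)
    have hB3 := hlt (D + D + D) (by omega)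
    simp only [zero_add, add_assoc (D + D) D] at hB0 hB3
    have hUU : p.W ^ D * p.W ^ D = p.W ^ 2 ^ p.e := by rw [← pow_add, hEE]
    have hU : 2 * p.n + 1 ≤ p.W ^ D := by
      have h1 : p.W ^ 1 ≤ p.W ^ D := Nat.pow_le_pow_right hp.W_pos (hD ▸ Nat.one_le_two_pow)
      have h2 : 8 * 1 * p.n ^ 1 ≤ p.W := by
        rw [hp.W_eq]
        gcongr
        · exact Nat.one_le_two_pow
        · exact hp.n_pos
        · norm_num
      rw [pow_one] at h1 h2
      omega
    have hM : p.W ^ D * p.W ^ D * (p.W ^ D * p.W ^ D) ≤ 2 ^ (2 * p.w * 2 ^ p.e) := by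
      rw [hUU, show 2 * p.w * 2 ^ p.e = p.w * 2 ^ p.e + p.w * 2 ^ p.e by ring, pow_add]
      exact Nat.mul_le_mul (hp.pow_W_le _) (hp.pow_W_le _)
    have haU : σ.v a < p.W ^ D * p.W ^ D := by rw [hUU, ha]; exact hp.pack_lt f
    have hbU : σ.v b < p.W ^ D * p.W ^ D := by rw [hUU, hb]; exact hp.pack_lt g
    clear hUU
    generalize digitSum p.W c D = B0 at *
    generalize digitSum p.W (fun j => c (D + j)) D = B1 at *
    generalize digitSum p.W (fun j => c (D + D + j)) D = B2 at *
    generalize digitSum p.W (fun j => c (D + D + (D + j))) D = B3 at *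
    generalize p.W ^ D = U at *
    have d1 : (B0 + U * B1 + U * U * (B2 + U * B3)) / U = B1 + U * (B2 + U * B3) := by
      rw [show B0 + U * B1 + U * U * (B2 + U * B3) = B0 + U * (B1 + U * (B2 + U * B3)) by ring,
        Nat.add_mul_div_left _ _ (by omega), Nat.div_eq_of_lt hB0, zero_add]
    have s1 : B0 + U * B1 + U * U * (B2 + U * B3) - (B1 + U * (B2 + U * B3)) * U = B0 := by
      rw [show B0 + U * B1 + U * U * (B2 + U * B3) = B0 + (B1 + U * (B2 + U * B3)) * U by ring,
        Nat.add_sub_cancel]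
    have d2 : (B1 + U * (B2 + U * B3)) / U = B2 + U * B3 := by
      rw [Nat.add_mul_div_left _ _ (by omega), Nat.div_eq_of_lt hB1, zero_add]
    have s2 : B1 + U * (B2 + U * B3) - (B2 + U * B3) * U = B1 := by rw [mul_comm U, Nat.add_sub_cancel]
    have d3 : (B2 + U * B3) / U = B3 := by
      rw [Nat.add_mul_div_left _ _ (by omega), Nat.div_eq_of_lt hB2, zero_add]
    have s3 : B2 + U * B3 - B3 * U = B2 := by rw [mul_comm U, Nat.add_sub_cancel]
  · simp [hprod, hX, hE.c1, hE.c2, hE.c3, hE.c4, d1, s1, d2, s2, d3, s3]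
    exact mulMod_small hp.n_pos hp.c1_le hp.c2_le hp.c3_le hp.c4_le hU haU hbU hB0 hB1 hB2 hB3 hM
  · simp [hprod, hX, hE.c1, hE.c2, hE.c3, hE.c4, d1, s1, d2, s2, d3, s3, hfd]
    ring

end RAM

/-! ### Powers modulo the modulus. -/

namespace RAM

open Polynomial

variable {Y : ℕ} {p : Par}

theorem Par.pack_linear (he : 0 < p.e) (a b : ZMod p.n) : p.pack (C a * X + C b) = b.val + a.val * p.W := by
  obtain ⟨l, hl⟩ : ∃ l, 2 ^ p.e = l + 1 + 1 :=
    ⟨2 ^ p.e - 2, by have : 2 ^ 1 ≤ 2 ^ p.e := Nat.pow_le_pow_right (by norm_num) he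
                     omega⟩
  have h0 : ∀ j, (C a * X + C b).coeff (j + 1 + 1) = 0 := fun j => by
    rw [coeff_add, coeff_C_mul_X, coeff_C]; simp
  rw [pack, digitSum, hl, Finset.sum_range_succ', Finset.sum_range_succ',
    Finset.sum_eq_zero fun j _ => by rw [h0, ZMod.val_zero, zero_mul]]
  simp [coeff_C]
  ring

theorem Par.pack_C (he : 0 < p.e) (a : ZMod p.n) : p.pack (C a) = a.val := by
  have := p.pack_linear he 0 a
  simpa using this

theorem Par.pack_one (he : 0 < p.e) (hn : 2 ≤ p.n) : p.pack 1 = 1 := by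
  have : Fact (1 < p.n) := ⟨hn⟩
  rw [← C_1, p.pack_C he, ZMod.val_one]

theorem Par.Ok.unit_le_of_le (hp : p.Ok Y) {b : ℕ} (hb : b ≤ 2 * p.w * 2 ^ p.e) :
    unit Y b ≤ 600 * (p.w * p.e * 2 ^ p.e * Y ^ 2) := (unit_mono Y hb).trans hp.unit_le

theorem mk_modByMonic {R : Type*} [CommRing R] (F f : R[X]) :
    AdjoinRoot.mk F (f %ₘ F) = AdjoinRoot.mk F f := by
  rw [AdjoinRoot.mk_eq_mk]
  exact ⟨-(f /ₘ F), by have := modByMonic_add_div f F; linear_combination this⟩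

theorem modByMonic_eq_of_mk_eq {R : Type*} [CommRing R] {F f g : R[X]} (hF : F.Monic)
    (h : AdjoinRoot.mk F f = AdjoinRoot.mk F g) : f %ₘ F = g %ₘ F :=
  modByMonic_eq_of_dvd_sub hF (AdjoinRoot.mk_eq_mk.1 h)

/-- Raises the polynomial represented by `bas` to the power `m`; the result is in `acc`. -/
def powMod : Stmt :=
  .prims [.copy .acc .one] ;;
  .loop .m (
    .prims [.add .t2 .one .one, .div .h .m .t2, .add .q .h .h, .sub .f .m .q] ;;
    .ite .f (mulMod .acc .bas ;; .prims [.copy .acc .t]) (.prims []) ;;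
    mulMod .bas .bas ;;
    .prims [.copy .bas .t, .add .t2 .one .one, .div .m .m .t2])

theorem powMod_spec (hp : p.Ok Y) (hn : 2 ≤ p.n) {f : (ZMod p.n)[X]} (hf : f.degree < (2 ^ p.e : ℕ)) {σ : St}
    (hE : Env p σ) (hb : σ.v .bas = p.pack f) {k l : ℕ} (hm : σ.v .m = k) (hk : k < 2 ^ l) (hkW : k ≤ p.W) :
    WP Y powMod ((l + 1) * (80000 * (p.w * p.e * 2 ^ p.e * Y ^ 2)))
      (fun σ' => σ'.v .acc = p.pack (f ^ k %ₘ p.modulus)) σ := by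
  have : Fact (1 < p.n) := ⟨hn⟩
  set G := p.w * p.e * 2 ^ p.e * Y ^ 2 with hG
  have hE0 : 1 ≤ 2 ^ p.e := Nat.one_le_two_pow
  have hbig : p.w ≤ 2 * p.w * 2 ^ p.e := by nlinarith
  have hwb : len p.w + 2 ≤ Y := hp.len_le_of_le hbig
  have hwpos := hp.w_pos
  have hWlt := hp.W_lt
  have hEw : 4 * 2 ^ p.e < 2 ^ p.w := hp.E_le_W.trans_lt hp.W_lt
  have hu := hp.unit_le
  have huw := hp.unit_le_of_le hbig
  have hcost : 1 ≤ G := hp.one_le_cost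
  have hadd := hp.add_le
  have hpack : ∀ g : (ZMod p.n)[X], p.pack g < 2 ^ (2 * p.w * 2 ^ p.e) := fun g =>
    (hp.pack_lt g).trans_le ((hp.pow_W_le _).trans (Nat.pow_le_pow_right (by norm_num) (by gcongr; omega)))
  have hbigw : 2 ^ p.w ≤ 2 ^ (2 * p.w * 2 ^ p.e) := Nat.pow_le_pow_right (by norm_num) hbig
  refine WP.comp (unit Y p.w) (∑ i ∈ Finset.range l, (79900 * G + (p.w + 8)) + (p.w + 8))
    (fun σ1 => σ1.v .acc = 1 ∧ σ1.v .bas = p.pack f ∧ σ1.v .m = k) ?_ (WP.assign p.w hwb (by simp) ?_ ?_) ?_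
  · rw [Finset.sum_const, Finset.card_range, smul_eq_mul, add_mul]
    have : l * (79900 * G + (p.w + 8)) ≤ l * (80000 * G) := Nat.mul_le_mul_left _ (by omega)
    omega
  · simp [hE.one, hwpos.ne']
  · simp [hE.one, hb, hm]
  rintro σ1 hF1 ⟨h1, h2, h3⟩
  have hE1 : Env p σ1 := hE.frame hF1 (by decide) (by decide)
  -- Binary powering from the lowest bit of the exponent: acc·bas^m is constant in the quotient
  -- ring. The representatives are kept reduced, so at m = 0 the accumulator is the remainder
  -- itself.
  refine WP.loop (I := fun j σ' => ∃ (a b : (ZMod p.n)[X]) (m : ℕ), a.degree < (2 ^ p.e : ℕ) ∧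
      b.degree < (2 ^ p.e : ℕ) ∧ σ'.v .acc = p.pack a ∧ σ'.v .bas = p.pack b ∧ σ'.v .m = m ∧ m < 2 ^ j ∧ m ≤ p.W ∧
      AdjoinRoot.mk p.modulus a * AdjoinRoot.mk p.modulus b ^ m = AdjoinRoot.mk p.modulus f ^ k) ?_ l σ1
      (.refl _ _) ?_
  swap
  · refine ⟨1, f, k, ?_, hf, ?_, h2, h3, hk, hkW, by simp⟩
    · exact degree_one_le.trans_lt (by exact_mod_cast hE0)
    · rw [h1, p.pack_one hp.e_pos hn]
  rintro j σ2 hF2 ⟨a, b, m, ha, hb, hacc, hbas, hm, hmj, hmW, hab⟩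
  have hE2 : Env p σ2 := hE1.frame hF2 (by decide) (by decide)
  refine ⟨?_, fun h0 => ?_, fun h0 => ?_⟩
  · rw [hm]
    have := len_le (hmW.trans_lt hWlt); omega
  · obtain rfl : m = 0 := by omega
    rw [pow_zero, mul_one, ← map_pow] at hab
    rw [hacc, ← modByMonic_eq_of_mk_eq hp.monic hab, (modByMonic_eq_self_iff hp.monic).2]
    rw [hp.degree]; exact ha
  obtain ⟨j, rfl⟩ : ∃ j', j = j' + 1 := by
    rcases j with _ | j
    · rw [hm] at h0; simp at hmj; omega
    · exact ⟨j, rfl⟩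
  refine ⟨j, rfl, ?_⟩
  rw [hm] at h0
  have hmod : m - (m / 2 + m / 2) = m % 2 := by omega
  refine WP.comp (4 * unit Y p.w) (77000 * G) (fun σ3 => σ3.v .f = m % 2) (by omega)
    (WP.assign p.w hwb le_rfl ?_ ?_) ?_
  · simp [hE2.one, hm]; omega
  · simp [hE2.one, hm, hmod]
  intro σ3 hF3 h3
  have hE3 : Env p σ3 := hE2.frame hF3 (by decide) (by decide)
  have hacc3 : σ3.v .acc = p.pack a := (hF3.1 .acc (by decide)).trans hacc
  have hbas3 : σ3.v .bas = p.pack b := (hF3.1 .bas (by decide)).trans hbas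
  have hm3 : σ3.v .m = m := (hF3.1 .m (by decide)).trans hm
  have hdeg : ∀ g : (ZMod p.n)[X], (g %ₘ p.modulus).degree < (2 ^ p.e : ℕ) := fun g => by
    rw [← hp.degree]; exact degree_modByMonic_lt _ hp.monic
  refine WP.comp (36600 * G + 9) (40300 * G) (fun σ4 => ∃ a' : (ZMod p.n)[X], a'.degree < (2 ^ p.e : ℕ) ∧
      σ4.v .acc = p.pack a' ∧ AdjoinRoot.mk p.modulus a' =
        AdjoinRoot.mk p.modulus a * AdjoinRoot.mk p.modulus b ^ (m % 2)) (by omega) (WP.ite ?_ ?_ ?_) ?_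
  · rw [h3]
    have := len_le (x := m % 2) (b := 1) (by omega); omega
  · intro hodd
    have hodd : m % 2 = 1 := by omega
    refine WP.comp (36000 * G) (600 * G) _ (by omega) (mulMod_spec hp hn ha hb hE3 hacc3 hbas3) ?_
    intro σ4 hF4 h4
    refine WP.assign _ (hp.len_le_of_le le_rfl) (by simpa using hu) ?_ ?_
    · simp [h4, hpack]
    · refine ⟨a * b %ₘ p.modulus, hdeg _, by simp [h4], ?_⟩
      rw [mk_modByMonic, hodd, map_mul, pow_one]
  · intro heven
    have heven : m % 2 = 0 := by omega
    refine WP.assign p.w hwb (by simp) trivial ⟨a, ha, hacc3, ?_⟩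
    rw [heven, pow_zero, mul_one]
  rintro σ4 hF4 ⟨a', ha', hacc4, haa⟩
  have hE4 : Env p σ4 := hE3.frame hF4 (by decide) (by decide)
  have hbas4 : σ4.v .bas = p.pack b := (hF4.1 .bas (by decide)).trans hbas3
  have hm4 : σ4.v .m = m := (hF4.1 .m (by decide)).trans hm3
  refine WP.comp (36000 * G) (1800 * G) _ (by omega) (mulMod_spec hp hn hb hb hE4 hbas4 hbas4) ?_
  intro σ5 hF5 h5
  have hE5 : Env p σ5 := hE4.frame hF5 (by decide) (by decide)
  have hacc5 : σ5.v .acc = p.pack a' := (hF5.1 .acc (by decide)).trans hacc4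
  have hm5 : σ5.v .m = m := (hF5.1 .m (by decide)).trans hm4
  refine WP.assign _ (hp.len_le_of_le le_rfl) (by simp; omega) ?_ ?_
  · have := hpack (b * b %ₘ p.modulus)
    simp [h5, hE5.one, hm5]; omega
  · refine ⟨a', b * b %ₘ p.modulus, m / 2, ha', hdeg _, by simp [hacc5], by simp [h5], by simp [hE5.one, hm5],
      by rw [pow_succ] at hmj; omega, by omega, ?_⟩
    rw [mk_modByMonic, haa, ← hab, map_mul, ← pow_two, ← pow_mul, mul_assoc, ← pow_add]
    congr 2
    omega

end RAM

/-! ### The bit length of n, the 2-part of N - 1, the degree and the number of tests. -/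

namespace RAM

variable {Y : ℕ}

theorem guard_le {x b : ℕ} (h : x < 2 ^ b) (hY : len b + 2 ≤ Y) : len x + 7 ≤ unit Y b := by
  have h1 := len_le h
  have hY0 : 0 < Y := by omega
  have h2 : (b + 1) * 1 ≤ (b + 1) * Y ^ 2 := Nat.mul_le_mul_left _ (pow_pos hY0 2)
  have h3 : unit Y b = 200 * ((b + 1) * Y ^ 2) := by unfold unit; ring
  rw [h3]
  generalize (b + 1) * Y ^ 2 = z at *
  omega

theorem ne_zero_of_lt_two_pow {x b : ℕ} (h : x < 2 ^ b) (hx : x ≠ 0) : b ≠ 0 := by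
  rintro rfl
  rw [pow_zero] at h
  omega

theorem lt_len_iff {x i : ℕ} (hx : x ≠ 0) : i < len x ↔ 2 ^ i ≤ x := by
  rw [len, Nat.lt_succ_iff, Nat.le_log_iff_pow_le (by norm_num) hx]

/-- Computes the length of `n`. -/
def lenPhase : Stmt :=
  .prims [.copy .t .n, .sub .len .one .one] ;;
  .loop .t (.prims [.add .t2 .one .one, .div .t .t .t2, .add .len .len .one])

theorem lenPhase_spec {b n : ℕ} (hY : len b + 2 ≤ Y) (hn : n ≠ 0) (hb : 2 * n + 2 < 2 ^ b) {σ : St}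
    (h1 : σ.v .one = 1) (hσn : σ.v .n = n) :
    WP Y lenPhase ((4 * b + 3) * unit Y b) (fun σ' => σ'.v .len = len n) σ := by
  have hlen : ∀ i, i ≤ len n → i ≤ n := fun i hi => by
    rcases i with _ | i
    · omega
    · exact (Nat.lt_two_pow_self).trans_le ((lt_len_iff hn).1 hi)
  have hLb : len n ≤ b := by
    have := (lt_len_iff hn).1 (show len n - 1 < len n by unfold len; omega)
    have := (Nat.pow_lt_pow_iff_right (show 1 < 2 by norm_num)).1 (this.trans_lt (show n < 2 ^ b by omega))
    omega
  have hb0 := ne_zero_of_lt_two_pow hb (by omega)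
  refine WP.comp (2 * unit Y b) (∑ i ∈ Finset.range (len n), (3 * unit Y b + unit Y b) + unit Y b)
    (fun σ1 => σ1.v .t = n ∧ σ1.v .len = 0) ?_ (WP.assign b hY le_rfl ?_ ?_) ?_
  · rw [Finset.sum_const, Finset.card_range, smul_eq_mul]
    have := Nat.mul_le_mul_right (3 * unit Y b + unit Y b) hLb
    linarith
  · simp [h1, hσn]; omega
  · simp [h1, hσn]
  rintro σ1 hF1 ⟨h2, h3⟩
  have h11 : σ1.v .one = 1 := (hF1.1 .one (by decide)).trans h1
  refine WP.loop (I := fun j σ' => ∃ i, i + j = len n ∧ σ'.v .len = i ∧ σ'.v .t = n / 2 ^ i) ?_ (len n) σ1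
    (.refl _ _) ⟨0, by simp, h3, by simpa using h2⟩
  rintro j σ2 hF2 ⟨i, hij, h4, h5⟩
  have h12 : σ2.v .one = 1 := (hF2.1 .one (by decide)).trans h11
  have hti : n / 2 ^ i ≤ n := Nat.div_le_self _ _
  have hin := hlen i (by omega)
  refine ⟨?_, fun h0 => ?_, fun h0 => ?_⟩
  · rw [h5]; exact guard_le (by omega) hY
  · rw [h5, Nat.div_eq_zero_iff] at h0
    have : ¬ i < len n := fun h => by
      have := (lt_len_iff hn).1 h
      have := Nat.two_pow_pos i
      omega
    omega
  · have hi : i < len n := (lt_len_iff hn).2 (by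
      by_contra h
      exact h0 (by rw [h5]; exact Nat.div_eq_of_lt (by omega)))
    refine ⟨j - 1, by omega, WP.assign b hY le_rfl ?_ ⟨i + 1, by omega, by simp [h12, h4], ?_⟩⟩
    · simp [h12, h4, h5]; omega
    · simp [h12, h5, Nat.div_div_eq_div_mul, pow_succ]

/-- Computes the exponent `kp` of the exact power `pw` of two that divides `ex - 1`. -/
def twoPhase : Stmt :=
  .prims [.sub .m .ex .one, .copy .pw .one, .sub .kp .one .one, .add .t2 .one .one, .div .h .m .t2,
    .add .q .h .h, .sub .f .m .q, .sub .g .one .f] ;;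
  .loop .g (.prims [.copy .m .h, .add .pw .pw .pw, .add .kp .kp .one, .div .h .m .t2,
    .add .q .h .h, .sub .f .m .q, .sub .g .one .f])

theorem twoPhase_spec {b N K m₀ : ℕ} (hY : len b + 2 ≤ Y) (hN : N = 2 ^ K * m₀ + 1) (hm : Odd m₀)
    (hb : 4 * N < 2 ^ b) {σ : St} (h1 : σ.v .one = 1) (hσN : σ.v .ex = N) :
    WP Y twoPhase ((8 * b + 9) * unit Y b) (fun σ' => σ'.v .kp = K ∧ σ'.v .pw = 2 ^ K) σ := by
  have hm0 := hm.pos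
  have hK : 2 ^ K ≤ 2 ^ K * m₀ := Nat.le_mul_of_pos_right _ hm0
  have hKb : K ≤ b := ((Nat.pow_lt_pow_iff_right (show 1 < 2 by norm_num)).1 (show 2 ^ K < 2 ^ b by omega)).le
  have hb4 : 4 < 2 ^ b := by omega
  have hb0 := ne_zero_of_lt_two_pow hb4 (by norm_num)
  refine WP.comp (8 * unit Y b) (∑ i ∈ Finset.range K, (7 * unit Y b + unit Y b) + unit Y b)
    (fun σ1 => σ1.v .kp = 0 ∧ σ1.v .pw = 2 ^ 0 ∧ σ1.v .h = 2 ^ K * m₀ / 2 ∧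
      σ1.v .g = 1 - 2 ^ K * m₀ % 2 ∧ σ1.v .t2 = 2) ?_ (WP.assign b hY le_rfl ?_ ?_) ?_
  · rw [Finset.sum_const, Finset.card_range, smul_eq_mul]
    have := Nat.mul_le_mul_right (7 * unit Y b + unit Y b) hKb
    linarith
  · simp [h1, hσN, hN]; omega
  · simp [h1, hσN, hN]; omega
  rintro σ1 hF1 ⟨h2, h3, h4, h5, h6⟩
  have h11 : σ1.v .one = 1 := (hF1.1 .one (by decide)).trans h1
  refine WP.loop (I := fun j σ' => ∃ i, i + j = K ∧ σ'.v .kp = i ∧ σ'.v .pw = 2 ^ i ∧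
    σ'.v .h = 2 ^ j * m₀ / 2 ∧ σ'.v .g = 1 - 2 ^ j * m₀ % 2) ?_ K σ1
    (.refl _ _) ⟨0, by simp, h2, h3, h4, h5⟩
  rintro j σ2 hF2 ⟨i, hij, h7, h8, h9, h10⟩
  have h12 : σ2.v .one = 1 := (hF2.1 .one (by decide)).trans h11
  have h13 : σ2.v .t2 = 2 := (hF2.1 .t2 (by decide)).trans h6
  refine ⟨?_, fun h0 => ?_, fun h0 => ?_⟩
  · rw [h10]; exact guard_le (by omega) hY
  · rcases j with _ | j
    · simp only [add_zero] at hij; subst hij; exact ⟨h7, h8⟩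
    · rw [h10, pow_succ, mul_right_comm, Nat.mul_mod_left] at h0; omega
  · rcases j with _ | j
    · rw [h10, pow_zero, one_mul, Nat.odd_iff.1 hm] at h0; omega
    · have e1 : 2 ^ (j + 1) * m₀ / 2 = 2 ^ j * m₀ := by
        rw [pow_succ, mul_right_comm, Nat.mul_div_cancel _ (by norm_num)]
      rw [e1] at h9
      have e2 : 2 ^ i ≤ 2 ^ K := Nat.pow_le_pow_right (by norm_num) (by omega)
      have e3 : 2 ^ j * m₀ ≤ 2 ^ K * m₀ := Nat.mul_le_mul_right _ (Nat.pow_le_pow_right (by norm_num) (by omega))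
      have e4 : i < 2 ^ i := Nat.lt_two_pow_self
      refine ⟨j, rfl, WP.assign b hY le_rfl ?_ ⟨i + 1, by omega, by simp [h12, h7], ?_, ?_, ?_⟩⟩
      · simp [h12, h7, h8, h9, h13]; omega
      · simp [h8, pow_succ]; omega
      · simp [h13, h9]
      · simp [h13, h9, h12]; omega

/-- Computes `2 ^ u`, the degree `dd`, the exponent `kap` and the number `vv` of the tests. -/
def sizePhase : Stmt :=
  .prims [.copy .uu .one, .copy .i .u] ;;
  .loop .i (.prims [.add .uu .uu .uu, .sub .i .i .one]) ;;
  .prims [.add .kap .kp .one, .sub .kap .kap .u, .add .r .pw .pw, .div .r .r .uu, .const .t1 16,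
    .mul .t .len .len, .mul .t .t1 .t, .mul .t .uu .t, .copy .dd .one, .sub .g .t .dd] ;;
  .loop .g (.prims [.add .dd .dd .dd, .sub .g .t .dd]) ;;
  .prims [.div .vv .dd .r, .sub .f .one .vv, .add .vv .vv .f]

/-- Doubling stops at the least power of two that is at least 2^u·16L². The lower bound serves the
correctness of the test, the upper bound its running time. Each tested number will stand for up to
2^(K+1-u) shifts, which fixes `vv`; the maximum with 1 keeps at least one test. -/
theorem sizePhase_spec {b L K u : ℕ} (hY : len b + 2 ≤ Y) (hL : L ≠ 0) (huK : u ≤ K)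
    (hb : 2 ^ u * (32 * L ^ 2) + 2 * 2 ^ K + 2 * K + 32 < 2 ^ b) {σ : St} (h1 : σ.v .one = 1) (hlen : σ.v .len = L)
    (hu : σ.v .u = u) (hkp : σ.v .kp = K) (hpw : σ.v .pw = 2 ^ K) :
    WP Y sizePhase ((6 * b + 20) * unit Y b) (fun σ' => σ'.v .kap = K + 1 - u ∧ ∃ S, σ'.v .dd = 2 ^ S ∧
      2 ^ u * (16 * L ^ 2) ≤ 2 ^ S ∧ 2 ^ S < 2 ^ u * (32 * L ^ 2) ∧ σ'.v .vv = max (2 ^ S / 2 ^ (K + 1 - u)) 1) σ := by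
  have hLL : L ≤ L ^ 2 := Nat.le_self_pow (by norm_num) L
  have hu1 : 1 ≤ 2 ^ u := Nat.one_le_two_pow
  have huL : 1 * (32 * L ^ 2) ≤ 2 ^ u * (32 * L ^ 2) := Nat.mul_le_mul_right _ hu1
  have huK2 : 2 ^ u ≤ 2 ^ K := Nat.pow_le_pow_right (by norm_num) huK
  have hKb : K ≤ b := ((Nat.pow_lt_pow_iff_right (show 1 < 2 by norm_num)).1 (show 2 ^ K < 2 ^ b by omega)).le
  have hT : 2 ^ u * (32 * L ^ 2) = 2 * (2 ^ u * (16 * L ^ 2)) := by ring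
  have hT0 : 0 < L ^ 2 := by positivity
  have hb0 := ne_zero_of_lt_two_pow hb (by omega)
  refine WP.comp (2 * unit Y b) ((3 * b + 1 + (10 + (3 * b + 1) + 3)) * unit Y b)
    (fun σ1 => σ1.v .uu = 1 ∧ σ1.v .i = u) (by linarith) (WP.assign b hY le_rfl ?_ ?_) ?_
  · simp [h1, hu]
    have : u < 2 ^ u := Nat.lt_two_pow_self
    omega
  · simp [h1, hu]
  rintro σ1 hF1 ⟨h2, h3⟩
  have h11 : σ1.v .one = 1 := (hF1.1 .one (by decide)).trans h1
  refine WP.comp ((3 * b + 1) * unit Y b) ((10 + (3 * b + 1) + 3) * unit Y b) (fun σ2 => σ2.v .uu = 2 ^ u)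
    (le_of_eq (by ring)) (WP.count 0 u (unit Y b) (fun _ => 2 * unit Y b)
      (fun i σ' => σ'.v .i = u - i ∧ σ'.v .uu = 2 ^ i) ?_ (Nat.zero_le _) ?_ ⟨by simp [h3], by simp [h2]⟩
      (fun i σ' h => h.1) ?_ (fun σ' _ h => h.2)) ?_
  · rw [Finset.sum_const, Nat.card_Ico, smul_eq_mul, Nat.sub_zero]
    have := Nat.mul_le_mul_right (2 * unit Y b + unit Y b) (huK.trans hKb)
    linarith
  · refine guard_le ?_ hY
    have : u < 2 ^ u := Nat.lt_two_pow_self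
    omega
  · rintro i σ' _ hi hF ⟨h4, h5⟩
    have h12 : σ'.v .one = 1 := (hF.1 .one (by decide)).trans h11
    have e1 : 2 ^ i ≤ 2 ^ u := Nat.pow_le_pow_right (by norm_num) hi.le
    refine WP.assign b hY le_rfl ?_ ⟨?_, ?_⟩
    · simp [h12, h4, h5]
      have : u < 2 ^ u := Nat.lt_two_pow_self
      omega
    · simp [h12, h4]; omega
    · simp [h5, pow_succ]; omega
  intro σ2 hF2 h4
  have h12 : σ2.v .one = 1 := (hF2.1 .one (by decide)).trans h11
  have hlen2 : σ2.v .len = L := (hF2.1 .len (by decide)).trans ((hF1.1 .len (by decide)).trans hlen)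
  have hu2 : σ2.v .u = u := (hF2.1 .u (by decide)).trans ((hF1.1 .u (by decide)).trans hu)
  have hkp2 : σ2.v .kp = K := (hF2.1 .kp (by decide)).trans ((hF1.1 .kp (by decide)).trans hkp)
  have hpw2 : σ2.v .pw = 2 ^ K := (hF2.1 .pw (by decide)).trans ((hF1.1 .pw (by decide)).trans hpw)
  have hr : (2 ^ K + 2 ^ K) / 2 ^ u = 2 ^ (K + 1 - u) := by
    rw [← two_mul, ← pow_succ', Nat.pow_div (by omega) (by norm_num)]
  have ht : 2 ^ u * (16 * (L * L)) = 2 ^ u * (16 * L ^ 2) := by ring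
  refine WP.comp (10 * unit Y b) ((3 * b + 1 + 3) * unit Y b) (fun σ3 => σ3.v .kap = K + 1 - u ∧
    σ3.v .r = 2 ^ (K + 1 - u) ∧ σ3.v .t = 2 ^ u * (16 * L ^ 2) ∧ σ3.v .dd = 1 ∧
    σ3.v .g = 2 ^ u * (16 * L ^ 2) - 1) (le_of_eq (by ring)) (WP.assign b hY le_rfl ?_ ?_) ?_
  · simp [h12, h4, hlen2, hu2, hkp2, hpw2, ht]
    have : L * L = L ^ 2 := by ring
    have : u < 2 ^ u := Nat.lt_two_pow_self
    have : 1 * (16 * L ^ 2) ≤ 2 ^ u * (16 * L ^ 2) := Nat.mul_le_mul_right _ hu1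
    have : 2 ^ u * 1 ≤ 2 ^ u * (16 * L ^ 2) := Nat.mul_le_mul_left _ (by omega)
    omega
  · simp [h12, h4, hlen2, hu2, hkp2, hpw2, ht, hr]
  rintro σ3 hF3 ⟨h5, h6, h7, h8, h9⟩
  have h13 : σ3.v .one = 1 := (hF3.1 .one (by decide)).trans h12
  refine WP.comp ((3 * b + 1) * unit Y b) (3 * unit Y b) (fun σ4 => ∃ S, σ4.v .dd = 2 ^ S ∧
      2 ^ u * (16 * L ^ 2) ≤ 2 ^ S ∧ 2 ^ S < 2 ^ u * (32 * L ^ 2)) (le_of_eq (by ring)) (WP.mono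
      (WP.loop (σ₀ := σ3) (I := fun j σ' => ∃ i, i + j = b ∧ σ'.v .dd = 2 ^ i ∧ 2 ^ i < 2 ^ u * (32 * L ^ 2) ∧
        σ'.v .g = 2 ^ u * (16 * L ^ 2) - 2 ^ i) (T := fun _ => 2 * unit Y b) (c := unit Y b) ?_ b σ3 (.refl _ _)
        ⟨0, by simp, by simp [h8], by rw [pow_zero]; omega, by simp [h9]⟩) ?_ fun σ' _ h => h) ?_
  · rintro j σ' hF ⟨i, hij, h10, h11', h14⟩
    refine ⟨?_, fun h0 => ⟨i, h10, by omega, h11'⟩, fun h0 => ?_⟩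
    · rw [h14]; exact guard_le (by omega) hY
    · have htt : σ'.v .t = 2 ^ u * (16 * L ^ 2) := (hF.1 .t (by decide)).trans h7
      have hib : i < b := (Nat.pow_lt_pow_iff_right (show 1 < 2 by norm_num)).1 (show 2 ^ i < 2 ^ b by omega)
      refine ⟨j - 1, by omega, WP.assign b hY le_rfl ?_ ⟨i + 1, by omega, ?_, ?_, ?_⟩⟩
      · simp [h10, htt]; omega
      · simp [h10, pow_succ]; omega
      · rw [pow_succ]; omega
      · simp [h10, htt, pow_succ]; omega
  · rw [Finset.sum_const, Finset.card_range, smul_eq_mul]; linarith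
  rintro σ4 hF4 ⟨S, h10, h14, h15⟩
  have hr4 : σ4.v .r = 2 ^ (K + 1 - u) := (hF4.1 .r (by decide)).trans h6
  have ho4 : σ4.v .one = 1 := (hF4.1 .one (by decide)).trans h13
  have hk4 : σ4.v .kap = K + 1 - u := (hF4.1 .kap (by decide)).trans h5
  have hdiv := Nat.div_le_self (2 ^ S) (2 ^ (K + 1 - u))
  have hr2 : 2 ^ (K + 1 - u) ≤ 2 * 2 ^ K := by
    rw [← pow_succ']; exact Nat.pow_le_pow_right (by norm_num) (by omega)
  refine WP.assign b hY le_rfl ?_ ⟨by simp [hk4], S, by simp [h10], h14, h15, ?_⟩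
  · simp [h10, hr4, ho4]
    generalize 2 ^ S / 2 ^ (K + 1 - u) = z at *
    omega
  · simp [h10, hr4, ho4]; omega

end RAM

/-! ### The constants of the polynomial arithmetic. -/

namespace RAM

variable {Y : ℕ} {p : Par}

/-- The parameters for the reduction modulo `X ^ (2 * D) - 2 * re * X ^ D + (re ^ 2 + im ^ 2)`, `D = 2 ^ S`. -/
def par (n re im S : ℕ) : Par where
  n := n
  e := S + 1
  W := 8 * 2 ^ (S + 1) * n ^ 3
  w := 4 * len n + 8
  c1 := n - (re * re + im * im) % n
  c2 := (re + re) % n * (n - (re * re + im * im) % n) % n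
  c3 := (re + re) % n
  c4 := ((re + re) % n * ((re + re) % n) + (n - (re * re + im * im) % n)) % n

/-- Computes the constants of the polynomial arithmetic. -/
def constPhase : Stmt :=
  .prims [.add .ee .dd .dd, .const .t 8, .mul .ww .t .ee, .mul .t .n .n, .mul .t .t .n, .mul .ww .ww .t,
    .add .c3 .re .re, .div .q .c3 .n, .mul .q .n .q, .sub .c3 .c3 .q,
    .mul .c1 .re .re, .mul .t .im .im, .add .c1 .c1 .t, .div .q .c1 .n, .mul .q .n .q, .sub .c1 .c1 .q,
    .sub .c1 .n .c1, .mul .c2 .c3 .c1, .div .q .c2 .n, .mul .q .n .q, .sub .c2 .c2 .q,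
    .mul .c4 .c3 .c3, .add .c4 .c4 .c1, .div .q .c4 .n, .mul .q .n .q, .sub .c4 .c4 .q]

theorem sub_mul_div (a n : ℕ) : a - n * (a / n) = a % n := by
  have := Nat.div_add_mod a n
  omega

/-- The case 2^S ≥ n is left to trial division; under 2^S < n the base is at most 16n⁴, so a digit
has O(log n) bits. -/
theorem par_W_lt {n S : ℕ} (hn : 0 < n) (hS : 2 ^ S < n) : 8 * 2 ^ (S + 1) * n ^ 3 < 2 ^ (4 * len n + 8) := by
  have h1 := lt_two_pow_len n
  calc 8 * 2 ^ (S + 1) * n ^ 3 = 16 * (2 ^ S * n ^ 3) := by ring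
    _ ≤ 16 * (n * n ^ 3) := by gcongr
    _ = 16 * n ^ 4 := by ring
    _ < 16 * (2 ^ len n) ^ 4 := by gcongr
    _ ≤ 256 * (2 ^ len n) ^ 4 := by gcongr; norm_num
    _ = 2 ^ (4 * len n + 8) := by rw [pow_add, ← pow_mul, mul_comm 4]; norm_num [mul_comm]

theorem cast_mul_mod (n a b : ℕ) : ((a * b % n : ℕ) : ZMod n) = a * b := by
  rw [ZMod.natCast_mod]; push_cast; rfl

theorem cast_sq_add_mod (n a b : ℕ) : (((a * a + b) % n : ℕ) : ZMod n) = a ^ 2 + b := by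
  rw [ZMod.natCast_mod]; push_cast; ring

theorem par_ok {n re im S : ℕ} (hn : 0 < n) (hS : 2 ^ S < n) (hY : len (2 * (4 * len n + 8) * 2 ^ (S + 1)) + 2 ≤ Y) :
    (par n re im S).Ok Y where
  n_pos := hn
  e_pos := Nat.succ_pos _
  W_eq := rfl
  W_lt := par_W_lt hn hS
  c1_le := Nat.sub_le _ _
  c2_le := (Nat.mod_lt _ hn).le
  c3_le := (Nat.mod_lt _ hn).le
  c4_le := (Nat.mod_lt _ hn).le
  c2_eq := cast_mul_mod n _ _
  c4_eq := cast_sq_add_mod n _ _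
  len_le := hY

theorem constPhase_spec {n re im S : ℕ} (hn : 0 < n) (hS : 2 ^ S < n)
    (hY : len (4 * len n + 8) + 2 ≤ Y) (hre : re < n) (him : im < n) {σ : St}
    (hσn : σ.v .n = n) (hσre : σ.v .re = re) (hσim : σ.v .im = im) (hdd : σ.v .dd = 2 ^ S) :
    WP Y constPhase (26 * unit Y (4 * len n + 8)) (fun σ' => σ'.v .ee = 2 ^ (S + 1) ∧
      σ'.v .ww = (par n re im S).W ∧ σ'.v .c1 = (par n re im S).c1 ∧ σ'.v .c2 = (par n re im S).c2 ∧
      σ'.v .c3 = (par n re im S).c3 ∧ σ'.v .c4 = (par n re im S).c4) σ := by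
  have hW := par_W_lt hn hS
  have hWn : 8 * (2 ^ S + 2 ^ S) * (n * n * n) = 8 * 2 ^ (S + 1) * n ^ 3 := by rw [pow_succ]; ring
  rw [← hWn] at hW
  generalize hB : 2 ^ (4 * len n + 8) = B at hW
  have hS1 : 1 ≤ 2 ^ S := Nat.one_le_two_pow
  have h3 : 1 * 1 * (n * n * n) ≤ 8 * (2 ^ S + 2 ^ S) * (n * n * n) := by gcongr <;> omega
  have h4 : 8 * (2 ^ S + 2 ^ S) * 1 ≤ 8 * (2 ^ S + 2 ^ S) * (n * n * n) := by
    gcongr; exact Nat.mul_pos (Nat.mul_pos hn hn) hn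
  have h5 : 1 * (n * n) * 1 ≤ 4 * (n * n) * n := by gcongr <;> omega
  have h6 : 4 * (n * n) * n = 4 * 1 * (n * n * n) := by ring
  have h7 : 4 * 1 * (n * n * n) ≤ 8 * (2 ^ S + 2 ^ S) * (n * n * n) := by gcongr <;> omega
  have h8 : 4 * (n * n) ≤ 4 * (n * n) * n := Nat.le_mul_of_pos_right _ hn
  have h9 : n * 1 ≤ n * n := Nat.mul_le_mul_left _ hn
  have hmul : ∀ a b, a ≤ n → b ≤ n → a * b ≤ n * n := fun a b ha hb => Nat.mul_le_mul ha hb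
  have hd : ∀ a, n * (a / n) ≤ a := fun a => Nat.mul_div_le a n
  have hd' : ∀ a, a / n ≤ a := fun a => Nat.div_le_self a n
  have hmod : ∀ a, a % n ≤ n := fun a => (Nat.mod_lt a hn).le
  have r1 := hmul re re hre.le hre.le
  have r2 := hmul im im him.le him.le
  have r3 := hmod (re + re)
  have r4 : n - (re * re + im * im) % n ≤ n := Nat.sub_le _ _
  have r5 := hmul _ _ r3 r4
  have r6 := hmul _ _ r3 r3
  have r7 := hd (re + re)
  have r8 := hd (re * re + im * im)
  have r9 := hd ((re + re) % n * (n - (re * re + im * im) % n))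
  have r10 := hd ((re + re) % n * ((re + re) % n) + (n - (re * re + im * im) % n))
  have q7 := hd' (re + re)
  have q8 := hd' (re * re + im * im)
  have q9 := hd' ((re + re) % n * (n - (re * re + im * im) % n))
  have q10 := hd' ((re + re) % n * ((re + re) % n) + (n - (re * re + im * im) % n))
  have r11 := hmod (re * re + im * im)
  refine WP.assign (4 * len n + 8) hY le_rfl ?_ ?_
  · simp [hσn, hσre, hσim, hdd, sub_mul_div, hB]
    omega
  · simp [hσn, hσre, hσim, hdd, sub_mul_div, par]
    refine ⟨by rw [pow_succ]; ring, ?_⟩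
    rw [← hWn]

/-- Computes the table of the powers of `W` and the power `xx = W ^ D`. -/
def tablePhase : Stmt :=
  .prims [.sub .i .ee .one] ;;
  .loop .i (.prims [.add .j .i .i, .sub .g .ee .j] ;;
    .ite .g (.prims [.get .x .Q .j, .mul .x .x .x]) (.prims [.copy .x .ww]) ;;
    .prims [.put .Q .i .x, .sub .i .i .one]) ;;
  .prims [.get .xx .Q .one]

/-- The divisor is W at the parents of the leaves, and elsewhere it is the square of the divisor at
a child. Running through the nodes from the last to the first, one squaring per node suffices, and
the cost is that of one pass through the tree. -/
theorem tablePhase_spec (hp : p.Ok Y) {σ : St} (h1 : σ.v .one = 1) (hee : σ.v .ee = 2 ^ p.e)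
    (hww : σ.v .ww = p.W) :
    WP Y tablePhase (8000 * (p.w * p.e * 2 ^ p.e * Y ^ 2))
      (fun σ' => σ'.v .xx = p.W ^ 2 ^ (p.e - 1) ∧ ∀ i, 0 < i → i < 2 ^ p.e → σ'.a .Q i = nodeBase p.W p.e i) σ := by
  have hE2 : 2 * 1 ≤ 2 ^ p.e := by
    obtain ⟨l, hl⟩ : ∃ l, p.e = l + 1 := ⟨p.e - 1, by have := hp.e_pos; omega⟩
    rw [hl, pow_succ']; gcongr; exact Nat.one_le_two_pow
  have hEw : 4 * 2 ^ p.e < 2 ^ p.w := hp.E_le_W.trans_lt hp.W_lt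
  have hpw : ∀ l, 2 ^ p.w ≤ 2 ^ (p.w * 2 ^ l) := fun l =>
    Nat.pow_le_pow_right (by norm_num) (Nat.le_mul_of_pos_right _ (by positivity))
  have hwpos := hp.w_pos
  have hwb : len p.w + 2 ≤ Y := hp.len_le_of_le (by nlinarith)
  have hlen : ∀ x, x ≤ 2 ^ p.e → len x + 7 ≤ p.w + 8 := fun x hx => by
    have := len_le (x := x) (b := p.w) (by omega); omega
  have hsum : ∑ i ∈ Finset.Ico 1 (2 ^ p.e), (6 * unit Y (p.w * 2 ^ (p.e - Nat.log 2 (2 ^ p.e - i))) +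
      (p.w + 8) + (p.w + 8)) =
      ∑ i ∈ Finset.Ico 1 (2 ^ p.e), (6 * unit Y (p.w * 2 ^ (p.e - Nat.log 2 i)) + (p.w + 8) + (p.w + 8)) := by
    refine Finset.sum_nbij' (fun i => 2 ^ p.e - i) (fun i => 2 ^ p.e - i) ?_ ?_ ?_ ?_ (fun _ _ => rfl) <;>
      · intro i hi
        simp only [Finset.mem_Ico] at *
        omega
  refine WP.comp (unit Y p.w) ((∑ i ∈ Finset.Ico 1 (2 ^ p.e),
      (6 * unit Y (p.w * 2 ^ (p.e - Nat.log 2 i)) + (p.w + 8) + (p.w + 8)) + (p.w + 8)) + unit Y (2 * p.w * 2 ^ p.e))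
    (fun σ1 => σ1.v .i = 2 ^ p.e - 1) ?_ (WP.assign p.w hwb (by simp) ?_ ?_) ?_
  · rw [Finset.sum_add_distrib, Finset.sum_add_distrib, ← Finset.mul_sum, Finset.sum_const, Nat.card_Ico, smul_eq_mul]
    have h1 := hp.unit_le
    have h2 := hp.sum_unit_le
    have h3 := hp.card_mul_add_le
    have h4 := hp.add_le
    have h5 : (2 ^ p.e - 1) * (p.w + 8) ≤ 2 ^ p.e * (p.w + 8) := Nat.mul_le_mul_right _ (Nat.sub_le _ _)
    have h6 := hp.card_mul_unit_le
    have h7 : 1 * unit Y p.w ≤ 2 ^ p.e * unit Y p.w := Nat.mul_le_mul_right _ (by omega)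
    linarith
  · simp [hee, h1]; omega
  · simp [hee, h1]
  rintro σ1 hF1 hi1
  have ho1 : σ1.v .one = 1 := (hF1.1 .one (by decide)).trans h1
  have he1 : σ1.v .ee = 2 ^ p.e := (hF1.1 .ee (by decide)).trans hee
  have hw1 : σ1.v .ww = p.W := (hF1.1 .ww (by decide)).trans hww
  refine WP.comp _ _ (fun σ3 => ∀ i, 0 < i → i < 2 ^ p.e → σ3.a .Q i = nodeBase p.W p.e i) le_rfl
    (WP.count 1 (2 ^ p.e) (p.w + 8)
      (fun i => 6 * unit Y (p.w * 2 ^ (p.e - Nat.log 2 (2 ^ p.e - i))) + (p.w + 8)) (fun i σ' => σ'.v .i = 2 ^ p.e - i ∧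
      ∀ j, 2 ^ p.e - i < j → j < 2 ^ p.e → σ'.a .Q j = nodeBase p.W p.e j)
      (by rw [hsum]) (by omega) (hlen _ (Nat.sub_le _ _)) ?_ (fun i σ' h => h.1) ?_ ?_) ?_
  · exact ⟨hi1, fun j hj hj' => by omega⟩
  · rintro k σ2 hk hk' hF2 ⟨h4, h6⟩
    have ho2 : σ2.v .one = 1 := (hF2.1 .one (by decide)).trans ho1
    have he2 : σ2.v .ee = 2 ^ p.e := (hF2.1 .ee (by decide)).trans he1
    have hw2 : σ2.v .ww = p.W := (hF2.1 .ww (by decide)).trans hw1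
    obtain ⟨i, hi⟩ : ∃ i, i = 2 ^ p.e - k := ⟨_, rfl⟩
    rw [← hi] at h4 h6 ⊢
    have hi0 : 0 < i := by omega
    have hi' : i < 2 ^ p.e := by omega
    have hlog := log_lt_of_lt hi0 hi'
    have hb := hp.len_le_of_le (show p.w * 2 ^ (p.e - Nat.log 2 i) ≤ 2 * p.w * 2 ^ p.e by
      rw [mul_assoc 2, mul_comm 2, mul_assoc]
      gcongr
      exact (Nat.pow_le_pow_right (by norm_num) (Nat.sub_le _ _)).trans (Nat.le_mul_of_pos_right _ (by norm_num)))
    have hpwi := hpw (p.e - Nat.log 2 i)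
    have hQ : nodeBase p.W p.e i < 2 ^ (p.w * 2 ^ (p.e - Nat.log 2 i)) := by
      refine (hp.pow_W_le _).trans_lt (Nat.pow_lt_pow_right (by norm_num) ?_)
      gcongr <;> omega
    refine WP.comp (2 * unit Y (p.w * 2 ^ (p.e - Nat.log 2 i)))
      (4 * unit Y (p.w * 2 ^ (p.e - Nat.log 2 i)) + (p.w + 8)) (fun σ3 => σ3.v .j = 2 * i ∧
      σ3.v .g = 2 ^ p.e - 2 * i) (by omega) (WP.assign _ hb le_rfl ?_ ?_) ?_
    · simp [h4, he2]; omega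
    · simp [h4, he2]; omega
    rintro σ3 hF3 ⟨hj3, hg3⟩
    have ho3 : σ3.v .one = 1 := (hF3.1 .one (by decide)).trans ho2
    have hi3 : σ3.v .i = i := (hF3.1 .i (by decide)).trans h4
    have hw3 : σ3.v .ww = p.W := (hF3.1 .ww (by decide)).trans hw2
    have hQ3 : σ3.a .Q = σ2.a .Q := hF3.2 .Q (by decide)
    refine WP.comp (2 * unit Y (p.w * 2 ^ (p.e - Nat.log 2 i)) + (p.w + 8))
      (2 * unit Y (p.w * 2 ^ (p.e - Nat.log 2 i))) (fun σ4 => σ4.v .x = nodeBase p.W p.e i) (by omega)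
      (WP.ite ?_ ?_ ?_) ?_
    · rw [hg3]; exact hlen _ (Nat.sub_le _ _)
    · intro h0
      have h2i : 2 * i < 2 ^ p.e := by omega
      have hQ2 : σ3.a .Q (2 * i) = nodeBase p.W p.e (2 * i) := by rw [hQ3, h6 _ (by omega) h2i]
      have hin := nodeBase_inner (W := p.W) hi0 h2i
      have hle : nodeBase p.W p.e (2 * i) ≤ nodeBase p.W p.e i := by
        rw [hin]; exact Nat.le_mul_self _
      refine WP.assign _ hb le_rfl ?_ ?_
      · simp [hj3, hQ2]; omega
      · simp [hj3, hQ2, hin]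
    · intro h0
      have hleaf : nodeBase p.W p.e i = p.W := nodeBase_leaf (by omega) hi'
      refine WP.assign _ hb (by simp; omega) ?_ ?_
      · simp [hw3]; omega
      · simp [hw3, hleaf]
    intro σ4 hF4 hx4
    have ho4 : σ4.v .one = 1 := (hF4.1 .one (by decide)).trans ho3
    have hi4 : σ4.v .i = i := (hF4.1 .i (by decide)).trans hi3
    have hQ4 : σ4.a .Q = σ2.a .Q := (hF4.2 .Q (by decide)).trans hQ3
    refine WP.assign _ hb le_rfl ?_ ?_
    · simp [hi4, hx4, ho4]; omega
    · simp [hi4, hx4, ho4, hQ4]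
      refine ⟨by omega, fun j hj hj' => ?_⟩
      by_cases hj1 : j = i
      · simp [hj1]
      · rw [Function.update_of_ne hj1, h6 j (by omega) hj']
  · rintro σ2 hF2 ⟨h4, h6⟩ i hi hi'
    exact h6 i (by omega) hi'
  · intro σ3 hF3 h3
    have ho3 : σ3.v .one = 1 := (hF3.1 .one (by decide)).trans ho1
    have hQ1 : σ3.a .Q 1 = p.W ^ 2 ^ (p.e - 1) := by rw [h3 1 one_pos (by omega), nodeBase]; simp
    have hlt : p.W ^ 2 ^ (p.e - 1) < 2 ^ (2 * p.w * 2 ^ p.e) := by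
      refine (hp.pow_W_le _).trans_lt (Nat.pow_lt_pow_right (by norm_num) ?_)
      have := hp.e_pos
      gcongr <;> omega
    refine WP.assign (2 * p.w * 2 ^ p.e) (hp.len_le_of_le le_rfl) (by simp) ?_ ?_
    · simp [ho3, hQ1, hlt, hwpos.ne']
    · simp [ho3, hQ1]
      exact h3

/-- Computes all constants of the polynomial arithmetic. -/
def setupPhase : Stmt := constPhase ;; tablePhase

theorem setupPhase_spec {n re im S : ℕ} (hn : 0 < n) (hS : 2 ^ S < n)
    (hp : (par n re im S).Ok Y) (hre : re < n) (him : im < n) {σ : St}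
    (hσn : σ.v .n = n) (hσre : σ.v .re = re) (hσim : σ.v .im = im) (hdd : σ.v .dd = 2 ^ S) (h1 : σ.v .one = 1) :
    WP Y setupPhase (26 * unit Y (4 * len n + 8) + 8000 * ((4 * len n + 8) * (S + 1) * 2 ^ (S + 1) * Y ^ 2))
      (Env (par n re im S)) σ := by
  have hY : len (4 * len n + 8) + 2 ≤ Y := hp.len_le_of_le (by
    have : 1 ≤ 2 ^ (S + 1) := Nat.one_le_two_pow
    simp only [par]; nlinarith)
  refine WP.comp _ _ _ le_rfl (constPhase_spec hn hS hY hre him hσn hσre hσim hdd) ?_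
  rintro σ1 hF1 ⟨h2, h3, h4, h5, h6, h7⟩
  have ho1 : σ1.v .one = 1 := (hF1.1 .one (by decide)).trans h1
  refine (tablePhase_spec hp ho1 h2 h3).mono le_rfl ?_
  rintro σ2 hF2 ⟨h8, h9⟩
  exact ⟨(hF2.1 .n (by decide)).trans ((hF1.1 .n (by decide)).trans hσn), (hF2.1 .ee (by decide)).trans h2,
    (hF2.1 .dd (by decide)).trans ((hF1.1 .dd (by decide)).trans hdd), (hF2.1 .ww (by decide)).trans h3,
    (hF2.1 .one (by decide)).trans ho1, (hF2.1 .c1 (by decide)).trans h4, (hF2.1 .c2 (by decide)).trans h5,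
    (hF2.1 .c3 (by decide)).trans h6, (hF2.1 .c4 (by decide)).trans h7, h8, h9⟩

end RAM

/-! ### Recognition of perfect powers. -/

namespace RAM

variable {Y : ℕ}

/-- Computes the smaller one of `(r + b) ^ j` and `n + 1`. -/
def powCap : Stmt :=
  .prims [.add .x .r .b, .copy .acc .one, .copy .z .j, .add .t3 .n .one] ;;
  .loop .z (.prims [.mul .acc .acc .x, .sub .q .acc .t3, .sub .acc .acc .q, .sub .z .z .one])

/-- Truncation at n+1 after every multiplication keeps the numbers below 4(n+1)² throughout. As the
base is positive, a power that has reached the cap stays there. -/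
theorem powCap_spec {w n L r b j : ℕ} (hY : len w + 2 ≤ Y) (hw : 4 * (n + 1) * (n + 1) < 2 ^ w) (hj : j ≤ L)
    (hLn : L ≤ n + 1) (hL : 0 < L) (hr : r ≤ n) (hb : b ≤ n) (hrb : 0 < r + b) {σ : St} (h1 : σ.v .one = 1) (hσn : σ.v .n = n)
    (hσr : σ.v .r = r) (hσb : σ.v .b = b) (hσj : σ.v .j = j) :
    WP Y powCap (10 * L * unit Y w) (fun σ' => σ'.v .acc = min ((r + b) ^ j) (n + 1)) σ := by
  have hsq : 2 * (n + 1) * 1 ≤ 2 * (n + 1) * (2 * (n + 1)) := Nat.mul_le_mul_left _ (by omega)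
  have hsq' : 4 * (n + 1) * (n + 1) = 2 * (n + 1) * (2 * (n + 1)) := by ring
  have hw0 := ne_zero_of_lt_two_pow hw (by positivity)
  refine WP.comp (4 * unit Y w) (∑ i ∈ Finset.Ico 0 j, (4 * unit Y w + unit Y w) + unit Y w) (fun σ1 =>
    σ1.v .x = r + b ∧ σ1.v .acc = 1 ∧ σ1.v .z = j ∧ σ1.v .t3 = n + 1) ?_
    (WP.assign w hY le_rfl ?_ ?_) ?_
  · rw [Finset.sum_const, Nat.card_Ico, smul_eq_mul]
    have h2 : (j - 0) * (4 * unit Y w + unit Y w) ≤ L * (4 * unit Y w + unit Y w) := Nat.mul_le_mul_right _ (by omega)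
    have h3 : 1 * unit Y w ≤ L * unit Y w := Nat.mul_le_mul_right _ hL
    linarith
  · simp [h1, hσn, hσr, hσb, hσj]; omega
  · simp [h1, hσn, hσr, hσb, hσj]
  rintro σ1 hF1 ⟨h2, h3, h4, h5⟩
  have ho1 : σ1.v .one = 1 := (hF1.1 .one (by decide)).trans h1
  refine WP.count 0 j _ _ (fun i σ' => σ'.v .z = j - i ∧ σ'.v .acc = min ((r + b) ^ i) (n + 1)) le_rfl
    (Nat.zero_le _) (guard_le (by omega) hY) ⟨by omega, ?_⟩ (fun i σ' h => h.1) ?_ fun σ' _ h => h.2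
  · rw [h3, pow_zero, min_eq_left (by omega)]
  rintro i σ2 _ hi hF2 ⟨h6, h7⟩
  have ho2 : σ2.v .one = 1 := (hF2.1 .one (by decide)).trans ho1
  have hx2 : σ2.v .x = r + b := (hF2.1 .x (by decide)).trans h2
  have ht2 : σ2.v .t3 = n + 1 := (hF2.1 .t3 (by decide)).trans h5
  have hm : min ((r + b) ^ i) (n + 1) * (r + b) ≤ (2 * (n + 1)) * (2 * (n + 1)) :=
    Nat.mul_le_mul ((min_le_right _ _).trans (by omega)) (by omega)
  have hm2 := min_le_right ((r + b) ^ i) (n + 1)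
  have key : min ((r + b) ^ i) (n + 1) * (r + b) - (min ((r + b) ^ i) (n + 1) * (r + b) - (n + 1)) =
      min ((r + b) ^ (i + 1)) (n + 1) := by
    rw [pow_succ]
    rcases le_total ((r + b) ^ i) (n + 1) with h | h
    · rw [min_eq_left h]; omega
    · rw [min_eq_right h]
      have e1 : (n + 1) * 1 ≤ (n + 1) * (r + b) := Nat.mul_le_mul_left _ hrb
      have e2 : (n + 1) * (r + b) ≤ (r + b) ^ i * (r + b) := Nat.mul_le_mul_right _ h
      omega
  refine WP.assign w hY le_rfl ?_ ⟨?_, ?_⟩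
  · simp [ho2, hx2, ht2, h6, h7]
    omega
  · simp [ho2, h6]; omega
  · simp [ho2, hx2, ht2, h7, key]

/-- Looks for a `j`-th root of `n`. -/
def rootPhase : Stmt :=
  .prims [.sub .r .one .one, .copy .b .y] ;;
  .loop .b (powCap ;; .prims [.sub .f .acc .n, .sub .g .one .f, .mul .g .g .b, .add .r .r .g, .sub .t .n .acc,
    .add .t .t .f, .sub .t .one .t, .sub .h .one .found, .mul .t .t .h, .add .found .found .t, .add .t2 .one .one,
    .div .b .b .t2])

theorem rootPhase_spec {w n j f₀ : ℕ} (hY : len w + 2 ≤ Y) (hn : 2 ≤ n) (hw : 4 * (n + 1) * (n + 1) < 2 ^ w) (hj : j ≤ len n)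
    (hj2 : 2 ≤ j) (hf : f₀ ≤ 1) {σ : St} (h1 : σ.v .one = 1) (hσn : σ.v .n = n)
    (hσy : σ.v .y = 2 ^ (len n - 1)) (hσj : σ.v .j = j) (hσf : σ.v .found = f₀) :
    WP Y rootPhase (40 * len n ^ 2 * unit Y w) (fun σ' => σ'.v .found ≤ 1 ∧
      (σ'.v .found = 1 ↔ f₀ = 1 ∨ ∃ x, x ^ j = n)) σ := by
  have hL : 0 < len n := by unfold len; omega
  have hpn := two_pow_len_le (show n ≠ 0 by omega)
  have hLn : len n ≤ n + 1 := by
    have := Nat.lt_two_pow_self (n := len n - 1); omega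
  have hLL : len n ≤ len n ^ 2 := Nat.le_self_pow (by norm_num) _
  have hsq : 2 * (n + 1) * 1 ≤ 2 * (n + 1) * (2 * (n + 1)) := Nat.mul_le_mul_left _ (by omega)
  have hsq' : 4 * (n + 1) * (n + 1) = 2 * (n + 1) * (2 * (n + 1)) := by ring
  have hw0 := ne_zero_of_lt_two_pow hw (by positivity)
  refine WP.comp (2 * unit Y w) (∑ i ∈ Finset.range (len n), ((10 * len n * unit Y w + 12 * unit Y w) + unit Y w) + unit Y w)
    (fun σ1 => σ1.v .r = 0 ∧ σ1.v .b = 2 ^ (len n - 1)) ?_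
    (WP.assign w hY le_rfl ?_ ?_) ?_
  · rw [Finset.sum_const, Finset.card_range, smul_eq_mul]
    have h3 : 1 * unit Y w ≤ len n ^ 2 * unit Y w := Nat.mul_le_mul_right _ (by omega)
    have h4 : len n * unit Y w ≤ len n ^ 2 * unit Y w := Nat.mul_le_mul_right _ hLL
    calc _ = 10 * (len n ^ 2 * unit Y w) + 13 * (len n * unit Y w) + 3 * (1 * unit Y w) := by ring
      _ ≤ 40 * (len n ^ 2 * unit Y w) := by omega
      _ = _ := by ring
  · simp [h1, hσy]; omega
  · simp [h1, hσy]
  rintro σ1 hF1 ⟨h2, h3⟩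
  have ho1 : σ1.v .one = 1 := (hF1.1 .one (by decide)).trans h1
  have hn1 : σ1.v .n = n := (hF1.1 .n (by decide)).trans hσn
  have hj1 : σ1.v .j = j := (hF1.1 .j (by decide)).trans hσj
  have hf1 : σ1.v .found = f₀ := (hF1.1 .found (by decide)).trans hσf
  -- The bits of the root are found from the top: r^j ≤ n < (r + 2^i)^j. At i = 0 only r itself can
  -- be a root, and equality was recorded when r last changed. The form 2^i / 2 makes b zero exactly
  -- at i = 0, which ends the loop.
  refine WP.loop (I := fun i σ' => σ'.v .b = 2 ^ i / 2 ∧ i ≤ len n ∧ σ'.v .r ^ j ≤ n ∧ n < (σ'.v .r + 2 ^ i) ^ j ∧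
    σ'.v .found ≤ 1 ∧ (σ'.v .found = 1 → f₀ = 1 ∨ ∃ x, x ^ j = n) ∧ (f₀ = 1 → σ'.v .found = 1) ∧
    (σ'.v .r ^ j = n → σ'.v .found = 1)) ?_ (len n) σ1 (.refl _ _) ?_
  swap
  · obtain ⟨l, hl⟩ : ∃ l, len n = l + 1 := ⟨len n - 1, by omega⟩
    refine ⟨?_, le_rfl, ?_, ?_, ?_, ?_, ?_, ?_⟩
    · rw [h3, hl, pow_succ]; simp
    · rw [h2, zero_pow (by omega)]; omega
    · rw [h2, zero_add]
      exact (lt_two_pow_len n).trans_le (Nat.le_self_pow (by omega) _)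
    · omega
    · rw [hf1]; exact Or.inl
    · rw [hf1]; exact id
    · rw [h2, zero_pow (by omega)]; omega
  rintro i σ2 hF2 ⟨hb, hiL, hrn, hnr, hf1', hfs, hf0, hfr⟩
  have ho2 : σ2.v .one = 1 := (hF2.1 .one (by decide)).trans ho1
  have hn2 : σ2.v .n = n := (hF2.1 .n (by decide)).trans hn1
  have hj2' : σ2.v .j = j := (hF2.1 .j (by decide)).trans hj1
  have hbn : σ2.v .b ≤ n := by
    rw [hb]
    have : 2 ^ i ≤ 2 ^ (len n - 1 + 1) := Nat.pow_le_pow_right (by norm_num) (by omega)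
    rw [pow_succ] at this
    omega
  generalize hr : σ2.v .r = r at *
  generalize hff : σ2.v .found = f at *
  have hrle : r ≤ n := (Nat.le_self_pow (by omega) _).trans hrn
  refine ⟨guard_le (by omega) hY, fun h0 => ?_, fun h0 => ?_⟩
  · have hi0 : i = 0 := by
      by_contra h
      obtain ⟨l, rfl⟩ : ∃ l, i = l + 1 := ⟨i - 1, by omega⟩
      rw [hb, pow_succ] at h0
      have := Nat.two_pow_pos l
      omega
    subst hi0
    refine ⟨hf1', hfs, ?_⟩
    rintro (h | ⟨x, hx⟩)
    · exact hf0 h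
    · apply hfr
      have e1 : r ≤ x := by
        by_contra h
        have : x ^ j < r ^ j := Nat.pow_lt_pow_left (by omega) (by omega)
        omega
      have e2 : x < r + 1 := by
        by_contra h
        have : (r + 2 ^ 0) ^ j ≤ x ^ j := Nat.pow_le_pow_left (by rw [pow_zero]; omega) _
        omega
      rw [show r = x by omega, hx]
  obtain ⟨l, rfl⟩ : ∃ l, i = l + 1 := ⟨i - 1, by rcases i with _ | i; · simp at hb; omega
                                                 · omega⟩
  have hbl : σ2.v .b = 2 ^ l := by rw [hb, pow_succ]; simp
  have hl0 := Nat.two_pow_pos l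
  refine ⟨l, rfl, WP.comp _ _ _ le_rfl (powCap_spec hY hw hj hLn hL hrle hbn (by omega) ho2 hn2 hr rfl hj2') ?_⟩
  intro σ3 hF3 hacc
  have ho3 : σ3.v .one = 1 := (hF3.1 .one (by decide)).trans ho2
  have hn3 : σ3.v .n = n := (hF3.1 .n (by decide)).trans hn2
  have hr3 : σ3.v .r = r := (hF3.1 .r (by decide)).trans hr
  have hb3 : σ3.v .b = 2 ^ l := (hF3.1 .b (by decide)).trans hbl
  have hf3 : σ3.v .found = f := (hF3.1 .found (by decide)).trans hff
  rw [hbl] at hbn hacc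
  have hrr : r + 2 ^ (l + 1) = r + 2 ^ l + 2 ^ l := by rw [pow_succ]; ring
  rw [hrr] at hnr
  by_cases hc : (r + 2 ^ l) ^ j ≤ n
  · rw [min_eq_left (by omega)] at hacc
    generalize hC : (r + 2 ^ l) ^ j = C at *
    have e1 : C - n = 0 := by omega
    refine WP.assign w hY le_rfl ?_ ?_
    · simp [ho3, hn3, hr3, hb3, hf3, hacc, e1]
      have e5 : (1 - (n - C)) * (1 - f) ≤ 1 * 1 := Nat.mul_le_mul (by omega) (by omega)
      clear * - hw0 hc hsq hsq' hw hbn hrle hf1' e1 e5 hn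
      omega
    · simp [ho3, hn3, hr3, hb3, hf3, hacc, e1]
      rw [hC]
      refine ⟨by omega, hc, hnr, ?_⟩
      clear hnr
      rcases Nat.lt_or_ge f 1 with hf | hf
      · obtain rfl : f = 0 := by omega
        simp only [Nat.sub_zero, mul_one, zero_add] at *
        refine ⟨by omega, fun h => Or.inr ⟨r + 2 ^ l, by omega⟩, fun h => absurd (hf0 h) (by norm_num), fun h => by omega⟩
      · obtain rfl : f = 1 := by omega
        simp at *
        exact hfs
  · rw [min_eq_right (by omega)] at hacc
    refine WP.assign w hY le_rfl ?_ ?_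
    · simp [ho3, hn3, hr3, hb3, hf3, hacc]
      clear hfs
      omega
    · simp [ho3, hn3, hr3, hb3, hf3, hacc]
      exact ⟨by omega, hrn, by omega, hf1', hfs, hf0, hfr⟩

/-- The number `n` is a `j`-th power for some `a < j ≤ b`. -/
def HasRoot (n a b : ℕ) : Prop := ∃ x j, a < j ∧ j ≤ b ∧ x ^ j = n

/-- Tests whether `n` is a perfect power. -/
def rootsPhase : Stmt :=
  .prims [.copy .y .one, .sub .i .len .one] ;;
  .loop .i (.prims [.add .y .y .y, .sub .i .i .one]) ;;
  .prims [.sub .found .one .one, .sub .kk .len .one] ;;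
  .loop .kk (.prims [.add .j .kk .one] ;; rootPhase ;; .prims [.sub .kk .kk .one])

/-- A base is at least 2, so only exponents up to L = `len n` matter. The L exponents, L bits of a
root and L multiplications for a power explain the factor L³. -/
theorem rootsPhase_spec {w n : ℕ} (hY : len w + 2 ≤ Y) (hn : 2 ≤ n) (hw : 4 * (n + 1) * (n + 1) < 2 ^ w)
    {σ : St} (h1 : σ.v .one = 1) (hσn : σ.v .n = n) (hlen : σ.v .len = len n) :
    WP Y rootsPhase (60 * len n ^ 3 * unit Y w) (fun σ' => σ'.v .found ≤ 1 ∧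
      (σ'.v .found = 1 ↔ ∃ x j, 2 ≤ j ∧ x ^ j = n)) σ := by
  have hpn := two_pow_len_le (show n ≠ 0 by omega)
  have hLn : len n ≤ n + 1 := by
    have := Nat.lt_two_pow_self (n := len n - 1); omega
  have hsq : 2 * (n + 1) * 1 ≤ 2 * (n + 1) * (2 * (n + 1)) := Nat.mul_le_mul_left _ (by omega)
  have hsq' : 4 * (n + 1) * (n + 1) = 2 * (n + 1) * (2 * (n + 1)) := by ring
  have hw0 := ne_zero_of_lt_two_pow hw (by positivity)
  obtain ⟨l, hl⟩ : ∃ l, len n = l + 1 := ⟨len n - 1, by unfold len; omega⟩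
  have hlt := lt_two_pow_len n
  rw [hl] at hlen hlt hpn hLn ⊢
  rw [Nat.add_sub_cancel] at hpn
  refine WP.comp (2 * unit Y w) ((∑ i ∈ Finset.Ico 0 l, (2 * unit Y w + unit Y w) + unit Y w) + (2 * unit Y w +
      (∑ i ∈ Finset.Ico 0 l, ((unit Y w + (40 * (l + 1) ^ 2 * unit Y w + unit Y w)) + unit Y w) + unit Y w)))
    (fun σ1 => σ1.v .y = 1 ∧ σ1.v .i = l) ?_
    (WP.assign w hY le_rfl ?_ ?_) ?_
  · rw [Finset.sum_const, Finset.sum_const, Nat.card_Ico, smul_eq_mul, smul_eq_mul, Nat.sub_zero]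
    calc _ = (40 * (l * (l + 1) ^ 2) + 6 * l + 6) * unit Y w := by ring
      _ ≤ (40 * (l + 1) ^ 3 + 6 * ((l + 1) ^ 3) + 6 * (l + 1) ^ 3) * unit Y w := by
        have e1 : l * (l + 1) ^ 2 ≤ (l + 1) ^ 3 := by rw [pow_succ' _ 2]; gcongr; omega
        have e2 : 1 ≤ (l + 1) ^ 3 := Nat.one_le_pow _ _ (by omega)
        have e3 : l + 1 ≤ (l + 1) ^ 3 := Nat.le_self_pow (by norm_num) _
        exact Nat.mul_le_mul_right _ (by omega)
      _ = 52 * ((l + 1) ^ 3 * unit Y w) := by ring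
      _ ≤ 60 * ((l + 1) ^ 3 * unit Y w) := Nat.mul_le_mul_right _ (by norm_num)
      _ = _ := by ring
  · simp [h1, hlen]; omega
  · simp [h1, hlen]
  rintro σ1 hF1 ⟨h2, h3⟩
  have ho1 : σ1.v .one = 1 := (hF1.1 .one (by decide)).trans h1
  have hn1 : σ1.v .n = n := (hF1.1 .n (by decide)).trans hσn
  have hl1 : σ1.v .len = l + 1 := (hF1.1 .len (by decide)).trans hlen
  refine WP.comp _ _ (fun σ2 => σ2.v .y = 2 ^ l) le_rfl (WP.count 0 l (unit Y w) (fun _ => 2 * unit Y w)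
      (fun i σ' => σ'.v .i = l - i ∧ σ'.v .y = 2 ^ i) le_rfl (Nat.zero_le _) (guard_le (by omega) hY)
      ⟨by simp [h3], by simp [h2]⟩ (fun i σ' h => h.1) ?_ (fun σ' _ h => h.2)) ?_
  · rintro i σ' _ hi hF ⟨h4, h5⟩
    have ho2 : σ'.v .one = 1 := (hF.1 .one (by decide)).trans ho1
    have e1 : 2 ^ i ≤ 2 ^ l := Nat.pow_le_pow_right (by norm_num) hi.le
    refine WP.assign w hY le_rfl ?_ ⟨?_, ?_⟩
    · simp [ho2, h4, h5]; omega
    · simp [ho2, h4]; omega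
    · simp [h5, pow_succ]; omega
  intro σ2 hF2 h4
  have ho2 : σ2.v .one = 1 := (hF2.1 .one (by decide)).trans ho1
  have hn2 : σ2.v .n = n := (hF2.1 .n (by decide)).trans hn1
  have hl2 : σ2.v .len = l + 1 := (hF2.1 .len (by decide)).trans hl1
  refine WP.comp _ _ (fun σ3 => σ3.v .found = 0 ∧ σ3.v .kk = l) le_rfl (WP.assign w hY le_rfl ?_ ?_) ?_
  · simp [ho2, hl2]; omega
  · simp [ho2, hl2]
  rintro σ3 hF3 ⟨h5, h6⟩
  have ho3 : σ3.v .one = 1 := (hF3.1 .one (by decide)).trans ho2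
  have hn3 : σ3.v .n = n := (hF3.1 .n (by decide)).trans hn2
  have hy3 : σ3.v .y = 2 ^ l := (hF3.1 .y (by decide)).trans h4
  refine WP.count 0 l (unit Y w) _ (fun i σ' => σ'.v .kk = l - i ∧ σ'.v .found ≤ 1 ∧
      (σ'.v .found = 1 ↔ HasRoot n (l + 1 - i) (l + 1))) le_rfl (Nat.zero_le _) (guard_le (by omega) hY)
      ⟨by simp [h6], by omega, ?_⟩ (fun i σ' h => h.1) ?_ ?_
  · rw [h5]
    constructor
    · intro h; omega
    · rintro ⟨x, j, h7, h8, _⟩; omega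
  · rintro i σ4 _ hi hF4 ⟨h7, h8, h9⟩
    have ho4 : σ4.v .one = 1 := (hF4.1 .one (by decide)).trans ho3
    have hn4 : σ4.v .n = n := (hF4.1 .n (by decide)).trans hn3
    have hy4 : σ4.v .y = 2 ^ l := (hF4.1 .y (by decide)).trans hy3
    refine WP.comp _ _ (fun σ5 => σ5.v .j = l + 1 - i) le_rfl (WP.assign w hY (by simp) ?_ ?_) ?_
    · simp [ho4, h7]; omega
    · simp [ho4, h7]; omega
    intro σ5 hF5 h10
    have ho5 : σ5.v .one = 1 := (hF5.1 .one (by decide)).trans ho4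
    have hn5 : σ5.v .n = n := (hF5.1 .n (by decide)).trans hn4
    have hy5 : σ5.v .y = 2 ^ l := (hF5.1 .y (by decide)).trans hy4
    have hk5 : σ5.v .kk = l - i := (hF5.1 .kk (by decide)).trans h7
    have hf5 : σ5.v .found = σ4.v .found := hF5.1 .found (by decide)
    refine WP.comp _ _ _ le_rfl (rootPhase_spec (j := l + 1 - i) hY hn (by omega) (by omega) (by omega) h8 ho5 hn5
      (by rw [hy5, hl]; simp) h10 hf5) ?_ |>.mono (by rw [hl]) fun _ _ h => h
    rintro σ6 hF6 ⟨h11, h12⟩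
    have ho6 : σ6.v .one = 1 := (hF6.1 .one (by decide)).trans ho5
    have hk6 : σ6.v .kk = l - i := (hF6.1 .kk (by decide)).trans hk5
    refine WP.assign w hY (by simp) ?_ ⟨?_, ?_, ?_⟩
    · simp [ho6, hk6]; clear h12; omega
    · simp [ho6, hk6]; clear h12; omega
    · simpa using h11
    · simp [h12, h9, HasRoot]
      clear h9 h12
      constructor
      · rintro (⟨x, j, h13, h14, h15⟩ | ⟨x, hx⟩)
        · exact ⟨x, j, by omega, h14, h15⟩
        · exact ⟨x, l + 1 - i, by omega, by omega, hx⟩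
      · rintro ⟨x, j, h13, h14, h15⟩
        by_cases hj : j = l + 1 - i
        · exact Or.inr ⟨x, hj ▸ h15⟩
        · exact Or.inl ⟨x, j, by omega, h14, h15⟩
  · rintro σ4 hF4 ⟨h7, h8, h9⟩
    refine ⟨h8, h9.trans ⟨?_, ?_⟩⟩
    · rintro ⟨x, j, h13, h14, h15⟩
      exact ⟨x, j, by omega, h15⟩
    · rintro ⟨x, j, h13, h15⟩
      refine ⟨x, j, by omega, ?_, h15⟩
      have hx : 2 ≤ x := by
        by_contra h
        have : x ^ j ≤ 1 ^ j := Nat.pow_le_pow_left (by omega) _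
        rw [one_pow] at this
        omega
      have : 2 ^ j ≤ n := h15 ▸ Nat.pow_le_pow_left hx _
      have := (Nat.pow_lt_pow_iff_right (show 1 < 2 by norm_num)).1 (this.trans_lt hlt)
      omega

end RAM

/-! ### The search for numbers e with distinct powers. -/

namespace RAM

variable {Y : ℕ}

theorem dvd_dist_iff {p x y : ℕ} : p ∣ x - y + (y - x) ↔ y ≡ x [MOD p] := by
  rcases le_total x y with h | h
  · rw [Nat.sub_eq_zero_of_le h, zero_add, ← Nat.modEq_iff_dvd' h, Nat.ModEq.comm]
  · rw [Nat.sub_eq_zero_of_le h, add_zero, ← Nat.modEq_iff_dvd' h]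

/-- The number `x` is congruent to one of the different numbers `H 0, …, H (c - 1)`. -/
def Collides (H : ℕ → ℕ) (x c p : ℕ) : Prop := ∃ i < c, H i ≠ x ∧ H i ≡ x [MOD p]

theorem collides_succ {H : ℕ → ℕ} {x c p : ℕ} :
    Collides H x (c + 1) p ↔ Collides H x c p ∨ (H c ≠ x ∧ H c ≡ x [MOD p]) := by
  constructor
  · rintro ⟨i, hi, h⟩
    rcases Nat.lt_succ_iff_lt_or_eq.1 hi with hi | rfl
    · exact Or.inl ⟨i, hi, h⟩
    · exact Or.inr h
  · rintro (⟨i, hi, h⟩ | h)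
    · exact ⟨i, by omega, h⟩
    · exact ⟨c, by omega, h⟩

/-- All of `H 0, …, H (c - 1)` differ from `x`. -/
def Avoids (H : ℕ → ℕ) (x c : ℕ) : Prop := ∀ i < c, H i ≠ x

/-- The effect on the product `pr` of the comparison of `x` with the list `H`. -/
def ScanRel (n : ℕ) (H : ℕ → ℕ) (x c pr pr' : ℕ) : Prop :=
  ∀ p : ℕ, p.Prime → p ∣ n → (p ∣ pr' ↔ p ∣ pr ∨ Collides H x c p)

/-- Compares `x` with the list `H`; the differences are multiplied into `pr`. -/
def scanPhase : Stmt :=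
  .prims [.sub .i .one .one, .copy .f .one, .copy .j .cnt] ;;
  .loop .j (.prims [.get .y .H .i, .sub .t .x .y, .sub .t1 .y .x, .add .t .t .t1] ;;
    .ite .t (.prims [.mul .pr .pr .t, .div .q .pr .n, .mul .q .n .q, .sub .pr .pr .q]) (.prims [.sub .f .one .one]) ;;
    .prims [.add .i .i .one, .sub .j .j .one])

/-- A zero difference lowers the flag `f`; only nonzero differences enter the product. So a prime
divisor p of n divides the new product precisely if it divided the old one or identifies x with a
different entry. Reduction modulo n does not affect divisibility by p. -/
theorem scanPhase_spec {w n c x pr : ℕ} {H : ℕ → ℕ} (hY : len w + 2 ≤ Y) (hn : 2 ≤ n) (hw : 4 * (n * n) < 2 ^ w)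
    (hc : c ≤ n) (hx : x < n) (hH : ∀ i < c, H i < n) (hpr : pr < n) {σ : St} (h1 : σ.v .one = 1) (hσn : σ.v .n = n)
    (hσx : σ.v .x = x) (hσc : σ.v .cnt = c) (hσp : σ.v .pr = pr) (hσH : σ.a .H = H) :
    WP Y scanPhase ((12 * c + 4) * unit Y w) (fun σ' => σ'.v .f ≤ 1 ∧ (σ'.v .f = 1 ↔ Avoids H x c) ∧
      σ'.v .pr < n ∧ ScanRel n H x c pr (σ'.v .pr)) σ := by
  have hnn : n * 1 ≤ n * n := Nat.mul_le_mul_left _ (by omega)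
  have hw0 := ne_zero_of_lt_two_pow hw (by positivity)
  refine WP.comp (3 * unit Y w) (∑ i ∈ Finset.Ico 0 c, (11 * unit Y w + unit Y w) + unit Y w) (fun σ1 =>
    σ1.v .i = 0 ∧ σ1.v .f = 1 ∧ σ1.v .j = c) ?_ (WP.assign w hY le_rfl ?_ ?_) ?_
  · rw [Finset.sum_const, Nat.card_Ico, smul_eq_mul, Nat.sub_zero]
    linarith
  · simp [h1, hσc]; omega
  · simp [h1, hσc]
  rintro σ1 hF1 ⟨h2, h3, h4⟩
  have ho1 : σ1.v .one = 1 := (hF1.1 .one (by decide)).trans h1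
  have hn1 : σ1.v .n = n := (hF1.1 .n (by decide)).trans hσn
  have hx1 : σ1.v .x = x := (hF1.1 .x (by decide)).trans hσx
  have hp1 : σ1.v .pr = pr := (hF1.1 .pr (by decide)).trans hσp
  have hH1 : σ1.a .H = H := (hF1.2 .H (by decide)).trans hσH
  refine WP.count 0 c _ _ (fun i σ' => σ'.v .j = c - i ∧ σ'.v .i = i ∧ σ'.v .f ≤ 1 ∧ (σ'.v .f = 1 ↔ Avoids H x i) ∧
      σ'.v .pr < n ∧ ScanRel n H x i pr (σ'.v .pr)) le_rfl
    (Nat.zero_le _) (guard_le (by omega) hY) ⟨by omega, h2, by omega, ?_, by omega, ?_⟩ (fun i σ' h => h.1) ?_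
    fun σ' _ h => h.2.2
  · rw [h3]; simp [Avoids]
  · intro p hp hpn
    rw [hp1]; simp [Collides]
  rintro i σ2 _ hi hF2 ⟨h5, h6, h7, h8, h9, h10⟩
  have ho2 : σ2.v .one = 1 := (hF2.1 .one (by decide)).trans ho1
  have hn2 : σ2.v .n = n := (hF2.1 .n (by decide)).trans hn1
  have hx2 : σ2.v .x = x := (hF2.1 .x (by decide)).trans hx1
  have hH2 : σ2.a .H = H := (hF2.2 .H (by decide)).trans hH1
  have hHi := hH i hi
  generalize hP : σ2.v .pr = P at *
  generalize hff : σ2.v .f = f at *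
  have havoid : Avoids H x (i + 1) ↔ Avoids H x i ∧ H i ≠ x := by
    constructor
    · exact fun h => ⟨fun j hj => h j (by omega), h i (by omega)⟩
    · rintro ⟨h, h'⟩ j hj
      rcases Nat.lt_succ_iff_lt_or_eq.1 hj with hj | rfl
      · exact h j hj
      · exact h'
  refine WP.comp (4 * unit Y w) (7 * unit Y w) (fun σ3 => σ3.v .t = x - H i + (H i - x)) (by omega)
    (WP.assign w hY le_rfl ?_ ?_) ?_
  · simp [hx2, hH2, h6]; omega
  · simp [hx2, hH2, h6]
  intro σ3 hF3 ht
  have ho3 : σ3.v .one = 1 := (hF3.1 .one (by decide)).trans ho2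
  have hn3 : σ3.v .n = n := (hF3.1 .n (by decide)).trans hn2
  have hP3 : σ3.v .pr = P := (hF3.1 .pr (by decide)).trans hP
  have hi3 : σ3.v .i = i := (hF3.1 .i (by decide)).trans h6
  have hj3 : σ3.v .j = c - i := (hF3.1 .j (by decide)).trans h5
  have hf3 : σ3.v .f = f := (hF3.1 .f (by decide)).trans hff
  refine WP.comp (4 * unit Y w + unit Y w) (2 * unit Y w) (fun σ4 => σ4.v .f ≤ 1 ∧ (σ4.v .f = 1 ↔ Avoids H x (i + 1)) ∧
      σ4.v .pr < n ∧ ScanRel n H x (i + 1) pr (σ4.v .pr)) (by omega) (WP.ite ?_ ?_ ?_) ?_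
  · rw [ht]; exact guard_le (by omega) hY
  · intro h0
    rw [ht] at h0
    have e1 : P * (x - H i + (H i - x)) ≤ n * n := Nat.mul_le_mul h9.le (by omega)
    have e2 := Nat.mul_div_le (P * (x - H i + (H i - x))) n
    have e3 := Nat.div_le_self (P * (x - H i + (H i - x))) n
    refine WP.assign w hY le_rfl ?_ ?_
    · simp [hn3, hP3, ht]; omega
    · simp [hn3, hP3, ht, sub_mul_div, hf3]
      refine ⟨h7, ?_, Nat.mod_lt _ (by omega), fun p hp hpn => ?_⟩
      · rw [h8, havoid, and_iff_left]
        rintro rfl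
        omega
      · rw [Nat.dvd_mod_iff hpn, hp.dvd_mul, h10 p hp hpn, collides_succ, dvd_dist_iff, or_assoc]
        have : H i ≠ x := by
          rintro rfl
          omega
        simp [this]
  · intro h0
    rw [ht] at h0
    have e1 : H i = x := by omega
    refine WP.assign w hY (by simp; omega) ?_ ?_
    · simp [ho3]; omega
    · simp [ho3, hP3, havoid, e1, h9]
      intro p hp hpn
      rw [collides_succ, h10 p hp hpn]
      simp [e1]
  rintro σ4 hF4 ⟨h11, h12, h13, h14⟩
  have ho4 : σ4.v .one = 1 := (hF4.1 .one (by decide)).trans ho3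
  have hi4 : σ4.v .i = i := (hF4.1 .i (by decide)).trans hi3
  have hj4 : σ4.v .j = c - i := (hF4.1 .j (by decide)).trans hj3
  refine WP.assign w hY le_rfl ?_ ?_
  · simp [ho4, hi4, hj4]; omega
  · simp [ho4, hi4, hj4]
    exact ⟨by omega, h11, h12, h13, h14⟩

/-- The list `S 0, …, S (c - 1)` of numbers `e ≤ k` with different powers `H i = S i ^ 2 ^ kap` modulo `n`,
and the product `pr`. -/
structure Cands (n kap vv k c pr : ℕ) (S H : ℕ → ℕ) : Prop where
  le : c ≤ vv
  pr_lt : pr < n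
  mem : ∀ i < c, 1 ≤ S i ∧ S i ≤ k ∧ H i = S i ^ 2 ^ kap % n
  inj : ∀ i < c, ∀ j < c, H i = H j → i = j
  full : c < vv → ∀ e, 1 ≤ e → e ≤ k → ∃ i < c, H i = e ^ 2 ^ kap % n
  sound : ∀ p : ℕ, p.Prime → p ∣ n → ¬ p ∣ pr → (∀ e, 1 ≤ e → e ≤ k → ¬ p ∣ e) ∧
    ∀ i < c, ∀ j < c, i ≠ j → ¬ H i ≡ H j [MOD p]
  prime : n.Prime → ¬ n ∣ pr

theorem Cands.init {n kap vv : ℕ} (hn : 2 ≤ n) (S H : ℕ → ℕ) : Cands n kap vv 0 0 1 S H where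
  le := Nat.zero_le _
  pr_lt := hn
  mem := by simp
  inj := by simp
  full := by intro _ e h1 h2; omega
  sound := by intro p _ _ _; exact ⟨fun e h1 h2 => by omega, by simp⟩
  prime := fun h h' => by rw [Nat.dvd_one] at h'; omega

/-- The candidate and its nonzero differences are multiplied into the product even if it is not
stored. For prime n these factors lie strictly between 0 and n, so the product stays invertible. For
any prime divisor p of n that does not divide the product, no candidate vanishes modulo p and the
listed powers remain distinct modulo p. The two conclusions treat a candidate that is stored and one
that is not; a new power is left out only when the list is full, which preserves `full`. -/
theorem Cands.succ {n kap vv k c pr pr₁ pr₂ x : ℕ} {S H : ℕ → ℕ} (h : Cands n kap vv k c pr S H) (hk : k + 1 < n)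
    (hx : x = (k + 1) ^ 2 ^ kap % n) (hpr1 : pr₁ = pr * (k + 1) % n)
    (hpr2 : pr₂ < n) (hs : ScanRel n H x c pr₁ pr₂) :
    (Avoids H x c → c < vv → Cands n kap vv (k + 1) (c + 1) pr₂ (Function.update S c (k + 1)) (Function.update H c x)) ∧
    ((Avoids H x c → vv ≤ c) → Cands n kap vv (k + 1) c pr₂ S H) := by
  have hn0 : 0 < n := by omega
  have hdvd : ∀ p : ℕ, p.Prime → p ∣ n → (p ∣ pr₂ ↔ (p ∣ pr ∨ p ∣ k + 1) ∨ Collides H x c p) := fun p hp hpn => by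
    rw [hs p hp hpn, hpr1, Nat.dvd_mod_iff hpn, hp.dvd_mul]
  have hprime : n.Prime → ¬ n ∣ pr₂ := fun hp => by
    rw [hdvd n hp dvd_rfl]
    rintro ((h1 | h1) | ⟨i, hi, h2, h3⟩)
    · exact h.prime hp h1
    · exact absurd (Nat.le_of_dvd (by omega) h1) (by omega)
    · refine h2 (Nat.ModEq.eq_of_lt_of_lt h3 ?_ ?_)
      · rw [(h.mem i hi).2.2]; exact Nat.mod_lt _ hn0
      · rw [hx]; exact Nat.mod_lt _ hn0
  have hsound : ∀ p : ℕ, p.Prime → p ∣ n → ¬ p ∣ pr₂ → ((∀ e, 1 ≤ e → e ≤ k + 1 → ¬ p ∣ e) ∧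
      ∀ i < c, ∀ j < c, i ≠ j → ¬ H i ≡ H j [MOD p]) ∧ ¬ Collides H x c p := fun p hp hpn hpp => by
    rw [hdvd p hp hpn, not_or, not_or] at hpp
    obtain ⟨⟨h1, h2⟩, h3⟩ := hpp
    obtain ⟨h4, h5⟩ := h.sound p hp hpn h1
    refine ⟨⟨fun e he he' => ?_, h5⟩, h3⟩
    rcases Nat.le_succ_iff.1 he' with he' | rfl
    · exact h4 e he he'
    · exact h2
  constructor
  · intro hav hc
    have hlt : ∀ {i}, i < c + 1 → i ≠ c → i < c := fun h1 h2 => by omega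
    refine ⟨hc, hpr2, fun i hi => ?_, fun i hi j hj hij => ?_, fun hc' e he he' => ?_, fun p hp hpn hpp => ?_, hprime⟩
    · by_cases hic : i = c
      · subst hic; simp [hx]
      · have := h.mem i (hlt hi hic)
        rw [Function.update_of_ne hic, Function.update_of_ne hic]
        exact ⟨this.1, this.2.1.trans (Nat.le_succ _), this.2.2⟩
    · by_cases hic : i = c <;> by_cases hjc : j = c
      · rw [hic, hjc]
      · subst hic
        rw [Function.update_self, Function.update_of_ne hjc] at hij
        exact absurd hij.symm (hav j (hlt hj hjc))
      · subst hjc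
        rw [Function.update_self, Function.update_of_ne hic] at hij
        exact absurd hij (hav i (hlt hi hic))
      · rw [Function.update_of_ne hic, Function.update_of_ne hjc] at hij
        exact h.inj i (hlt hi hic) j (hlt hj hjc) hij
    · rcases Nat.le_succ_iff.1 he' with he' | rfl
      · obtain ⟨i, hi, h1⟩ := h.full hc e he he'
        exact ⟨i, by omega, by rw [Function.update_of_ne (by omega)]; exact h1⟩
      · exact ⟨c, by omega, by rw [Function.update_self, hx]⟩
    · obtain ⟨⟨h1, h2⟩, h3⟩ := hsound p hp hpn hpp
      refine ⟨h1, fun i hi j hj hij => ?_⟩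
      by_cases hic : i = c <;> by_cases hjc : j = c
      · exact absurd (hic.trans hjc.symm) hij
      · subst hic
        rw [Function.update_self, Function.update_of_ne hjc]
        exact fun h4 => h3 ⟨j, hlt hj hjc, hav j (hlt hj hjc), h4.symm⟩
      · subst hjc
        rw [Function.update_self, Function.update_of_ne hic]
        exact fun h4 => h3 ⟨i, hlt hi hic, hav i (hlt hi hic), h4⟩
      · rw [Function.update_of_ne hic, Function.update_of_ne hjc]
        exact h2 i (hlt hi hic) j (hlt hj hjc) hij
  · intro hav
    refine ⟨h.le, hpr2, fun i hi => ?_, h.inj, fun hc e he he' => ?_, fun p hp hpn hpp => (hsound p hp hpn hpp).1, hprime⟩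
    · have := h.mem i hi
      exact ⟨this.1, this.2.1.trans (Nat.le_succ _), this.2.2⟩
    · rcases Nat.le_succ_iff.1 he' with he' | rfl
      · exact h.full hc e he he'
      · by_contra hne
        push Not at hne
        exact absurd (hav fun i hi => by rw [hx]; exact hne i hi) (by omega)

/-- Treats the candidate `e`. -/
def candPhase : Stmt :=
  .prims [.copy .x .e, .copy .z .kap] ;;
  .loop .z (.prims [.mul .x .x .x, .div .q .x .n, .mul .q .n .q, .sub .x .x .q, .sub .z .z .one]) ;;
  .prims [.mul .pr .pr .e, .div .q .pr .n, .mul .q .n .q, .sub .pr .pr .q] ;;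
  scanPhase ;;
  .prims [.sub .g .vv .cnt] ;;
  .ite .f (.ite .g (.prims [.put .S .cnt .e, .put .H .cnt .x, .add .cnt .cnt .one]) (.prims [])) (.prims []) ;;
  .prims [.add .e .e .one, .sub .o .o .one]

theorem candPhase_spec {w n kap vv k c pr l : ℕ} {S H : ℕ → ℕ} (hY : len w + 2 ≤ Y) (hn : 2 ≤ n)
    (hw : 4 * (n * n) < 2 ^ w) (hkap : kap < 2 ^ w) (hvv : vv ≤ n) (hl : l ≤ n) (h : Cands n kap vv k c pr S H)
    (hk : k + 1 < n) {σ : St} (h1 : σ.v .one = 1) (hσn : σ.v .n = n) (hσk : σ.v .kap = kap) (hσv : σ.v .vv = vv)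
    (hσe : σ.v .e = k + 1) (hσo : σ.v .o = l)
    (hσc : σ.v .cnt = c) (hσp : σ.v .pr = pr) (hσS : σ.a .S = S) (hσH : σ.a .H = H) :
    WP Y candPhase ((6 * kap + 12 * vv + 20) * unit Y w) (fun σ' => σ'.v .e = k + 2 ∧ σ'.v .o = l - 1 ∧
      Cands n kap vv (k + 1) (σ'.v .cnt) (σ'.v .pr) (σ'.a .S) (σ'.a .H)) σ := by
  have hnn : n * 1 ≤ n * n := Nat.mul_le_mul_left _ (by omega)
  have hw0 := ne_zero_of_lt_two_pow hw (by positivity)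
  have hcv := h.le
  have hprn := h.pr_lt
  have hkn : k < n := by omega
  have hcost : (12 * c + 4) * unit Y w ≤ (12 * vv + 4) * unit Y w := Nat.mul_le_mul_right _ (by omega)
  refine WP.comp (2 * unit Y w) ((6 * kap + 12 * vv + 18) * unit Y w) (fun σ1 => σ1.v .x = (k + 1) ^ 2 ^ 0 % n ∧ σ1.v .z = kap)
    (by linarith) (WP.assign w hY le_rfl ?_ ?_) ?_
  · simp [hσe, hσk]; omega
  · simp [hσe, hσk, Nat.mod_eq_of_lt hk]
  rintro σ1 hF1 ⟨h2, h3⟩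
  have ho1 : σ1.v .one = 1 := (hF1.1 .one (by decide)).trans h1
  have hn1 : σ1.v .n = n := (hF1.1 .n (by decide)).trans hσn
  refine WP.comp (∑ i ∈ Finset.Ico 0 kap, (5 * unit Y w + unit Y w) + unit Y w) ((12 * vv + 17) * unit Y w)
    (fun σ2 => σ2.v .x = (k + 1) ^ 2 ^ kap % n) ?_ (WP.count 0 kap _ _
      (fun i σ' => σ'.v .z = kap - i ∧ σ'.v .x = (k + 1) ^ 2 ^ i % n) le_rfl
      (Nat.zero_le _) (guard_le (by omega) hY) ⟨h3, h2⟩ (fun i σ' h => h.1) ?_ fun σ' _ h => h.2) ?_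
  · rw [Finset.sum_const, Nat.card_Ico, smul_eq_mul, Nat.sub_zero]
    linarith
  · rintro i σ2 _ hi hF2 ⟨h4, h5⟩
    have ho2 : σ2.v .one = 1 := (hF2.1 .one (by decide)).trans ho1
    have hn2 : σ2.v .n = n := (hF2.1 .n (by decide)).trans hn1
    have e0 : (k + 1) ^ 2 ^ i % n < n := Nat.mod_lt _ (by omega)
    have e4 : ((k + 1) ^ 2 ^ i % n) * ((k + 1) ^ 2 ^ i % n) % n = (k + 1) ^ 2 ^ (i + 1) % n := by
      rw [← Nat.mul_mod, ← pow_add, pow_succ 2 i, mul_two]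
    generalize (k + 1) ^ 2 ^ i % n = a at *
    have e1 : a * a ≤ n * n := Nat.mul_le_mul e0.le e0.le
    have e2 := Nat.mul_div_le (a * a) n
    have e3 := Nat.div_le_self (a * a) n
    refine WP.assign w hY le_rfl ?_ ⟨?_, ?_⟩
    · simp [ho2, hn2, h4, h5]; omega
    · simp [ho2, h4]; omega
    · simp [hn2, h5, sub_mul_div, e4]
  intro σ2 hF2 hx2
  have ho2 : σ2.v .one = 1 := (hF2.1 .one (by decide)).trans ho1
  have hn2 : σ2.v .n = n := (hF2.1 .n (by decide)).trans hn1
  have he2 : σ2.v .e = k + 1 := (hF2.1 .e (by decide)).trans ((hF1.1 .e (by decide)).trans hσe)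
  have hp2 : σ2.v .pr = pr := (hF2.1 .pr (by decide)).trans ((hF1.1 .pr (by decide)).trans hσp)
  have e1 : pr * (k + 1) ≤ n * n := Nat.mul_le_mul hprn.le hk.le
  have e2 := Nat.mul_div_le (pr * (k + 1)) n
  have e3 := Nat.div_le_self (pr * (k + 1)) n
  refine WP.comp (4 * unit Y w) ((12 * vv + 13) * unit Y w) (fun σ3 => σ3.v .pr = pr * (k + 1) % n) (by linarith)
    (WP.assign w hY le_rfl ?_ ?_) ?_
  · simp [hn2, hp2, he2]; omega
  · simp [hn2, hp2, he2, sub_mul_div]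
  intro σ3 hF3 hp3
  have ho3 : σ3.v .one = 1 := (hF3.1 .one (by decide)).trans ho2
  have hn3 : σ3.v .n = n := (hF3.1 .n (by decide)).trans hn2
  have he3 : σ3.v .e = k + 1 := (hF3.1 .e (by decide)).trans he2
  have hx3 : σ3.v .x = (k + 1) ^ 2 ^ kap % n := (hF3.1 .x (by decide)).trans hx2
  have hc3 : σ3.v .cnt = c := (hF3.1 .cnt (by decide)).trans ((hF2.1 .cnt (by decide)).trans
    ((hF1.1 .cnt (by decide)).trans hσc))
  have hv3 : σ3.v .vv = vv := (hF3.1 .vv (by decide)).trans ((hF2.1 .vv (by decide)).trans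
    ((hF1.1 .vv (by decide)).trans hσv))
  have hol3 : σ3.v .o = l := (hF3.1 .o (by decide)).trans ((hF2.1 .o (by decide)).trans
    ((hF1.1 .o (by decide)).trans hσo))
  have hS3 : σ3.a .S = S := (hF3.2 .S (by decide)).trans ((hF2.2 .S (by decide)).trans
    ((hF1.2 .S (by decide)).trans hσS))
  have hH3 : σ3.a .H = H := (hF3.2 .H (by decide)).trans ((hF2.2 .H (by decide)).trans
    ((hF1.2 .H (by decide)).trans hσH))
  have hHn : ∀ i < c, H i < n := fun i hi => by rw [(h.mem i hi).2.2]; exact Nat.mod_lt _ (by omega)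
  refine WP.comp ((12 * vv + 4) * unit Y w) (9 * unit Y w) _ (by linarith)
    ((scanPhase_spec hY hn hw (hcv.trans hvv) (Nat.mod_lt _ (by omega)) hHn (Nat.mod_lt _ (by omega)) ho3 hn3 hx3 hc3 hp3
      hH3).mono hcost fun _ _ h => h) ?_
  rintro σ4 hF4 ⟨hf, hfa, hpn, hs⟩
  have ho4 : σ4.v .one = 1 := (hF4.1 .one (by decide)).trans ho3
  have he4 : σ4.v .e = k + 1 := (hF4.1 .e (by decide)).trans he3
  have hx4 : σ4.v .x = (k + 1) ^ 2 ^ kap % n := (hF4.1 .x (by decide)).trans hx3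
  have hc4 : σ4.v .cnt = c := (hF4.1 .cnt (by decide)).trans hc3
  have hv4 : σ4.v .vv = vv := (hF4.1 .vv (by decide)).trans hv3
  have hol4 : σ4.v .o = l := (hF4.1 .o (by decide)).trans hol3
  have hS4 : σ4.a .S = S := (hF4.2 .S (by decide)).trans hS3
  have hH4 : σ4.a .H = H := (hF4.2 .H (by decide)).trans hH3
  obtain ⟨hnew, hold⟩ := h.succ hk rfl rfl hpn hs
  have hxn : (k + 1) ^ 2 ^ kap % n < n := Nat.mod_lt _ (by omega)
  generalize hxx : (k + 1) ^ 2 ^ kap % n = x at *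
  generalize hPP : σ4.v .pr = P at *
  generalize hff : σ4.v .f = f at *
  refine WP.comp (unit Y w) (8 * unit Y w) (fun σ5 => σ5.v .g = vv - c) (by linarith) (WP.assign w hY (by simp) ?_ ?_) ?_
  · simp [hv4, hc4]; omega
  · simp [hv4, hc4]
  intro σ5 hF5 hg5
  have ho5 : σ5.v .one = 1 := (hF5.1 .one (by decide)).trans ho4
  have he5 : σ5.v .e = k + 1 := (hF5.1 .e (by decide)).trans he4
  have hx5 : σ5.v .x = x := (hF5.1 .x (by decide)).trans hx4
  have hc5 : σ5.v .cnt = c := (hF5.1 .cnt (by decide)).trans hc4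
  have hf5 : σ5.v .f = f := (hF5.1 .f (by decide)).trans hff
  have hol5 : σ5.v .o = l := (hF5.1 .o (by decide)).trans hol4
  have hP5 : σ5.v .pr = P := (hF5.1 .pr (by decide)).trans hPP
  have hS5 : σ5.a .S = S := (hF5.2 .S (by decide)).trans hS4
  have hH5 : σ5.a .H = H := (hF5.2 .H (by decide)).trans hH4
  refine WP.comp (3 * unit Y w + unit Y w + unit Y w) (3 * unit Y w) (fun σ6 =>
      Cands n kap vv (k + 1) (σ6.v .cnt) (σ6.v .pr) (σ6.a .S) (σ6.a .H)) (by linarith) (WP.ite ?_ ?_ ?_) ?_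
  · rw [hf5]; exact guard_le (by omega) hY
  · intro hf1
    have hav := hfa.1 (by omega)
    refine WP.ite ?_ ?_ ?_
    · rw [hg5]; exact guard_le (by omega) hY
    · intro hg
      refine WP.assign w hY le_rfl ?_ ?_
      · simp [hc5, he5, hx5, ho5]; omega
      · simp [hc5, he5, hx5, ho5, hP5, hS5, hH5]
        exact hnew hav (by omega)
    · intro hg
      refine WP.assign w hY (by simp) trivial ?_
      simp only [runs]
      rw [hc5, hP5, hS5, hH5]
      exact hold fun _ => by omega
  · intro hf0
    refine WP.assign w hY (by simp) trivial ?_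
    simp only [runs]
    rw [hc5, hP5, hS5, hH5]
    exact hold fun hav => by
      have := hfa.2 hav
      omega
  intro σ6 hF6 h6
  have ho6 : σ6.v .one = 1 := (hF6.1 .one (by decide)).trans ho5
  have he6 : σ6.v .e = k + 1 := (hF6.1 .e (by decide)).trans he5
  have hol6 : σ6.v .o = l := (hF6.1 .o (by decide)).trans hol5
  refine WP.assign w hY (Nat.mul_le_mul_right _ (show 2 ≤ 3 by norm_num)) ?_ ⟨?_, ?_, ?_⟩
  · simp [ho6, he6, hol6]; omega
  · simp [ho6, he6]
  · simp [ho6, hol6]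
  · simpa using h6

/-- Finds the numbers `e` for the main test. -/
def candsPhase : Stmt :=
  .prims [.copy .pr .one, .sub .cnt .one .one, .copy .e .one, .copy .o .dd] ;;
  .loop .o candPhase

theorem candsPhase_spec {w n kap vv D : ℕ} (hY : len w + 2 ≤ Y) (hn : 2 ≤ n)
    (hw : 4 * (n * n) < 2 ^ w) (hkap : kap < 2 ^ w) (hvv : vv ≤ n) (hD : D < n) {σ : St} (h1 : σ.v .one = 1)
    (hσn : σ.v .n = n) (hσk : σ.v .kap = kap) (hσv : σ.v .vv = vv) (hσd : σ.v .dd = D) :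
    WP Y candsPhase ((D * (6 * kap + 12 * vv + 21) + 5) * unit Y w) (fun σ' =>
      Cands n kap vv D (σ'.v .cnt) (σ'.v .pr) (σ'.a .S) (σ'.a .H)) σ := by
  have hnn : n * 1 ≤ n * n := Nat.mul_le_mul_left _ (by omega)
  have hw0 := ne_zero_of_lt_two_pow hw (by positivity)
  refine WP.comp (4 * unit Y w) (∑ i ∈ Finset.Ico 0 D, ((6 * kap + 12 * vv + 20) * unit Y w + unit Y w) + unit Y w)
    (fun σ1 => σ1.v .pr = 1 ∧ σ1.v .cnt = 0 ∧ σ1.v .e = 1 ∧ σ1.v .o = D) ?_ (WP.assign w hY le_rfl ?_ ?_) ?_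
  · rw [Finset.sum_const, Nat.card_Ico, smul_eq_mul, Nat.sub_zero]
    linarith
  · simp [h1, hσd]; omega
  · simp [h1, hσd]
  rintro σ1 hF1 ⟨h2, h3, h4, h5⟩
  have ho1 : σ1.v .one = 1 := (hF1.1 .one (by decide)).trans h1
  have hn1 : σ1.v .n = n := (hF1.1 .n (by decide)).trans hσn
  have hk1 : σ1.v .kap = kap := (hF1.1 .kap (by decide)).trans hσk
  have hv1 : σ1.v .vv = vv := (hF1.1 .vv (by decide)).trans hσv
  refine WP.count 0 D _ _ (fun i σ' => σ'.v .o = D - i ∧ σ'.v .e = i + 1 ∧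
      Cands n kap vv i (σ'.v .cnt) (σ'.v .pr) (σ'.a .S) (σ'.a .H)) le_rfl
      (Nat.zero_le _) (guard_le (by omega) hY) ⟨h5, h4, ?_⟩ (fun i σ' h => h.1) ?_ fun σ' _ h => h.2.2
  · rw [h2, h3]; exact Cands.init hn _ _
  · rintro i σ2 _ hi hF2 ⟨h6, h7, h8⟩
    refine (candPhase_spec (l := D - i) hY hn hw hkap hvv (by omega) h8 (by omega)
      ((hF2.1 .one (by decide)).trans ho1) ((hF2.1 .n (by decide)).trans hn1) ((hF2.1 .kap (by decide)).trans hk1)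
      ((hF2.1 .vv (by decide)).trans hv1) h7 h6 rfl rfl rfl rfl).mono le_rfl ?_
    rintro σ3 hF3 ⟨h9, h10, h11⟩
    exact ⟨by omega, h9, h11⟩

end RAM

/-! ### The polynomial identities. -/

namespace RAM

open Polynomial

variable {Y : ℕ} {p : Par}

/-- The identity that the main test verifies. -/
def LinearTest (p : Par) (N e : ℕ) : Prop :=
  (X + C (e : ZMod p.n)) ^ N %ₘ p.modulus = X ^ N %ₘ p.modulus + C (e : ZMod p.n)

theorem Par.pack_add_digit (p : Par) (g : (ZMod p.n)[X]) (e : ℕ) :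
    p.pack g + e = digitSum p.W (fun j => (g.coeff j).val + if j = 0 then e else 0) (2 ^ p.e) := by
  have hE : 0 < 2 ^ p.e := Nat.two_pow_pos _
  simp only [Par.pack, digitSum, add_mul, Finset.sum_add_distrib, ite_mul, zero_mul]
  rw [Finset.sum_ite_eq' (Finset.range (2 ^ p.e)) 0 (fun j => e * p.W ^ j)]
  simp

/-- Adding e to a packed polynomial touches the constant digit only, which may exceed n - 1; hence
one more reduction of the digits before the comparison. -/
theorem digitSum_mod_eq_pack (hp : p.Ok Y) (g : (ZMod p.n)[X]) (e : ℕ) :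
    digitSum p.W (fun j => ((g.coeff j).val + if j = 0 then e else 0) % p.n) (2 ^ p.e) =
      p.pack (g + C (e : ZMod p.n)) := by
  have : NeZero p.n := ⟨hp.n_pos.ne'⟩
  refine digitSum_congr fun j _ => ?_
  rw [coeff_add, coeff_C, ← ZMod.val_natCast]
  congr 1
  push_cast
  rw [ZMod.natCast_zmod_val]

/-- Verifies that `pr` is invertible modulo the prime `n`. -/
def fermatPhase : Stmt :=
  .prims [.copy .bas .pr, .sub .m .n .one] ;; powMod ;;
  .prims [.sub .t .acc .one, .sub .t1 .one .acc, .add .t .t .t1, .sub .t .one .t, .sub .t .one .t, .add .bad .bad .t]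

/-- The condition pr^(n-1) = 1 certifies that pr is prime to n without a gcd, and Fermat's theorem
supplies it if n is prime and does not divide pr. The power is computed by `powMod` on a constant
polynomial. -/
theorem fermatPhase_spec (hp : p.Ok Y) (hn : 2 ≤ p.n) {σ : St} (hE : Env p σ) {pr b₀ L : ℕ} (hpr : σ.v .pr = pr)
    (hprn : pr < p.n) (hb : σ.v .bad = b₀) (hbW : b₀ < p.W) (hL : p.n < 2 ^ L) :
    WP Y fermatPhase ((L + 1) * (90000 * (p.w * p.e * 2 ^ p.e * Y ^ 2))) (fun σ' => σ'.v .bad ≤ b₀ + 1 ∧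
      (σ'.v .bad = 0 ↔ b₀ = 0 ∧ (pr : ZMod p.n) ^ (p.n - 1) = 1)) σ := by
  have : Fact (1 < p.n) := ⟨hn⟩
  have : NeZero p.n := ⟨hp.n_pos.ne'⟩
  have hbig : p.w ≤ 2 * p.w * 2 ^ p.e := by have : 1 ≤ 2 ^ p.e := Nat.one_le_two_pow
                                            nlinarith
  have hwb : len p.w + 2 ≤ Y := hp.len_le_of_le hbig
  have huw := hp.unit_le_of_le hbig
  have hn_W := hp.n_le_W
  have hWlt := hp.W_lt
  have hwpos := hp.w_pos
  set G := p.w * p.e * 2 ^ p.e * Y ^ 2 with hG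
  have hdegC : ∀ a : ZMod p.n, (C a).degree < (2 ^ p.e : ℕ) := fun a =>
    degree_C_le.trans_lt (by exact_mod_cast Nat.two_pow_pos p.e)
  refine WP.comp (2 * unit Y p.w) ((L + 1) * (80000 * G) + 6 * unit Y p.w)
    (fun σ1 => σ1.v .bas = pr ∧ σ1.v .m = p.n - 1) ?_ (WP.assign p.w hwb le_rfl ?_ ?_) ?_
  · have : 1 * (10000 * G) ≤ (L + 1) * (10000 * G) := Nat.mul_le_mul_right _ (by omega)
    linarith
  · simp [hpr, hE.n, hE.one]; omega
  · simp [hpr, hE.n, hE.one]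
  rintro σ1 hF1 ⟨h2, h3⟩
  have hE1 : Env p σ1 := hE.frame hF1 (by decide) (by decide)
  have hb1 : σ1.v .bad = b₀ := (hF1.1 .bad (by decide)).trans hb
  have hpack : p.pack (C (pr : ZMod p.n)) = pr := by
    rw [p.pack_C hp.e_pos, ZMod.val_natCast, Nat.mod_eq_of_lt hprn]
  refine WP.comp _ _ _ le_rfl (powMod_spec hp hn (hdegC (pr : ZMod p.n)) hE1 (h2.trans hpack.symm) h3
    (show p.n - 1 < 2 ^ L by omega) (by omega)) ?_
  intro σ2 hF2 h4
  have hE2 : Env p σ2 := hE1.frame hF2 (by decide) (by decide)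
  have hb2 : σ2.v .bad = b₀ := (hF2.1 .bad (by decide)).trans hb1
  rw [← C_pow, (modByMonic_eq_self_iff hp.monic).2 (by rw [hp.degree]; exact hdegC _), p.pack_C hp.e_pos] at h4
  have hval := ZMod.val_lt ((pr : ZMod p.n) ^ (p.n - 1))
  have hiff : (pr : ZMod p.n) ^ (p.n - 1) = 1 ↔ ((pr : ZMod p.n) ^ (p.n - 1)).val = 1 := by
    rw [← ZMod.val_one p.n]
    exact (ZMod.val_injective p.n).eq_iff.symm
  rw [hiff]
  generalize ((pr : ZMod p.n) ^ (p.n - 1)).val = a at *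
  refine WP.assign p.w hwb le_rfl ?_ ?_
  · simp [hE2.one, h4, hb2]; omega
  · simp [hE2.one, h4, hb2]; omega

/-- The main test, for the numbers in the list `S`. -/
def linearPhase : Stmt :=
  .prims [.copy .bas .ww, .copy .m .ex] ;; powMod ;; .prims [.copy .xn .acc, .copy .o .cnt] ;;
  .loop .o (.prims [.sub .o .o .one, .get .e .S .o, .add .bas .ww .e, .copy .m .ex] ;; powMod ;;
    .prims [.add .t .xn .e] ;; normDigits ;;
    .prims [.sub .h .t .acc, .sub .q .acc .t, .add .t .h .q, .sub .t .one .t, .sub .t .one .t, .add .bad .bad .t])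

/-- The power X^N is computed once, and every listed number costs one further power. The double
subtraction from 1 turns a nonzero distance into 1, so `bad` counts the failures; the list is read
from its end. -/
theorem linearPhase_spec (hp : p.Ok Y) (hn : 2 ≤ p.n) {σ : St} (hE : Env p σ) {N c b₀ l : ℕ} {S : ℕ → ℕ}
    (hex : σ.v .ex = N) (hc : σ.v .cnt = c) (hS : σ.a .S = S) (hSn : ∀ i < c, S i < p.n) (hcW : c < p.W)
    (hb : σ.v .bad = b₀) (hbW : b₀ + c < p.W) (hl : N < 2 ^ l) (hNW : N ≤ p.W) :
    WP Y linearPhase ((c + 1) * (l + 1) * (120000 * (p.w * p.e * 2 ^ p.e * Y ^ 2))) (fun σ' =>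
      σ'.v .bad ≤ b₀ + c ∧ (σ'.v .bad = 0 ↔ b₀ = 0 ∧ ∀ i < c, LinearTest p N (S i))) σ := by
  have : Fact (1 < p.n) := ⟨hn⟩
  have : NeZero p.n := ⟨hp.n_pos.ne'⟩
  have hE0 : 1 ≤ 2 ^ p.e := Nat.one_le_two_pow
  have hE2 : 2 * 1 ≤ 2 ^ p.e := by
    obtain ⟨l, hl⟩ : ∃ l, p.e = l + 1 := ⟨p.e - 1, by have := hp.e_pos; omega⟩
    rw [hl, pow_succ']; gcongr; exact Nat.one_le_two_pow
  have hbig : p.w ≤ 2 * p.w * 2 ^ p.e := by nlinarith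
  have hwb : len p.w + 2 ≤ Y := hp.len_le_of_le hbig
  have huw := hp.unit_le_of_le hbig
  have hu := hp.unit_le
  have hlenb := hp.len_le_of_le le_rfl
  have hn_W := hp.n_le_W
  have h2nW : 2 * p.n ≤ p.W := by
    rw [hp.W_eq]
    calc 2 * p.n ≤ 8 * 1 * p.n ^ 3 := by have := Nat.le_self_pow (show 3 ≠ 0 by norm_num) p.n; omega
      _ ≤ _ := by gcongr
  have hWlt := hp.W_lt
  have hwpos := hp.w_pos
  have hadd := hp.add_le
  have hbigw : 2 ^ p.w ≤ 2 ^ (2 * p.w * 2 ^ p.e) := Nat.pow_le_pow_right (by norm_num) hbig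
  set G := p.w * p.e * 2 ^ p.e * Y ^ 2 with hG
  have hpack : ∀ g : (ZMod p.n)[X], p.pack g + p.W < 2 ^ (2 * p.w * 2 ^ p.e) := fun g => by
    have h1 := hp.pack_lt g
    have h2 : p.W ≤ p.W ^ 2 ^ p.e := Nat.le_self_pow (by omega) _
    have h3 : p.W ^ 2 ^ p.e ≤ 2 ^ (p.w * 2 ^ p.e) := hp.pow_W_le _
    have h4 : 2 ^ (p.w * 2 ^ p.e + 1) ≤ 2 ^ (2 * p.w * 2 ^ p.e) := Nat.pow_le_pow_right (by norm_num) (by nlinarith)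
    rw [pow_succ] at h4
    omega
  have hdeg : ∀ g : (ZMod p.n)[X], (g %ₘ p.modulus).degree < (2 ^ p.e : ℕ) := fun g => by
    rw [← hp.degree]; exact degree_modByMonic_lt _ hp.monic
  have hdegC : ∀ a : ZMod p.n, (C a).degree < (2 ^ p.e : ℕ) := fun a =>
    degree_C_le.trans_lt (by exact_mod_cast Nat.two_pow_pos p.e)
  have hdegX : ∀ a : ZMod p.n, (X + C a).degree < ((2 ^ p.e : ℕ) : WithBot ℕ) := fun a => by
    rw [degree_X_add_C]; exact Nat.one_lt_cast.2 (show 1 < 2 ^ p.e by omega)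
  have hpackX : ∀ e < p.n, p.pack (X + C (e : ZMod p.n)) = p.W + e := fun e he => by
    have := p.pack_linear hp.e_pos 1 (e : ZMod p.n)
    rw [C_1, one_mul, ZMod.val_natCast, Nat.mod_eq_of_lt he, ZMod.val_one, one_mul] at this
    rw [this, add_comm]
  have hpX : p.pack X = p.W := by
    have := hpackX 0 (by omega)
    simpa using this
  have hXdeg : (X : (ZMod p.n)[X]).degree < (2 ^ p.e : ℕ) := by
    simpa using hdegX 0
  refine WP.comp (2 * unit Y p.w) ((l + 1) * (80000 * G) + (2 * unit Y (2 * p.w * 2 ^ p.e) +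
      (∑ i ∈ Finset.Ico 0 c, ((4 * unit Y p.w + ((l + 1) * (80000 * G) + (unit Y (2 * p.w * 2 ^ p.e) + (24000 * G +
        6 * unit Y (2 * p.w * 2 ^ p.e))))) + (p.w + 8)) + (p.w + 8))))
    (fun σ1 => σ1.v .bas = p.W ∧ σ1.v .m = N) ?_ (WP.assign p.w hwb le_rfl ?_ ?_) ?_
  · rw [Finset.sum_const, Nat.card_Ico, smul_eq_mul, Nat.sub_zero]
    have e1 : 1 * (40000 * G) ≤ (l + 1) * (40000 * G) := Nat.mul_le_mul_right _ (by omega)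
    have e2 : (4 * unit Y p.w + ((l + 1) * (80000 * G) + (unit Y (2 * p.w * 2 ^ p.e) + (24000 * G +
        6 * unit Y (2 * p.w * 2 ^ p.e))))) + (p.w + 8) ≤ (l + 1) * (120000 * G) := by linarith
    have e3 := Nat.mul_le_mul_left c e2
    have e4 : (c + 1) * (l + 1) * (120000 * G) = c * ((l + 1) * (120000 * G)) + (l + 1) * (120000 * G) := by ring
    rw [e4]
    linarith
  · simp [hE.ww, hex]; omega
  · simp [hE.ww, hex]
  rintro σ1 hF1 ⟨h2, h3⟩
  have hE1 : Env p σ1 := hE.frame hF1 (by decide) (by decide)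
  refine WP.comp _ _ _ le_rfl (powMod_spec hp hn hXdeg hE1 (h2.trans hpX.symm) h3 hl hNW) ?_
  intro σ2 hF2 h4
  have hE2 : Env p σ2 := hE1.frame hF2 (by decide) (by decide)
  have hc2 : σ2.v .cnt = c := (hF2.1 .cnt (by decide)).trans ((hF1.1 .cnt (by decide)).trans hc)
  refine WP.comp _ _ (fun σ3 => σ3.v .xn = p.pack (X ^ N %ₘ p.modulus) ∧ σ3.v .o = c) le_rfl
    (WP.assign _ hlenb le_rfl ?_ ?_) ?_
  · have := hpack (X ^ N %ₘ p.modulus)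
    simp [h4, hc2]; omega
  · simp [h4, hc2]
  rintro σ3 hF3 ⟨h5, h6⟩
  have hE3 : Env p σ3 := hE2.frame hF3 (by decide) (by decide)
  have hx3 : σ3.v .ex = N := (hF3.1 .ex (by decide)).trans ((hF2.1 .ex (by decide)).trans
    ((hF1.1 .ex (by decide)).trans hex))
  have hb3 : σ3.v .bad = b₀ := (hF3.1 .bad (by decide)).trans ((hF2.1 .bad (by decide)).trans
    ((hF1.1 .bad (by decide)).trans hb))
  have hS3 : σ3.a .S = S := (hF3.2 .S (by decide)).trans ((hF2.2 .S (by decide)).trans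
    ((hF1.2 .S (by decide)).trans hS))
  refine WP.count 0 c _ _ (fun i σ' => σ'.v .o = c - i ∧ σ'.v .bad ≤ b₀ + i ∧
      (σ'.v .bad = 0 ↔ b₀ = 0 ∧ ∀ k, c - i ≤ k → k < c → LinearTest p N (S k))) le_rfl
      (Nat.zero_le _) ?_ ⟨h6, by omega, ?_⟩ (fun i σ' h => h.1) ?_ ?_
  · have := len_le (x := c - 0) (b := p.w) (by omega); omega
  · rw [hb3, iff_self_and]
    intro _ k h1 h2; omega
  · rintro i σ4 _ hi hF4 ⟨h7, h8, h9⟩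
    have hE4 : Env p σ4 := hE3.frame hF4 (by decide) (by decide)
    have hx4 : σ4.v .ex = N := (hF4.1 .ex (by decide)).trans hx3
    have hS4 : σ4.a .S = S := (hF4.2 .S (by decide)).trans hS3
    have hxn4 : σ4.v .xn = p.pack (X ^ N %ₘ p.modulus) := (hF4.1 .xn (by decide)).trans h5
    obtain ⟨k, hk⟩ : ∃ k, k = c - i - 1 := ⟨_, rfl⟩
    have hrange : (∀ k', c - (i + 1) ≤ k' → k' < c → LinearTest p N (S k')) ↔
        LinearTest p N (S k) ∧ ∀ k', c - i ≤ k' → k' < c → LinearTest p N (S k') := by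
      constructor
      · exact fun h => ⟨h k (by omega) (by omega), fun k' h1 h2 => h k' (by omega) h2⟩
      · rintro ⟨h1, h2⟩ k' h3 h4
        by_cases hkk : k' = k
        · exact hkk ▸ h1
        · exact h2 k' (by omega) h4
    rw [hrange]
    have hen := hSn k (by omega)
    have hSk : σ4.a .S k = S k := by rw [hS4]
    generalize S k = e at *
    have hok : c - i - 1 = k := hk.symm
    refine WP.comp _ _ (fun σ5 => σ5.v .o = k ∧ σ5.v .e = e ∧ σ5.v .bas = p.W + e ∧ σ5.v .m = N) le_rfl
      (WP.assign p.w hwb le_rfl ?_ ?_) ?_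
    · simp [hE4.one, h7, hok, hSk, hE4.ww, hx4]; omega
    · simp [hE4.one, h7, hok, hSk, hE4.ww, hx4]
    rintro σ5 hF5 ⟨h10, h11, h12, h13⟩
    have hE5 : Env p σ5 := hE4.frame hF5 (by decide) (by decide)
    refine WP.comp _ _ _ le_rfl (powMod_spec hp hn (hdegX (e : ZMod p.n)) hE5 (h12.trans (hpackX e hen).symm) h13 hl hNW) ?_
    intro σ6 hF6 h14
    have hE6 : Env p σ6 := hE5.frame hF6 (by decide) (by decide)
    have hxn6 : σ6.v .xn = p.pack (X ^ N %ₘ p.modulus) := (hF6.1 .xn (by decide)).trans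
      ((hF5.1 .xn (by decide)).trans hxn4)
    have he6 : σ6.v .e = e := (hF6.1 .e (by decide)).trans h11
    have hpxn := hpack (X ^ N %ₘ p.modulus)
    refine WP.comp _ _ (fun σ7 => σ7.v .t = p.pack (X ^ N %ₘ p.modulus) + e) le_rfl (WP.assign _ hlenb (by simp) ?_ ?_) ?_
    · simp [hxn6, he6]; omega
    · simp [hxn6, he6]
    intro σ7 hF7 h15
    have hE7 : Env p σ7 := hE6.frame hF7 (by decide) (by decide)
    rw [p.pack_add_digit] at h15
    refine WP.comp _ _ _ le_rfl (normDigits_spec hp (fun j _ => ?_) hE7 h15) ?_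
    · have := hp.val_lt ((X ^ N %ₘ p.modulus).coeff j)
      split_ifs <;> omega
    intro σ8 hF8 h16
    have hE8 : Env p σ8 := hE7.frame hF8 (by decide) (by decide)
    rw [digitSum_mod_eq_pack hp] at h16
    have hacc8 : σ8.v .acc = p.pack ((X + C (e : ZMod p.n)) ^ N %ₘ p.modulus) := (hF8.1 .acc (by decide)).trans
      ((hF7.1 .acc (by decide)).trans h14)
    have hb8 : σ8.v .bad = σ4.v .bad := (hF8.1 .bad (by decide)).trans ((hF7.1 .bad (by decide)).trans
      ((hF6.1 .bad (by decide)).trans (hF5.1 .bad (by decide))))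
    have ho8 : σ8.v .o = k := (hF8.1 .o (by decide)).trans ((hF7.1 .o (by decide)).trans
      ((hF6.1 .o (by decide)).trans h10))
    have hiff : LinearTest p N e ↔ p.pack ((X + C (e : ZMod p.n)) ^ N %ₘ p.modulus) =
        p.pack (X ^ N %ₘ p.modulus + C (e : ZMod p.n)) :=
      ⟨fun h => by rw [h], fun h => hp.pack_injective (hdeg _)
        ((degree_add_le _ _).trans_lt (max_lt (hdeg _) (hdegC _))) h⟩
    rw [hiff]
    have e1 := hpack ((X + C (e : ZMod p.n)) ^ N %ₘ p.modulus)
    have e2 := hpack (X ^ N %ₘ p.modulus + C (e : ZMod p.n))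
    generalize p.pack ((X + C (e : ZMod p.n)) ^ N %ₘ p.modulus) = A at *
    generalize p.pack (X ^ N %ₘ p.modulus + C (e : ZMod p.n)) = B at *
    clear hpack hpackX hrange
    refine WP.assign _ hlenb (by simp) ?_ ⟨?_, ?_, ?_⟩
    · simp [hE8.one, h16, hacc8, hb8]; omega
    · simp [ho8]; omega
    · simp [hE8.one, h16, hacc8, hb8]; omega
    · simp [hE8.one, h16, hacc8, hb8, h9]
      generalize (∀ k', c - i ≤ k' → k' < c → LinearTest p N (S k')) = R
      have e3 : 1 - (1 - (B - A + (A - B))) = 0 ↔ A = B := by omega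
      rw [← e3]
      tauto
  · rintro σ4 hF4 ⟨h7, h8, h9⟩
    rw [h9]
    simpa using h8

end RAM

/-! ### Trial division and the main test. -/

namespace RAM

open Polynomial

variable {Y : ℕ}

/-- The number `n` is a perfect power. -/
def PerfectPower (n : ℕ) : Prop := ∃ x j, 2 ≤ j ∧ x ^ j = n

/-- Trial division. -/
def trialPhase : Stmt :=
  .prims [.add .i .one .one, .sub .g .n .i, .sub .found .one .one] ;;
  .loop .g (.prims [.div .q .n .i, .mul .q .i .q, .sub .t .n .q, .sub .t .one .t, .add .found .found .t,
    .add .i .i .one, .sub .g .n .i]) ;;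
  .prims [.sub .i0 .one .found]

/-- No number from `2` to `i - 1` divides `n`. -/
def NoDivisor (n i : ℕ) : Prop := ∀ d, 2 ≤ d → d < i → ¬ d ∣ n

theorem trialPhase_spec {w n : ℕ} (hY : len w + 2 ≤ Y) (hn : 2 ≤ n) (hw : 4 * (n * n) < 2 ^ w) {σ : St}
    (h1 : σ.v .one = 1) (hσn : σ.v .n = n) :
    WP Y trialPhase (10 * n * unit Y w) (fun σ' => σ'.v .i0 ≤ 1 ∧ (σ'.v .i0 = 1 ↔ n.Prime)) σ := by
  have hnn : n * 1 ≤ n * n := Nat.mul_le_mul_left _ (by omega)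
  have hw0 := ne_zero_of_lt_two_pow hw (by positivity)
  refine WP.comp (3 * unit Y w) ((∑ i ∈ Finset.Ico 2 n, (7 * unit Y w + unit Y w) + unit Y w) + unit Y w)
    (fun σ1 => σ1.v .i = 2 ∧ σ1.v .g = n - 2 ∧ σ1.v .found = 0) ?_ (WP.assign w hY le_rfl ?_ ?_) ?_
  · rw [Finset.sum_const, Nat.card_Ico, smul_eq_mul]
    have e1 : (n - 2) * (7 * unit Y w + unit Y w) ≤ n * (8 * unit Y w) := Nat.mul_le_mul (by omega) (by omega)
    have e2 : 2 * unit Y w ≤ n * unit Y w := Nat.mul_le_mul_right _ hn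
    have e3 : 10 * n * unit Y w = n * (8 * unit Y w) + 2 * (n * unit Y w) := by ring
    have e4 : (n - 2) * (7 * unit Y w + unit Y w) + 16 * unit Y w = n * (8 * unit Y w) := by
      obtain ⟨l, rfl⟩ : ∃ l, n = l + 2 := ⟨n - 2, by omega⟩
      rw [Nat.add_sub_cancel]; ring
    linarith
  · simp [h1, hσn]; omega
  · simp [h1, hσn]
  rintro σ1 hF1 ⟨h2, h3, h4⟩
  have ho1 : σ1.v .one = 1 := (hF1.1 .one (by decide)).trans h1
  have hn1 : σ1.v .n = n := (hF1.1 .n (by decide)).trans hσn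
  refine WP.comp _ _ (fun σ2 => σ2.v .found < n ∧ (σ2.v .found = 0 ↔ NoDivisor n n)) le_rfl (WP.count 2 n _ _
    (fun i σ' => σ'.v .g = n - i ∧ σ'.v .i = i ∧ σ'.v .found < i ∧ (σ'.v .found = 0 ↔ NoDivisor n i)) le_rfl
    hn (guard_le (by omega) hY) ⟨h3, h2, by omega, ?_⟩ (fun i σ' h => h.1) ?_ fun σ' _ h => h.2.2) ?_
  · rw [h4]; exact ⟨fun _ d h5 h6 => by omega, fun _ => rfl⟩
  · rintro i σ2 hi hi' hF2 ⟨h5, h6, h7, h8⟩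
    have ho2 : σ2.v .one = 1 := (hF2.1 .one (by decide)).trans ho1
    have hn2 : σ2.v .n = n := (hF2.1 .n (by decide)).trans hn1
    have e1 := Nat.mul_div_le n i
    have e2 := Nat.div_le_self n i
    have e3 : n - i * (n / i) = n % i := sub_mul_div n i
    have e4 : NoDivisor n (i + 1) ↔ NoDivisor n i ∧ ¬ n % i = 0 := by
      rw [← Nat.dvd_iff_mod_eq_zero]
      constructor
      · exact fun h => ⟨fun d hd hd' => h d hd (by omega), h i hi (by omega)⟩
      · rintro ⟨h, h'⟩ d hd hd'
        rcases Nat.lt_succ_iff_lt_or_eq.1 hd' with hd' | rfl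
        · exact h d hd hd'
        · exact h'
    refine WP.assign w hY le_rfl ?_ ⟨?_, ?_, ?_, ?_⟩
    · simp [ho2, hn2, h6]; omega
    · simp [ho2, hn2, h6]
    · simp [ho2, h6]
    · simp [ho2, hn2, h6]; omega
    · simp [ho2, hn2, h6, e4, e3, ← h8]
      omega
  rintro σ2 hF2 ⟨h5, h6⟩
  have ho2 : σ2.v .one = 1 := (hF2.1 .one (by decide)).trans ho1
  have hprime : n.Prime ↔ NoDivisor n n := Nat.prime_def_lt'.trans ⟨fun h => h.2, fun h => ⟨hn, h⟩⟩
  refine WP.assign w hY (by simp) ?_ ?_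
  · simp [ho2]; omega
  · simp [ho2, hprime, ← h6]; omega

/-- The outcome `a` of the main test. -/
def Verdict (n re im N kap vv S a : ℕ) : Prop :=
  a ≤ 1 ∧ ∃ c pr L H, Cands n kap vv (2 ^ S) c pr L H ∧ (a = 1 ↔ ¬ PerfectPower n ∧ vv ≤ c ∧
    (pr : ZMod n) ^ (n - 1) = 1 ∧ ∀ i < c, LinearTest (par n re im S) N (L i))

/-- The test for large `n`. -/
def mainPhase : Stmt :=
  setupPhase ;; rootsPhase ;; candsPhase ;; .prims [.sub .t .vv .cnt, .add .bad .found .t] ;; fermatPhase ;;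
  linearPhase ;; .prims [.sub .i0 .one .bad]

theorem two_pow_mul_unit_le {w : ℕ} (hw : 0 < w) (Y S : ℕ) :
    2 ^ (S + 1) * unit Y w ≤ 400 * (w * (S + 1) * 2 ^ (S + 1) * Y ^ 2) := by
  calc 2 ^ (S + 1) * unit Y w = 200 * (w + 1) * 2 ^ (S + 1) * Y ^ 2 := by unfold unit; ring
    _ ≤ 200 * (w + w) * 2 ^ (S + 1) * Y ^ 2 := by gcongr; exact hw
    _ = 400 * (w * 1 * 2 ^ (S + 1) * Y ^ 2) := by ring
    _ ≤ _ := by gcongr; omega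

/-- The polynomial identities dominate: about vv powers of O(L) products at cost G each. The search
for perfect powers costs L³U = L·(L²U) ≤ L·(DU), which is absorbed because DU = O(G); the search for
candidates costs D·(kap + vv)·U up to constants and is absorbed in the same way. -/
theorem mainPhase_cost {L vv kap D c G U : ℕ} (hL : 0 < L) (hvv : 0 < vv) (hkap : kap ≤ 2 * L + 1) (hLD : L ^ 2 ≤ D)
    (hU : D * U ≤ 400 * G) (hU1 : U ≤ 600 * G) (hc : c ≤ vv) :
    (26 * U + 8000 * G) + ((60 * L ^ 3 * U) + ((D * (6 * kap + 12 * vv + 21) + 5) * U + (2 * U +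
      ((L + 1) * (90000 * G) + ((c + 1) * (2 * L + 1) * (120000 * G) + U))))) ≤ 2000000 * (vv * L * G) := by
  have h1 : L ^ 3 * U ≤ L * (400 * G) := by
    calc L ^ 3 * U = L * (L ^ 2 * U) := by ring
      _ ≤ L * (D * U) := by gcongr
      _ ≤ L * (400 * G) := by gcongr
  have h2 : D * (6 * kap + 12 * vv + 21) * U ≤ (6 * (2 * L + 1) + 12 * vv + 21) * (400 * G) := by
    calc D * (6 * kap + 12 * vv + 21) * U = (6 * kap + 12 * vv + 21) * (D * U) := by ring
      _ ≤ _ := by gcongr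
  have h3 : (c + 1) * (2 * L + 1) * (120000 * G) ≤ (2 * vv) * (3 * L) * (120000 * G) := by gcongr <;> omega
  have h4 : L * G ≤ vv * L * G := Nat.mul_le_mul_right _ (Nat.le_mul_of_pos_left _ hvv)
  have h5 : vv * G ≤ vv * L * G := Nat.mul_le_mul_right _ (Nat.le_mul_of_pos_right _ hL)
  have h6 : G ≤ L * G := Nat.le_mul_of_pos_left _ hL
  nlinarith

theorem mainPhase_spec {n re im N kap vv S : ℕ} (hn : 2 ≤ n) (hS : 2 ^ S < n) (hp : (par n re im S).Ok Y)
    (hre : re < n) (him : im < n) (hN : N ≤ n ^ 2) (hvv : 0 < vv) (hvv' : vv ≤ n) (hkap : kap ≤ 2 * len n + 1)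
    (hLS : len n ^ 2 ≤ 2 ^ S) {σ : St} (h1 : σ.v .one = 1) (hσn : σ.v .n = n) (hσre : σ.v .re = re)
    (hσim : σ.v .im = im) (hσN : σ.v .ex = N) (hlen : σ.v .len = len n) (hσkap : σ.v .kap = kap) (hσvv : σ.v .vv = vv)
    (hdd : σ.v .dd = 2 ^ S) :
    WP Y mainPhase (2000000 * (vv * len n * ((4 * len n + 8) * (S + 1) * 2 ^ (S + 1) * Y ^ 2)))
      (fun σ' => Verdict n re im N kap vv S (σ'.v .i0)) σ := by
  have hL0 : 0 < len n := Nat.succ_pos _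
  have hE0 : 1 ≤ 2 ^ (S + 1) := Nat.one_le_two_pow
  have hlt := lt_two_pow_len n
  have hY : len (4 * len n + 8) + 2 ≤ Y := hp.len_le_of_le (by simp only [par]; nlinarith)
  have hwbig : 4 * (n + 1) * (n + 1) < 2 ^ (4 * len n + 8) := by
    calc 4 * (n + 1) * (n + 1) ≤ 4 * 2 ^ len n * 2 ^ len n := by gcongr <;> omega
      _ = 2 ^ (2 * len n + 2) := by rw [pow_add, two_mul, pow_add]; ring
      _ < _ := Nat.pow_lt_pow_right (by norm_num) (by omega)
  have hwbig' : 4 * (n * n) < 2 ^ (4 * len n + 8) := lt_of_le_of_lt (by nlinarith) hwbig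
  have hlenlt : 4 * len n + 8 < 2 ^ (4 * len n + 8) := Nat.lt_two_pow_self
  have hnnn : n * 1 ≤ n * n := Nat.mul_le_mul_left _ (by omega)
  have hW : 16 * n ^ 2 ≤ (par n re im S).W := by
    simp only [par]
    calc 16 * n ^ 2 = 8 * 2 * (n ^ 2 * 1) := by ring
      _ ≤ 8 * 2 ^ (S + 1) * (n ^ 2 * n) := by
        gcongr
        · rw [pow_succ]; have := Nat.one_le_two_pow (n := S); omega
        · omega
      _ = _ := by ring
  have hNl : N < 2 ^ (2 * len n) := by
    rw [mul_comm, pow_mul]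
    exact hN.trans_lt (Nat.pow_lt_pow_left hlt (by norm_num))
  have hnsq : n * n = n ^ 2 := (sq n).symm
  have hU := two_pow_mul_unit_le (show 0 < 4 * len n + 8 by omega) Y S
  have hU1 : unit Y (4 * len n + 8) ≤ 600 * ((4 * len n + 8) * (S + 1) * 2 ^ (S + 1) * Y ^ 2) := by
    have : 1 * unit Y (4 * len n + 8) ≤ 2 ^ (S + 1) * unit Y (4 * len n + 8) := Nat.mul_le_mul_right _ hE0
    omega
  have hU2 : 2 ^ S * unit Y (4 * len n + 8) ≤ 400 * ((4 * len n + 8) * (S + 1) * 2 ^ (S + 1) * Y ^ 2) :=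
    (Nat.mul_le_mul_right _ (Nat.pow_le_pow_right (by norm_num) (Nat.le_succ S))).trans hU
  refine (WP.comp _ _ _ le_rfl (setupPhase_spec (by omega) hS hp hre him hσn hσre hσim hdd h1) ?_).mono
    (mainPhase_cost hL0 hvv hkap hLS hU2 hU1 le_rfl) fun _ _ h => h
  intro σ1 hF1 hE1
  have fr1 : ∀ x, x ∉ setupPhase.wr → σ1.v x = σ.v x := hF1.1
  refine WP.comp _ _ _ le_rfl (rootsPhase_spec hY hn hwbig hE1.one hE1.n ((fr1 .len (by decide)).trans hlen)) ?_
  rintro σ2 hF2 ⟨hfd, hroot⟩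
  have hE2 : Env _ σ2 := hE1.frame hF2 (by decide) (by decide)
  have hvv2 : σ2.v .vv = vv := (hF2.1 .vv (by decide)).trans ((fr1 .vv (by decide)).trans hσvv)
  have hkap2 : σ2.v .kap = kap := (hF2.1 .kap (by decide)).trans ((fr1 .kap (by decide)).trans hσkap)
  refine WP.comp _ _ _ le_rfl (candsPhase_spec hY hn hwbig' (by omega) hvv' hS hE2.one hE2.n hkap2 hvv2
    hE2.dd) ?_
  intro σ3 hF3 hC
  have hE3 : Env _ σ3 := hE2.frame hF3 (by decide) (by decide)
  have hvv3 : σ3.v .vv = vv := (hF3.1 .vv (by decide)).trans hvv2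
  have hfd3 : σ3.v .found = σ2.v .found := hF3.1 .found (by decide)
  have hN3 : σ3.v .ex = N := (hF3.1 .ex (by decide)).trans ((hF2.1 .ex (by decide)).trans
    ((fr1 .ex (by decide)).trans hσN))
  generalize hff : σ2.v .found = f at *
  generalize hcc : σ3.v .cnt = c at *
  generalize hpp : σ3.v .pr = pr at *
  generalize hSS : σ3.a .S = Sf at *
  generalize σ3.a .H = H at *
  have hcv := hC.le
  have hpr := hC.pr_lt
  refine WP.comp _ _ (fun σ4 => σ4.v .bad = f + (vv - c)) le_rfl (WP.assign (4 * len n + 8) hY le_rfl ?_ ?_) ?_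
  · simp [hvv3, hcc, hfd3]; omega
  · simp [hvv3, hcc, hfd3]
  intro σ4 hF4 hb4
  have hE4 : Env _ σ4 := hE3.frame hF4 (by decide) (by decide)
  refine WP.comp _ _ _ le_rfl (fermatPhase_spec (L := len n) hp hn hE4 ((hF4.1 .pr (by decide)).trans hpp) hpr hb4
    (by omega) hlt) ?_
  rintro σ5 hF5 ⟨hb5, hb5'⟩
  have hE5 : Env _ σ5 := hE4.frame hF5 (by decide) (by decide)
  have hN5 : σ5.v .ex = N := (hF5.1 .ex (by decide)).trans ((hF4.1 .ex (by decide)).trans hN3)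
  have hc5 : σ5.v .cnt = c := (hF5.1 .cnt (by decide)).trans ((hF4.1 .cnt (by decide)).trans hcc)
  have hS5 : σ5.a .S = Sf := (hF5.2 .S (by decide)).trans ((hF4.2 .S (by decide)).trans hSS)
  have hlin := linearPhase_spec (l := 2 * len n) hp hn hE5 hN5 hc5 hS5
    (fun i hi => (hC.mem i hi).2.1.trans_lt hS) (by omega) rfl (by omega) hNl (by omega)
  refine WP.comp _ _ _ le_rfl (hlin.mono ?_ fun _ _ h => h) ?_
  · have : c + 1 ≤ vv + 1 := by omega
    simp only [par]
    gcongr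
  rintro σ6 hF6 ⟨hb6, hb6'⟩
  have hE6 : Env _ σ6 := hE5.frame hF6 (by decide) (by decide)
  refine WP.assign (4 * len n + 8) hY (by simp) ?_ ⟨?_, c, pr, Sf, H, hC, ?_⟩
  · clear hroot hb6' hb5'
    simp [hE6.one]; omega
  · simp [hE6.one]
  · have e1 : 1 - σ6.v .bad = 1 ↔ σ6.v .bad = 0 := by clear hroot hb6' hb5'; omega
    have e2 : f + (vv - c) = 0 ↔ ¬ f = 1 ∧ vv ≤ c := by clear hroot hb6' hb5'; omega
    simp only [runs, Prim.exec, St.setv_v, hE6.one, if_true]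
    rw [e1, hb6', hb5', e2, hroot, PerfectPower, and_assoc, and_assoc]
    rfl

end RAM

/-! ### The complete program and its running time. -/

namespace RAM

/-- The primality test, for `n`, `u`, `re`, `im` and the power `ex` of `n`. -/
def coreTest : Stmt :=
  lenPhase ;; twoPhase ;; sizePhase ;; .prims [.sub .g .n .dd] ;; .ite .g mainPhase trialPhase

/-- The bound for the logarithms. -/
def logBound (n u : ℕ) : ℕ := u + 3 * len (len n) + 20

theorem exponent_lt {L u S : ℕ} (hS : 2 ^ S < 2 ^ u * (32 * L ^ 2)) : S < u + 5 + 2 * len L := by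
  refine (Nat.pow_lt_pow_iff_right (show 1 < 2 by norm_num)).1 (hS.trans_le ?_)
  calc 2 ^ u * (32 * L ^ 2) ≤ 2 ^ u * (32 * (2 ^ len L) ^ 2) := by gcongr; exact (lt_two_pow_len L).le
    _ = 2 ^ (u + 5 + 2 * len L) := by rw [pow_add, pow_add, mul_comm 2 (len L), pow_mul]; norm_num [mul_assoc]

theorem len_le_logBound {n u S : ℕ} (hS : 2 ^ S < 2 ^ u * (32 * len n ^ 2)) :
    len (2 * (4 * len n + 8) * 2 ^ (S + 1)) + 2 ≤ logBound n u := by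
  have h1 := exponent_lt hS
  have h2 : len (2 * (4 * len n + 8) * 2 ^ (S + 1)) ≤ (S + 6 + len (len n)) + 1 := by
    apply len_le
    have hL : 0 < len n := Nat.succ_pos _
    have := lt_two_pow_len (len n)
    calc 2 * (4 * len n + 8) * 2 ^ (S + 1) < 2 * (16 * 2 ^ len (len n)) * 2 ^ (S + 1) := by gcongr; omega
      _ = 2 ^ (S + 6 + len (len n)) := by rw [pow_add, pow_add, pow_add]; ring
  unfold logBound
  omega

/-- The bound for the number of linear tests. -/
def testBound (n K u : ℕ) : ℕ := 2 ^ u * (32 * len n ^ 2) / 2 ^ (K + 1 - u) + 1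

/-- As 2^S < 2^u·32L², one multiplication modulo the modulus costs O(2^u·L³·Y³), and vv·L of them
give V·2^u·L⁴·Y³. Trial division is within the same bound since it is used only for n ≤ 2^S. The
third estimate pays for the preparations. -/
theorem coreTest_cost {L V vv S Y B u w n' : ℕ} (hL : 0 < L) (hw : w = 4 * L + 8) (hB : B = 2 ^ u * (32 * L ^ 2))
    (hS : 2 ^ S < B) (hSY : S + 1 ≤ Y) (hvv : vv ≤ V) (hV : 0 < V) (hn' : n' ≤ 2 ^ S) :
    2000000 * (vv * L * (w * (S + 1) * 2 ^ (S + 1) * Y ^ 2)) ≤ 1600000000 * (V * 2 ^ u * L ^ 4 * Y ^ 3) ∧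
    10 * n' * unit Y w ≤ 1600000000 * (V * 2 ^ u * L ^ 4 * Y ^ 3) ∧
    (18 * w + 34) * unit Y w ≤ 100000000 * (V * 2 ^ u * L ^ 4 * Y ^ 3) := by
  have hw' : w ≤ 12 * L := by omega
  have hE : 2 ^ (S + 1) ≤ 64 * (2 ^ u * L ^ 2) := by rw [pow_succ]; rw [hB] at hS; linarith
  have hY : 0 < Y := by omega
  have hG : w * (S + 1) * 2 ^ (S + 1) * Y ^ 2 ≤ 768 * (2 ^ u * L ^ 3 * Y ^ 3) := by
    calc w * (S + 1) * 2 ^ (S + 1) * Y ^ 2 ≤ 12 * L * Y * (64 * (2 ^ u * L ^ 2)) * Y ^ 2 := by gcongr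
      _ = _ := by ring
  have hX : 2 ^ u * L ^ 3 * Y ^ 3 ≤ V * 2 ^ u * L ^ 4 * Y ^ 3 := by
    calc 2 ^ u * L ^ 3 * Y ^ 3 = 1 * 2 ^ u * (1 * L ^ 3) * Y ^ 3 := by ring
      _ ≤ V * 2 ^ u * (L * L ^ 3) * Y ^ 3 := by gcongr <;> assumption
      _ = _ := by ring
  refine ⟨?_, ?_, ?_⟩
  · calc 2000000 * (vv * L * (w * (S + 1) * 2 ^ (S + 1) * Y ^ 2))
        ≤ 2000000 * (V * L * (768 * (2 ^ u * L ^ 3 * Y ^ 3))) := by gcongr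
      _ = 1536000000 * (V * 2 ^ u * L ^ 4 * Y ^ 3) := by ring
      _ ≤ _ := by gcongr; norm_num
  · have h1 := two_pow_mul_unit_le (show 0 < w by omega) Y S
    have h2 : n' * unit Y w ≤ 2 ^ (S + 1) * unit Y w := by
      gcongr; rw [pow_succ]; omega
    calc 10 * n' * unit Y w = 10 * (n' * unit Y w) := by ring
      _ ≤ 10 * (400 * (768 * (2 ^ u * L ^ 3 * Y ^ 3))) :=
        Nat.mul_le_mul_left _ (h2.trans (h1.trans (Nat.mul_le_mul_left _ hG)))
      _ ≤ 10 * (400 * (768 * (V * 2 ^ u * L ^ 4 * Y ^ 3))) := by gcongr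
      _ ≤ _ := by omega
  · calc (18 * w + 34) * unit Y w = (18 * w + 34) * (200 * (w + 1) * Y ^ 2) := rfl
      _ ≤ (18 * (12 * L) + 34 * L) * (200 * (12 * L + L) * Y ^ 2) := by gcongr <;> omega
      _ = 650000 * (1 * 1 * (L ^ 2 * 1) * (Y ^ 2 * 1)) := by ring
      _ ≤ 650000 * (V * 2 ^ u * (L ^ 2 * L ^ 2) * (Y ^ 2 * Y)) := by
        gcongr
        · exact hV
        · exact Nat.one_le_two_pow
        · exact Nat.one_le_pow _ _ hL
        · exact hY
      _ = 650000 * (V * 2 ^ u * L ^ 4 * Y ^ 3) := by ring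
      _ ≤ _ := by gcongr; norm_num

/-- Trial division settles the case n ≤ 2^S completely; for larger n only the outcome of the
computations is recorded here, and its arithmetical meaning is derived separately. All numbers in
the preparatory phases are bounded by a constant multiple of 2^(4L), which explains the word size 4L
+ 8. -/
theorem coreTest_spec {n re im N K m u : ℕ} (hn : 2 ≤ n) (hre : re < n) (him : im < n) (hN : N ≤ n ^ 2)
    (hNK : N = 2 ^ K * m + 1) (hm : Odd m) (huK : u ≤ K) {σ : St} (h1 : σ.v .one = 1) (hσn : σ.v .n = n)
    (hσre : σ.v .re = re) (hσim : σ.v .im = im) (hσN : σ.v .ex = N) (hσu : σ.v .u = u) :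
    WP (logBound n u) coreTest (1700000000 * (testBound n K u * 2 ^ u * len n ^ 4 * logBound n u ^ 3))
      (fun σ' => ∃ S, 2 ^ u * (16 * len n ^ 2) ≤ 2 ^ S ∧ (n ≤ 2 ^ S → σ'.v .i0 ≤ 1 ∧ (σ'.v .i0 = 1 ↔ n.Prime)) ∧
        (2 ^ S < n → Verdict n re im N (K + 1 - u) (max (2 ^ S / 2 ^ (K + 1 - u)) 1) S (σ'.v .i0))) σ := by
  have hL0 : 0 < len n := Nat.succ_pos _
  have hlt := lt_two_pow_len n
  have hm0 := hm.pos
  have hLL : len n < 2 ^ len n := Nat.lt_two_pow_self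
  have hKm : 2 ^ K ≤ 2 ^ K * m := Nat.le_mul_of_pos_right _ hm0
  have hn2 : n ^ 2 < 2 ^ (2 * len n) := by rw [mul_comm, pow_mul]; exact Nat.pow_lt_pow_left hlt (by norm_num)
  have hK2 : K < 2 * len n := (Nat.pow_lt_pow_iff_right (show 1 < 2 by norm_num)).1 (show 2 ^ K < 2 ^ (2 * len n) by omega)
  obtain ⟨w, hw⟩ : ∃ w, w = 4 * len n + 8 := ⟨_, rfl⟩
  have hYw : len w + 2 ≤ logBound n u := by
    have e1 : len w ≤ len (len n) + 4 + 1 := by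
      apply len_le
      rw [pow_add]
      have := lt_two_pow_len (len n)
      omega
    unfold logBound; omega
  have hb1 : 2 ^ (4 * len n) = 2 ^ (2 * len n) * 2 ^ (2 * len n) := by rw [← pow_add]; congr 1; ring
  have hb2 : 2 ^ w = 256 * (2 ^ (2 * len n) * 2 ^ (2 * len n)) := by rw [hw, pow_add, hb1]; ring
  have hb3 : 2 ^ u * (32 * len n ^ 2) ≤ 32 * (2 ^ (2 * len n) * 2 ^ (2 * len n)) := by
    calc 2 ^ u * (32 * len n ^ 2) ≤ 2 ^ (2 * len n) * (32 * (2 ^ len n) ^ 2) := by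
          gcongr
          · norm_num
          · omega
      _ = _ := by rw [mul_comm 2 (len n), pow_mul]; ring
  have hb4 : 4 * 2 ^ (2 * len n) ≤ 2 ^ (2 * len n) * 2 ^ (2 * len n) := by
    gcongr
    calc 4 = 2 ^ 2 := by norm_num
      _ ≤ 2 ^ (2 * len n) := Nat.pow_le_pow_right (by norm_num) (by omega)
  have hnn : n ≤ n ^ 2 := Nat.le_self_pow (by norm_num) n
  have hKlt : K < 2 ^ K := Nat.lt_two_pow_self
  have hw2 : 2 * n + 2 < 2 ^ w := by linarith
  have hw3 : 4 * N < 2 ^ w := by linarith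
  have hw4 : 4 * (n * n) < 2 ^ w := by rw [← sq]; linarith
  have hw5 : 2 ^ u * (32 * len n ^ 2) + 2 * 2 ^ K + 2 * K + 32 < 2 ^ w := by linarith
  have hw6 : n < 2 ^ w := by omega
  clear hb1 hb2 hb3 hb4
  obtain ⟨T, hT⟩ : ∃ T, T = testBound n K u * 2 ^ u * len n ^ 4 * logBound n u ^ 3 := ⟨_, rfl⟩
  have hV : 0 < testBound n K u := Nat.succ_pos _
  rw [← hT]
  have hu0 : (18 * w + 34) * unit (logBound n u) w ≤ 100000000 * T := by
    have hLpos : 0 < len n ^ 2 := by positivity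
    rw [hT]
    refine (coreTest_cost (S := 0) (vv := 0) (n' := 0) hL0 hw rfl ?_ ?_ (Nat.zero_le _) hV (Nat.zero_le _)).2.2
    · have : 1 * (32 * 1) ≤ 2 ^ u * (32 * len n ^ 2) := by gcongr <;> first | exact Nat.one_le_two_pow | exact hLpos
      rw [pow_zero]; omega
    · unfold logBound; omega
  refine WP.comp ((4 * w + 3) * unit (logBound n u) w) ((14 * w + 31) * unit (logBound n u) w + 1600000000 * T)
    _ (by linarith) (lenPhase_spec hYw (by omega) (by omega) h1 hσn) ?_
  intro σ1 hF1 hl1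
  have fr1 : ∀ x, x ∉ lenPhase.wr → σ1.v x = σ.v x := hF1.1
  refine WP.comp ((8 * w + 9) * unit (logBound n u) w) ((6 * w + 22) * unit (logBound n u) w + 1600000000 * T)
    _ (by linarith) (twoPhase_spec hYw hNK hm (by omega) ((fr1 .one (by decide)).trans h1)
      ((fr1 .ex (by decide)).trans hσN)) ?_
  rintro σ2 hF2 ⟨hkp2, hpw2⟩
  have fr2 : ∀ x, x ∉ (lenPhase ;; twoPhase).wr → σ2.v x = σ.v x := fun x hx => by
    simp only [Stmt.wr, List.mem_append, not_or] at hx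
    exact (hF2.1 x hx.2).trans (hF1.1 x hx.1)
  refine WP.comp ((6 * w + 20) * unit (logBound n u) w) (2 * unit (logBound n u) w + 1600000000 * T)
    _ (by linarith) (sizePhase_spec hYw hL0.ne' huK (by omega) ((fr2 .one (by decide)).trans h1)
      ((hF2.1 .len (by decide)).trans hl1) ((fr2 .u (by decide)).trans hσu) hkp2 hpw2) ?_
  rintro σ3 hF3 ⟨hkap3, S, hdd3, hS1, hS2, hvv3⟩
  have fr3 : ∀ x, x ∉ (lenPhase ;; twoPhase ;; sizePhase).wr → σ3.v x = σ.v x := fun x hx => by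
    simp only [Stmt.wr, List.mem_append, not_or] at hx
    exact (hF3.1 x hx.2.2).trans ((hF2.1 x hx.2.1).trans (hF1.1 x hx.1))
  have hlen3 : σ3.v .len = len n := (hF3.1 .len (by decide)).trans ((hF2.1 .len (by decide)).trans hl1)
  have ho3 : σ3.v .one = 1 := (fr3 .one (by decide)).trans h1
  have hn3 : σ3.v .n = n := (fr3 .n (by decide)).trans hσn
  refine WP.comp (unit (logBound n u) w) (1600000000 * T + unit (logBound n u) w) (fun σ4 => σ4.v .g = n - 2 ^ S) (by linarith)
    (WP.assign w hYw (by simp) ?_ ?_) ?_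
  · simp [hn3, hdd3]; omega
  · simp [hn3, hdd3]
  intro σ4 hF4 hg4
  have fr4 : ∀ x, x ∉ (lenPhase ;; twoPhase ;; sizePhase ;; .prims [.sub .g .n .dd]).wr → σ4.v x = σ.v x := fun x hx => by
    have hx' : x ∉ (Stmt.prims [.sub .g .n .dd]).wr := fun h => hx (by simp only [Stmt.wr, List.mem_append] at h ⊢; tauto)
    have hx'' : x ∉ (lenPhase ;; twoPhase ;; sizePhase).wr := fun h => hx (by simp only [Stmt.wr, List.mem_append] at h ⊢; tauto)
    exact (hF4.1 x hx').trans (fr3 x hx'')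
  have hlen4 : σ4.v .len = len n := (hF4.1 .len (by decide)).trans hlen3
  have hkap4 : σ4.v .kap = K + 1 - u := (hF4.1 .kap (by decide)).trans hkap3
  have hvv4 : σ4.v .vv = max (2 ^ S / 2 ^ (K + 1 - u)) 1 := (hF4.1 .vv (by decide)).trans hvv3
  have hdd4 : σ4.v .dd = 2 ^ S := (hF4.1 .dd (by decide)).trans hdd3
  have ho4 : σ4.v .one = 1 := (fr4 .one (by decide)).trans h1
  have hn4 : σ4.v .n = n := (fr4 .n (by decide)).trans hσn
  have hvvV : max (2 ^ S / 2 ^ (K + 1 - u)) 1 ≤ testBound n K u := by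
    exact max_le (le_trans (Nat.div_le_div_right hS2.le) (Nat.le_succ _)) hV
  have hSY : S + 1 ≤ logBound n u := by
    have := exponent_lt hS2
    unfold logBound; omega
  refine WP.ite ?_ ?_ ?_
  · rw [hg4]; exact guard_le (by omega) hYw
  · intro h0
    have hSn : 2 ^ S < n := by omega
    have hcost := (coreTest_cost (n' := 0) hL0 hw rfl hS2 hSY hvvV hV (Nat.zero_le _)).1
    have hLS : len n ^ 2 ≤ 2 ^ S := by
      refine le_trans ?_ hS1
      calc len n ^ 2 = 1 * (1 * len n ^ 2) := by ring
        _ ≤ _ := by gcongr <;> first | exact Nat.one_le_two_pow | norm_num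
    have hvn : max (2 ^ S / 2 ^ (K + 1 - u)) 1 ≤ n := max_le ((Nat.div_le_self _ _).trans hSn.le) (by omega)
    rw [hw] at hcost
    refine (mainPhase_spec hn hSn (par_ok (by omega) hSn (len_le_logBound hS2)) hre him hN (lt_max_of_lt_right one_pos)
      hvn (by omega) hLS ho4 hn4 ((fr4 .re (by decide)).trans hσre) ((fr4 .im (by decide)).trans hσim)
      ((fr4 .ex (by decide)).trans hσN) hlen4 hkap4 hvv4 hdd4).mono (hT ▸ hcost) ?_
    exact fun σ5 hF5 h5 => ⟨S, hS1, fun h => absurd h (by omega), fun _ => h5⟩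
  · intro h0
    have hcost := (coreTest_cost (n' := n) hL0 hw rfl hS2 hSY hvvV hV (by omega)).2.1
    refine (trialPhase_spec hYw hn hw4 ho4 hn4).mono (hT ▸ hcost) ?_
    exact fun σ5 hF5 h5 => ⟨S, hS1, fun _ => h5, fun h => by omega⟩

/-- The test for `n` and a Gaussian integer. -/
def gaussTest : Stmt :=
  .prims [.copy .n .i0, .copy .re .i1, .copy .im .i2, .copy .u .i3, .mul .ex .i0 .i0, .const .one 1] ;; coreTest

/-- The test for `n` and an integer. -/
def intTest : Stmt :=
  .prims [.copy .n .i0, .copy .re .i1, .copy .u .i2, .copy .ex .i0, .const .one 1] ;; coreTest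

/-- What the tests establish for inputs that pass the size check. -/
def TestCorrect (n re im N K u : ℕ) : Prop :=
  ∀ S a, 2 ^ u * (16 * len n ^ 2) ≤ 2 ^ S → 2 ^ S < n →
    Verdict n re im N (K + 1 - u) (max (2 ^ S / 2 ^ (K + 1 - u)) 1) S a → (a = 1 ↔ n.Prime)

theorem copy_cost_le {n K u : ℕ} : 6 * unit (logBound n u) (4 * len n + 8) ≤
    100000000 * (testBound n K u * 2 ^ u * len n ^ 4 * logBound n u ^ 3) := by
  have hL0 : 0 < len n := Nat.succ_pos _
  have hLpos : 0 < len n ^ 2 := by positivity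
  refine le_trans (Nat.mul_le_mul_right _ (by omega))
    (coreTest_cost (w := 4 * len n + 8) (B := 2 ^ u * (32 * len n ^ 2)) (V := testBound n K u)
    (S := 0) (vv := 0) (n' := 0) hL0 rfl rfl ?_ ?_ (Nat.zero_le _) (Nat.succ_pos _) (Nat.zero_le _)).2.2
  · have : 1 * (32 * 1) ≤ 2 ^ u * (32 * len n ^ 2) := by gcongr <;> first | exact Nat.one_le_two_pow | exact hLpos
    rw [pow_zero]; omega
  · unfold logBound; omega

theorem decides_of_testCorrect {n re im N K m u : ℕ} (hn : 2 ≤ n) (hre : re < n) (him : im < n) (hN : N ≤ n ^ 2)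
    (hNK : N = 2 ^ K * m + 1) (hm : Odd m) (huK : u ≤ K) (hc : TestCorrect n re im N K u) (l : List Prim)
    (hl : l.length ≤ 6) (input : List ℕ) (hin : input.length ≤ 4)
    (hs : Smalls (4 * len n + 8) l (.start input)) (h1 : (runs l (.start input)).v .one = 1)
    (hσn : (runs l (.start input)).v .n = n) (hσre : (runs l (.start input)).v .re = re)
    (hσim : (runs l (.start input)).v .im = im) (hσN : (runs l (.start input)).v .ex = N)
    (hσu : (runs l (.start input)).v .u = u) :
    DecidesWithin ((Stmt.prims l ;; coreTest).compile 0) input n.Prime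
      (1800000000 * (testBound n K u * 2 ^ u * len n ^ 4 * logBound n u ^ 3) : ℕ) := by
  have hYw : len (4 * len n + 8) + 2 ≤ logBound n u := by
    have hL0 : 0 < len n := Nat.succ_pos _
    have e1 : len (4 * len n + 8) ≤ len (len n) + 4 + 1 := by
      apply len_le
      rw [pow_add]
      have := lt_two_pow_len (len n)
      omega
    unfold logBound; omega
  refine WP.decides (Y := logBound n u) hin ?_
  have hcopy := copy_cost_le (n := n) (K := K) (u := u)
  refine WP.comp (l.length * unit (logBound n u) (4 * len n + 8))
    (1700000000 * (testBound n K u * 2 ^ u * len n ^ 4 * logBound n u ^ 3)) (fun σ => σ = runs l (.start input)) ?_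
    (WP.assign _ hYw le_rfl hs rfl) ?_
  · have : l.length * unit (logBound n u) (4 * len n + 8) ≤ 6 * unit (logBound n u) (4 * len n + 8) :=
      Nat.mul_le_mul_right _ hl
    linarith
  · rintro σ - rfl
    refine (coreTest_spec hn hre him hN hNK hm huK h1 hσn hσre hσim hσN hσu).mono le_rfl ?_
    rintro σ' - ⟨S, hS, h2, h3⟩
    have key : σ'.v .i0 ≤ 1 ∧ (σ'.v .i0 = 1 ↔ n.Prime) := by
      rcases Nat.lt_or_ge (2 ^ S) n with h | h
      · exact ⟨(h3 h).1, hc S _ hS h (h3 h)⟩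
      · exact h2 h
    refine ⟨key.2.2, fun h => ?_⟩
    have := mt key.2.1 h
    have := key.1
    omega

end RAM

/-! ### Why a number with two prime factors cannot pass. -/

namespace BinomialTest

open Polynomial

theorem eq_of_pow_char_pow_eq {K : Type*} [Field K] {p : ℕ} [Fact p.Prime] [CharP K p] {a b : K} {h : ℕ}
    (H : a ^ p ^ h = b ^ p ^ h) : a = b := by
  have : (a - b) ^ p ^ h = 0 := by rw [sub_pow_char_pow, H, sub_self]
  exact sub_eq_zero.1 (pow_eq_zero_iff (pow_ne_zero _ (Fact.out : p.Prime).ne_zero) |>.1 this)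

/-- The exponent `m` permutes the `D`-th roots of `A`, and commutes with adding elements of `Cs` to them. -/
def Introspective {K : Type*} [Field K] (D : ℕ) (A : K) (Cs : Finset K) (m : ℕ) : Prop :=
  (∀ z : K, z ^ D = A → (z ^ m) ^ D = A) ∧ ∀ d ∈ Cs, ∀ z : K, z ^ D = A → (z + d) ^ m = z ^ m + d

namespace Introspective

variable {K : Type*} [Field K] {D : ℕ} {A : K} {Cs : Finset K}

theorem one : Introspective D A Cs 1 := ⟨fun z hz => by simpa using hz, fun d _ z _ => by simp⟩

theorem mul {m m' : ℕ} (h : Introspective D A Cs m) (h' : Introspective D A Cs m') :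
    Introspective D A Cs (m * m') := by
  refine ⟨fun z hz => ?_, fun d hd z hz => ?_⟩
  · rw [pow_mul]; exact h'.1 _ (h.1 z hz)
  · rw [pow_mul, h.2 d hd z hz, h'.2 d hd _ (h.1 z hz), pow_mul]

theorem pow {m : ℕ} (h : Introspective D A Cs m) (i : ℕ) : Introspective D A Cs (m ^ i) := by
  induction i with
  | zero => exact one
  | succ i ih => rw [pow_succ]; exact ih.mul h

theorem of_pow_eq {m : ℕ} (hA : A ^ m = A)
    (h : ∀ d ∈ Cs, ∀ z : K, z ^ D = A → (z + d) ^ m = z ^ m + d) : Introspective D A Cs m :=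
  ⟨fun z hz => by rw [← pow_mul, mul_comm, pow_mul, hz, hA], h⟩

theorem char {p h : ℕ} [Fact p.Prime] [CharP K p] (hA : A ^ p ^ h = A) (hC : ∀ d ∈ Cs, d ^ p ^ h = d) :
    Introspective D A Cs (p ^ h) :=
  of_pow_eq hA fun d hd z _ => by rw [add_pow_char_pow, hC d hd]

/-- Since Frobenius is injective on a field, a factor p^h can be cancelled from the exponent.
Applied to N = n^h this shows that (n/p)^h is introspective too, although no test with that exponent
was made. -/
theorem div_char {p h m : ℕ} [Fact p.Prime] [CharP K p] (hA : A ^ p ^ h = A)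
    (hC : ∀ d ∈ Cs, d ^ p ^ h = d) (hm : Introspective D A Cs (m * p ^ h)) (hA' : A ^ (m * p ^ h) = A) :
    Introspective D A Cs m := by
  refine of_pow_eq (eq_of_pow_char_pow_eq (p := p) (h := h) ?_) fun d hd z hz =>
    eq_of_pow_char_pow_eq (p := p) (h := h) ?_
  · rw [← pow_mul, hA', hA]
  · rw [add_pow_char_pow, hC d hd, ← pow_mul, hm.2 d hd z hz, ← pow_mul]

end Introspective

/-- The multiplicity of r determines i, and then the power of p determines j. Here the second prime
factor is indispensable. -/
theorem pow_mul_pow_injective {m p r : ℕ} (hp : p.Prime) (hr : r.Prime) (hrp : r ≠ p) (hrm : r ∣ m) (hm : m ≠ 0)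
    {i j i' j' : ℕ} (H : m ^ i * p ^ j = m ^ i' * p ^ j') : i = i' ∧ j = j' := by
  have hi : i = i' := by
    have := congrArg (fun x => x.factorization r) H
    simp only [Nat.factorization_mul (pow_ne_zero _ hm) (pow_ne_zero _ hp.ne_zero),
      Nat.factorization_pow, Finsupp.add_apply, Finsupp.smul_apply, hp.factorization,
      Finsupp.single_apply, if_neg hrp.symm, smul_eq_mul, mul_zero, add_zero] at this
    have h1 : 0 < m.factorization r := hr.factorization_pos_of_dvd hm hrm
    exact Nat.eq_of_mul_eq_mul_right h1 this
  subst hi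
  exact ⟨rfl, Nat.pow_right_injective hp.two_le (Nat.eq_of_mul_eq_mul_left (pow_pos (Nat.pos_of_ne_zero hm) _) H)⟩

/-- T counts the images of ζ under the exponents built from n/p and p. All of them are D-th roots of
A, so T ≤ D, and the D elements of `Cs` are enough for subsets of size T - 1. -/
theorem card_le_of_introspective {K : Type*} [Field K] {p : ℕ} [Fact p.Prime] [CharP K p] {D n h r : ℕ}
    (hD : 0 < D) (hh : 0 < h) (hr : r.Prime) (hrp : r ≠ p) (hrn : r ∣ n) (hpn : p ∣ n) (hn : n ≠ 0)
    {A ζ : K} (hζ : ζ ^ D = A) (hAN : A ^ n ^ h = A) (hAp : A ^ p ^ h = A) (Cs : Finset K)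
    (hcard : D ≤ Cs.card) (hCp : ∀ d ∈ Cs, d ^ p ^ h = d)
    (hCN : ∀ d ∈ Cs, ∀ z : K, z ^ D = A → (z + d) ^ n ^ h = z ^ n ^ h + d) {M : ℕ}
    (hM : ∀ i j, i < j → j < M → ζ ^ (n ^ h) ^ i ≠ ζ ^ (n ^ h) ^ j) :
    ∃ T, M ≤ T ∧ 2 ^ (T - 1) ≤ n ^ (h * Nat.sqrt T) := by
  classical
  have hp : p.Prime := Fact.out
  obtain ⟨m, rfl⟩ := hpn
  have hm0 : m ≠ 0 := by rintro rfl; simp at hn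
  have hrm : r ∣ m := ((hr.dvd_mul).1 hrn).resolve_left fun h => hrp ((Nat.prime_dvd_prime_iff_eq hr hp).1 h)
  have hgN : Introspective D A Cs ((p * m) ^ h) := .of_pow_eq hAN hCN
  have hgp : Introspective D A Cs (p ^ h) := .char hAp hCp
  have hNm : (p * m) ^ h = m ^ h * p ^ h := by rw [mul_pow, mul_comm]
  have hgm : Introspective D A Cs (m ^ h) := .div_char hAp hCp (hNm ▸ hgN) (hNm ▸ hAN)
  have hg : ∀ i j, Introspective D A Cs ((m ^ i * p ^ j) ^ h) := fun i j => by
    rw [mul_pow, ← pow_mul, ← pow_mul, mul_comm i, mul_comm j, pow_mul, pow_mul]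
    exact (hgm.pow i).mul (hgp.pow j)
  let Z : Finset K := {z ∈ (nthRoots D A).toFinset | ∃ i j, z = ζ ^ (m ^ i * p ^ j) ^ h}
  have hZ : ∀ i j, ζ ^ (m ^ i * p ^ j) ^ h ∈ Z := fun i j => by
    rw [Finset.mem_filter, Multiset.mem_toFinset, mem_nthRoots hD]
    exact ⟨(hg i j).1 ζ hζ, i, j, rfl⟩
  have hZD : Z.card ≤ D :=
    (Finset.card_filter_le _ _).trans ((Multiset.toFinset_card_le _).trans (card_nthRoots D A))
  refine ⟨Z.card, ?_, ?_⟩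
  · rw [← Finset.card_range M]
    -- The diagonal exponents i = j are the powers of N, so the orbit of ζ under N lies in Z.
    refine Finset.card_le_card_of_injOn (fun i => ζ ^ (m ^ i * p ^ i) ^ h) (fun i _ => hZ i i) ?_
    intro i hi j hj hij
    rw [Finset.coe_range, Set.mem_Iio] at hi hj
    have hpow : ∀ i, (m ^ i * p ^ i) ^ h = ((p * m) ^ h) ^ i := fun i => by
      rw [← mul_pow, mul_comm m, ← pow_mul, ← pow_mul, mul_comm i]
    simp only [hpow] at hij
    rcases lt_trichotomy i j with h1 | h1 | h1
    · exact absurd hij (hM i j h1 hj)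
    · exact h1
    · exact absurd hij.symm (hM j i h1 hi)
  set T := Z.card
  set s := Nat.sqrt T
  -- There are (⌊√T⌋ + 1)² > T pairs with both entries at most √T, so two of them give the same
  -- element of Z.
  obtain ⟨⟨i, j⟩, hij, ⟨i', j'⟩, hij', hne, heq⟩ := Finset.exists_ne_map_eq_of_card_lt_of_maps_to
    (s := Finset.range (s + 1) ×ˢ Finset.range (s + 1)) (t := Z)
    (f := fun x => ζ ^ (m ^ x.1 * p ^ x.2) ^ h)
    (by rw [Finset.card_product, Finset.card_range]; exact Nat.lt_succ_sqrt T)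
    (fun x _ => hZ x.1 x.2)
  simp only [Finset.mem_product, Finset.mem_range] at hij hij'
  set m1 := (m ^ i * p ^ j) ^ h
  set m2 := (m ^ i' * p ^ j') ^ h
  have hm12 : m1 ≠ m2 := fun H => by
    have := pow_mul_pow_injective hp hr hrp hrm hm0 (Nat.pow_left_injective hh.ne' H)
    exact hne (by rw [this.1, this.2])
  have hle : ∀ i j, i < s + 1 → j < s + 1 → (m ^ i * p ^ j) ^ h ≤ (p * m) ^ (h * s) := fun i j hi hj => by
    rw [mul_comm h, pow_mul, mul_comm p, mul_pow m p]
    gcongr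
    · exact Nat.pos_of_ne_zero hm0
    · omega
    · exact hp.pos
    · omega
  have hT0 : 0 < T := Finset.card_pos.2 ⟨_, hZ 0 0⟩
  -- With T - 1 linear factors available every product has degree below T, so it is determined by
  -- its values on Z.
  obtain ⟨C, hC, hCc⟩ := Finset.exists_subset_card_eq (s := Cs) (n := T - 1) (by omega)
  let G : Finset K → K[X] := fun B => ∏ d ∈ B, (X + Polynomial.C d)
  have hG : ∀ B : Finset K, ∀ z, (G B).eval z = ∏ d ∈ B, (z + d) := fun B z => by
    simp [G, eval_prod]
  have hGint : ∀ B ⊆ C, ∀ k, Introspective D A Cs k → (G B).eval (ζ ^ k) = (G B).eval ζ ^ k := by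
    intro B hB k hk
    rw [hG, hG, ← Finset.prod_pow]
    exact Finset.prod_congr rfl fun d hd => (hk.2 d (hC (hB hd)) ζ hζ).symm
  have hdeg : ∀ B ⊆ C, (G B).natDegree < T := fun B hB => by
    rw [natDegree_prod_of_monic _ _ fun d _ => monic_X_add_C d]
    simp only [natDegree_X_add_C, Finset.sum_const, smul_eq_mul, mul_one]
    have := Finset.card_le_card hB
    omega
  have hinj : Set.InjOn (fun B => (G B).eval ζ) (C.powerset : Set (Finset K)) := by
    intro B hB B' hB' hBB
    rw [Finset.mem_coe, Finset.mem_powerset] at hB hB'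
    -- By introspection the value at ζ^k is the k-th power of the value at ζ. So polynomials that
    -- agree at ζ agree at all T points of Z.
    have hGG : G B = G B' := by
      refine eq_of_natDegree_lt_card_of_eval_eq' _ _ Z (fun z hz => ?_) (max_lt (hdeg B hB) (hdeg B' hB'))
      obtain ⟨_, a, b, rfl⟩ := Finset.mem_filter.1 hz
      rw [hGint B hB _ (hg a b), hGint B' hB' _ (hg a b)]
      exact congrArg (· ^ _) hBB
    ext d
    have key : ∀ B : Finset K, d ∈ B ↔ (G B).eval (-d) = 0 := fun B => by
      rw [hG, Finset.prod_eq_zero_iff]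
      constructor
      · intro h; exact ⟨d, h, by ring⟩
      · rintro ⟨a, ha, h⟩
        rwa [← neg_add_eq_zero.1 h] at ha
    rw [key B, key B', hGG]
  have hne0 : (X ^ m1 - X ^ m2 : K[X]) ≠ 0 := fun H => hm12 (by
    have := congrArg natDegree (sub_eq_zero.1 H)
    simpa using this)
  -- If y is the value at ζ, then y^m1 and y^m2 are the values at ζ^m1 = ζ^m2; so y is a root of
  -- X^m1 - X^m2.
  have hsub : C.powerset.image (fun B => (G B).eval ζ) ⊆ (X ^ m1 - X ^ m2 : K[X]).roots.toFinset := by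
    intro y hy
    obtain ⟨B, hB, rfl⟩ := Finset.mem_image.1 hy
    rw [Finset.mem_powerset] at hB
    rw [Multiset.mem_toFinset, mem_roots hne0, IsRoot, eval_sub, eval_pow, eval_pow, eval_X,
      ← hGint B hB _ (hg i j), ← hGint B hB _ (hg i' j'), sub_eq_zero]
    exact congrArg (fun z => (G B).eval z) heq
  calc 2 ^ (T - 1) = (C.powerset.image (fun B => (G B).eval ζ)).card := by
        rw [Finset.card_image_of_injOn hinj, Finset.card_powerset, hCc]
    _ ≤ _ := Finset.card_le_card hsub
    _ ≤ _ := Multiset.toFinset_card_le _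
    _ ≤ _ := card_roots' _
    _ ≤ max (X ^ m1 : K[X]).natDegree (X ^ m2 : K[X]).natDegree := natDegree_sub_le _ _
    _ ≤ _ := by
      rw [natDegree_X_pow, natDegree_X_pow]
      exact max_le (hle i j hij.1 hij.2) (hle i' j' hij'.1 hij'.2)

/-- Lifting the exponent: ν₂(N^d - 1) = k + ν₂(d), since 4 divides N - 1; hence the condition k ≥ 2.
-/
theorem two_pow_dvd_of_two_pow_dvd_pow_sub_one {N k m d t : ℕ} (hk : 2 ≤ k) (hm : Odd m)
    (hN : N = 2 ^ k * m + 1) (hd : 2 ^ (k + t) ∣ N ^ d - 1) : 2 ^ t ∣ d := by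
  have h4 : (4 : ℤ) ∣ (N : ℤ) - 1 := by
    rw [hN]; push_cast
    rw [add_sub_cancel_right]
    exact Dvd.dvd.mul_right (by simpa using pow_dvd_pow (2 : ℤ) hk) _
  have h2 : ¬ (2 : ℤ) ∣ N := by
    intro h
    have := (dvd_trans (by norm_num) h4 : (2 : ℤ) ∣ (N : ℤ) - 1)
    omega
  have key := Int.two_pow_sub_pow' d h4 h2
  have e1 : emultiplicity (2 : ℤ) ((N : ℤ) - 1) = k := by
    rw [hN]; push_cast
    rw [add_sub_cancel_right]
    refine emultiplicity_eq_coe.2 ⟨dvd_mul_right _ _, fun h => ?_⟩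
    rw [pow_succ, mul_dvd_mul_iff_left (by positivity)] at h
    have : 2 ∣ m := by exact_mod_cast h
    exact (Nat.not_even_iff_odd.2 hm) (even_iff_two_dvd.2 this)
  have h5 : ((2 : ℤ) ^ (k + t)) ∣ (N : ℤ) ^ d - 1 ^ d := by
    have h1 : 1 ≤ N ^ d := Nat.one_le_pow _ _ (by omega)
    have := Int.natCast_dvd_natCast.2 hd
    push_cast [h1] at this
    simpa using this
  rw [pow_dvd_iff_le_emultiplicity, key, e1] at h5
  push_cast at h5
  have h6 : (t : ℕ∞) ≤ emultiplicity (2 : ℤ) (d : ℤ) :=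
    (ENat.add_le_add_iff_left (ENat.natCast_ne_top k)).1 h5
  rw [← pow_dvd_iff_le_emultiplicity] at h6
  exact_mod_cast h6

/-- The hypothesis on A makes ζ^m a root of unity of order exactly 2^(S+(k-u)+1). A coincidence
forces this number to divide N^(j-i) - 1, as N is odd, and then 2^(S+1-u) divides j - i, which is
too small. -/
theorem orbit_injective {K : Type*} [Field K] (h2 : (2 : K) ≠ 0) {N k m u S : ℕ} (hk : 2 ≤ k) (hm : Odd m)
    (hN : N = 2 ^ k * m + 1) (huk : u ≤ k) (huS : u ≤ S) {A ζ : K}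
    (hζ : ζ ^ 2 ^ S = A) (hA : A ^ (m * 2 ^ (k - u)) = -1) (i j : ℕ) (hij : i < j)
    (hj : j < 2 ^ (S + 1 - u)) : ζ ^ N ^ i ≠ ζ ^ N ^ j := by
  intro H
  have hneg : (-1 : K) ≠ 1 := fun h => h2 (by linear_combination -h)
  have e1 : (ζ ^ m) ^ 2 ^ (S + (k - u)) = -1 := by
    rw [← pow_mul, pow_add, show m * (2 ^ S * 2 ^ (k - u)) = 2 ^ S * (m * 2 ^ (k - u)) by ring, pow_mul,
      hζ, hA]
  have ho : orderOf (ζ ^ m) = 2 ^ (S + (k - u) + 1) := by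
    have : Fact (Nat.Prime 2) := ⟨Nat.prime_two⟩
    refine orderOf_eq_prime_pow (by rw [e1]; exact hneg) ?_
    rw [pow_succ, pow_mul, e1]; norm_num
  have H' : (ζ ^ m) ^ N ^ i = (ζ ^ m) ^ N ^ j := by
    rw [← pow_mul, ← pow_mul, mul_comm m, mul_comm m, pow_mul, pow_mul, H]
  have hζ0 : ζ ^ m ≠ 0 := fun h0 => by
    rw [h0, zero_pow (by positivity)] at e1
    exact one_ne_zero (neg_eq_zero.1 e1.symm)
  have hN1 : 1 ≤ N := by omega
  have h3 : 2 ^ (S + (k - u) + 1) ∣ N ^ j - N ^ i := by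
    rw [← ho]
    refine orderOf_dvd_of_pow_eq_one (mul_left_cancel₀ (pow_ne_zero (N ^ i) hζ0) ?_)
    rw [← pow_add, Nat.add_sub_cancel' (Nat.pow_le_pow_right hN1 hij.le), H', mul_one]
  rw [show N ^ j - N ^ i = N ^ i * (N ^ (j - i) - 1) by
    rw [Nat.mul_sub, ← pow_add, mul_one, Nat.add_sub_cancel' hij.le]] at h3
  have hNodd : Odd N := by
    rw [hN]
    exact Even.add_one ((even_iff_two_dvd.2 (dvd_pow_self 2 (by omega))).mul_right _)
  have h4 : 2 ^ (S + (k - u) + 1) ∣ N ^ (j - i) - 1 :=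
    (Nat.Coprime.pow _ _ (Nat.coprime_two_left.2 hNodd)).dvd_of_dvd_mul_left h3
  rw [show S + (k - u) + 1 = k + (S + 1 - u) by omega] at h4
  have := Nat.le_of_dvd (by omega) (two_pow_dvd_of_two_pow_dvd_pow_sub_one hk hm hN h4)
  omega

/-- From √T ≥ 4L one gets h·L·√T ≤ 2L√T ≤ T/2 < T - 1. -/
theorem pow_lt_two_pow {n h L T : ℕ} (hh : h ≤ 2) (hn : n < 2 ^ L) (hL : 1 ≤ L) (hT : 32 * L ^ 2 ≤ T) :
    n ^ (h * Nat.sqrt T) < 2 ^ (T - 1) := by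
  have h1 : 4 * L ≤ Nat.sqrt T := by rw [Nat.le_sqrt]; nlinarith
  have h2 := Nat.sqrt_le T
  have h3 : L * (h * Nat.sqrt T) < T - 1 := by
    have : h * (L * Nat.sqrt T) ≤ 2 * (L * Nat.sqrt T) := Nat.mul_le_mul_right _ hh
    have : 4 * (L * Nat.sqrt T) ≤ T := by nlinarith
    have : L * (h * Nat.sqrt T) = h * (L * Nat.sqrt T) := by ring
    have : 32 ≤ T := by nlinarith
    omega
  calc n ^ (h * Nat.sqrt T) ≤ (2 ^ L) ^ (h * Nat.sqrt T) := Nat.pow_le_pow_left hn.le _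
    _ = 2 ^ (L * (h * Nat.sqrt T)) := by rw [← pow_mul]
    _ < _ := Nat.pow_lt_pow_right (by norm_num) h3

/-- No number with two different prime factors passes the tests. -/
theorem false_of_two_prime_factors {K : Type*} [Field K] {p : ℕ} [Fact p.Prime] [CharP K p]
    {n h r k m u S L : ℕ} (hh : 0 < h) (hh2 : h ≤ 2) (hr : r.Prime) (hrp : r ≠ p) (hrn : r ∣ n) (hpn : p ∣ n)
    (hk : 2 ≤ k) (hm : Odd m) (hN : n ^ h = 2 ^ k * m + 1) (hu : 1 ≤ u) (huk : u ≤ k) (huS : u ≤ S)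
    (hL : 1 ≤ L) (hnL : n < 2 ^ L) (hS : 2 ^ u * (16 * L ^ 2) ≤ 2 ^ S)
    {A ζ : K} (hζ : ζ ^ 2 ^ S = A) (hA : A ^ (m * 2 ^ (k - u)) = -1) (hAp : A ^ p ^ h = A) (Es : Finset ℕ)
    (hEs : 2 ^ S ≤ Es.card * 2 ^ min (k + 1 - u) S) (hE0 : ∀ e ∈ Es, (e : K) ≠ 0)
    (hinj : Set.InjOn (fun e : ℕ => (e : K) ^ 2 ^ (k + 1 - u)) Es)
    (hE : ∀ e ∈ Es, ∀ z : K, z ^ 2 ^ S = A → (e + z) ^ n ^ h = e + z ^ n ^ h) : False := by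
  classical
  have hp : p.Prime := Fact.out
  have hn0 : n ≠ 0 := by rintro rfl; rw [zero_pow hh.ne'] at hN; omega
  have h2 : (2 : K) ≠ 0 := by
    intro h0
    have : p ∣ 2 := (CharP.cast_eq_zero_iff K p 2).1 (by exact_mod_cast h0)
    have h3 : 2 ∣ n ^ h := by
      rw [(Nat.prime_dvd_prime_iff_eq hp Nat.prime_two).1 this] at hpn
      exact dvd_pow hpn hh.ne'
    have h4 : 2 ∣ 2 ^ k * m := (dvd_pow_self 2 (by omega)).mul_right _
    omega
  have hneg : (-1 : K) ≠ 1 := fun h => h2 (by linear_combination -h)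
  have hA1 : A ^ (2 ^ k * m) = 1 := by
    rw [show 2 ^ k * m = m * 2 ^ (k - u) * 2 ^ u by
      rw [mul_assoc, ← pow_add, Nat.sub_add_cancel huk, mul_comm], pow_mul, hA]
    exact Even.neg_one_pow (even_iff_two_dvd.2 (dvd_pow_self 2 (by omega)))
  have hA0 : A ≠ 0 := by
    rintro rfl
    rw [zero_pow (by have := hm.pos; positivity)] at hA1
    exact zero_ne_one hA1
  -- Its power with exponent 2^(t-1) is A^(m·2^(k-u)) = -1, so γ has order 2^t. The bound t ≤ k+1-u
  -- makes γ a power of A and makes γ disappear from 2^(k+1-u)-th powers; the bound t ≤ S makes it a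
  -- D-th root of unity.
  set t := min (k + 1 - u) S
  set γ := A ^ (m * 2 ^ (k + 1 - u - t)) with hγ
  have ht : 1 ≤ t := by omega
  have hord : orderOf γ = 2 ^ (t - 1 + 1) := by
    have : Fact (Nat.Prime 2) := ⟨Nat.prime_two⟩
    have e : γ ^ 2 ^ (t - 1) = -1 := by
      rw [hγ, ← pow_mul, mul_assoc, ← pow_add, show k + 1 - u - t + (t - 1) = k - u by omega, hA]
    refine orderOf_eq_prime_pow (by rw [e]; exact hneg) ?_
    rw [pow_succ, pow_mul, e]; norm_num
  rw [Nat.sub_add_cancel ht] at hord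
  have hγt : ∀ s, t ≤ s → γ ^ 2 ^ s = 1 := fun s hs =>
    orderOf_dvd_iff_pow_eq_one.1 (hord ▸ pow_dvd_pow 2 hs)
  have hγ0 : γ ≠ 0 := pow_ne_zero _ hA0
  have hAN : A ^ n ^ h = A := by rw [hN, pow_succ, hA1, one_mul]
  have hγN : ∀ j, (γ ^ j) ^ n ^ h = γ ^ j := fun j => by
    rw [pow_right_comm, hγ, pow_right_comm A, hAN]
  have hγp : ∀ j, (γ ^ j) ^ p ^ h = γ ^ j := fun j => by
    rw [pow_right_comm, hγ, pow_right_comm A, hAp]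
  let f : ℕ × ℕ → K := fun x => x.1 * γ ^ x.2
  -- Raising e·γ^j to the power 2^(k+1-u) removes γ and determines e by hypothesis; dividing by e ≠
  -- 0 then determines γ^j.
  have hf : Set.InjOn f (Es ×ˢ Finset.range (2 ^ t) : Finset (ℕ × ℕ)) := by
    rintro ⟨e, j⟩ hx ⟨e', j'⟩ hx' hff
    simp only [Finset.coe_product, Set.mem_prod, Finset.mem_coe, Finset.mem_range] at hx hx'
    have hγ1 : ∀ j, (γ ^ j) ^ 2 ^ (k + 1 - u) = 1 := fun j => by
      rw [← pow_mul, mul_comm, pow_mul, hγt _ (min_le_left _ _), one_pow]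
    have hpow := congrArg (· ^ 2 ^ (k + 1 - u)) hff
    simp only [f, mul_pow, hγ1, mul_one] at hpow
    have hee : e = e' := hinj hx.1 hx'.1 hpow
    subst hee
    have hjj : γ ^ j = γ ^ j' := mul_left_cancel₀ (hE0 e hx.1) hff
    rw [(IsPrimitiveRoot.orderOf γ).pow_inj (hord ▸ hx.2) (hord ▸ hx'.2) hjj]
  obtain ⟨T, hT1, hT2⟩ := card_le_of_introspective (p := p) (D := 2 ^ S) (n := n) (h := h) (by positivity) hh hr
    hrp hrn hpn hn0 hζ hAN hAp ((Es ×ˢ Finset.range (2 ^ t)).image f)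
    (by rw [Finset.card_image_of_injOn hf, Finset.card_product, Finset.card_range]; exact hEs)
    (by
      intro d hd
      obtain ⟨⟨e, j⟩, _, rfl⟩ := Finset.mem_image.1 hd
      have he : ((e : K)) ^ p ^ h = e := by
        have := map_natCast (iterateFrobenius K p h) e
        rwa [iterateFrobenius_def] at this
      show ((e : K) * γ ^ j) ^ p ^ h = e * γ ^ j
      rw [mul_pow, hγp, he])
    (by
      intro d hd z hz
      obtain ⟨⟨e, j⟩, hx, rfl⟩ := Finset.mem_image.1 hd
      show (z + (e : K) * γ ^ j) ^ n ^ h = z ^ n ^ h + e * γ ^ j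
      have hj0 : γ ^ j ≠ 0 := pow_ne_zero _ hγ0
      -- The identity for e at the root z/γ^j, multiplied by γ^j, is the identity for e·γ^j at z,
      -- because γ^j is fixed by the exponent N.
      have hz' : (z / γ ^ j) ^ 2 ^ S = A := by
        rw [div_pow, hz, ← pow_mul γ, mul_comm j, pow_mul γ, hγt _ (min_le_right _ _), one_pow, div_one]
      have := hE e (Finset.mem_product.1 hx).1 _ hz'
      calc (z + (e : K) * γ ^ j) ^ n ^ h = ((e + z / γ ^ j) * γ ^ j) ^ n ^ h := by
            congr 1; field_simp; ring
        _ = z ^ n ^ h + e * γ ^ j := by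
          rw [mul_pow, this, hγN, div_pow, hγN]; field_simp; ring)
    (M := 2 ^ (S + 1 - u))
    (by
      intro i j hij hj
      exact orbit_injective h2 hk hm hN huk huS hζ hA i j hij hj)
  -- The orbit has 2^(S+1-u) elements, and 2^S ≥ 2^u·16L²; the additional factor 2 yields 32L².
  have hT3 : 32 * L ^ 2 ≤ T := by
    refine le_trans ?_ hT1
    have : 2 ^ u * (32 * L ^ 2) ≤ 2 ^ u * 2 ^ (S + 1 - u) := by
      rw [← pow_add, show u + (S + 1 - u) = S + 1 by omega, pow_succ 2 S]; linarith
    exact Nat.le_of_mul_le_mul_left this (by positivity)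
  exact absurd hT2 (not_le.2 (pow_lt_two_pow hh2 hnL hL hT3))

end BinomialTest

/-! ### The verdict of the test is correct. -/

namespace RAM

open Polynomial

section Complete

variable {n re im N kap vv S : ℕ}

/-- In the field with n elements each value has at most 2^kap roots of order 2^kap. The numbers 1,
…, 2^S are distinct modulo n, and if the list is not full their powers take at most c values. -/
theorem le_card_of_full (hp : n.Prime) (hS : 2 ^ S < n) {c pr : ℕ} {L H : ℕ → ℕ}
    (hC : Cands n kap vv (2 ^ S) c pr L H) (hc : c < vv) : 2 ^ S ≤ 2 ^ kap * c := by
  classical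
  have : Fact n.Prime := ⟨hp⟩
  have hmaps : ∀ e ∈ Finset.Icc (1 : ℕ) (2 ^ S), (e : ZMod n) ^ 2 ^ kap ∈ (Finset.range c).image fun i => (H i : ZMod n) := by
    intro e he
    rw [Finset.mem_Icc] at he
    obtain ⟨i, hi, h⟩ := hC.full hc e he.1 he.2
    rw [Finset.mem_image]
    refine ⟨i, Finset.mem_range.2 hi, ?_⟩
    rw [h, ZMod.natCast_mod]
    push_cast
    rfl
  have hinj : ∀ a ∈ Finset.Icc (1 : ℕ) (2 ^ S), ∀ b ∈ Finset.Icc (1 : ℕ) (2 ^ S), (a : ZMod n) = b → a = b := by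
    intro a ha b hb hab
    rw [Finset.mem_Icc] at ha hb
    exact Nat.ModEq.eq_of_lt_of_lt ((ZMod.natCast_eq_natCast_iff _ _ _).1 hab) (by omega) (by omega)
  have key := Finset.card_le_mul_card_image_of_maps_to hmaps (2 ^ kap) fun b _ => by
    have h1 : (((Finset.Icc 1 (2 ^ S)).filter fun e : ℕ => (e : ZMod n) ^ 2 ^ kap = b).image
        fun e : ℕ => (e : ZMod n)) ⊆ (nthRoots (2 ^ kap) b).toFinset := by
      intro x hx
      obtain ⟨e, he, rfl⟩ := Finset.mem_image.1 hx
      rw [Multiset.mem_toFinset, mem_nthRoots (by positivity)]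
      exact (Finset.mem_filter.1 he).2
    rw [← Finset.card_image_of_injOn (s := (Finset.Icc 1 (2 ^ S)).filter fun e : ℕ => (e : ZMod n) ^ 2 ^ kap = b)
      (f := fun e : ℕ => (e : ZMod n))]
    · exact (Finset.card_le_card h1).trans ((Multiset.toFinset_card_le _).trans (card_nthRoots _ _))
    · intro a ha b' hb hab
      exact hinj a (Finset.mem_filter.1 ha).1 b' (Finset.mem_filter.1 hb).1 hab
  rw [Nat.card_Icc, Nat.add_sub_cancel] at key
  exact key.trans (Nat.mul_le_mul_left _ (Finset.card_image_le.trans (by rw [Finset.card_range])))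

/-- Too short a list would give (c+1)·2^kap ≤ 2^S ≤ c·2^kap. The alternative 1 in the maximum is
harmless, since the candidate 1 keeps the list from being empty. -/
theorem le_of_prime (hp : n.Prime) (hS : 2 ^ S < n) {c pr : ℕ} {L H : ℕ → ℕ}
    (hC : Cands n kap (max (2 ^ S / 2 ^ kap) 1) (2 ^ S) c pr L H) : max (2 ^ S / 2 ^ kap) 1 ≤ c := by
  by_contra hc
  push Not at hc
  have h1 := le_card_of_full hp hS hC hc
  have h2 : 0 < c := by
    obtain ⟨i, hi, _⟩ := hC.full hc 1 le_rfl Nat.one_le_two_pow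
    omega
  have h3 : c + 1 ≤ 2 ^ S / 2 ^ kap := by
    rcases lt_max_iff.1 hc with h | h <;> omega
  have h4 := (Nat.le_div_iff_mul_le (by positivity)).1 h3
  have h5 : 0 < 2 ^ kap := by positivity
  nlinarith

/-- Raising to the power n^h is additive in characteristic n and fixes constants; a constant is its
own remainder. -/
theorem linearTest_of_prime {p : Par} {Y : ℕ} (hok : p.Ok Y) (hp : p.n.Prime) (h e : ℕ) : LinearTest p (p.n ^ h) e := by
  have : Fact p.n.Prime := ⟨hp⟩
  have : CharP (ZMod p.n)[X] p.n := inferInstance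
  rw [LinearTest, add_pow_char_pow, ← C_pow, ZMod.pow_card_pow, add_modByMonic]
  congr 1
  rw [modByMonic_eq_self_iff hok.monic, hok.degree]
  exact degree_C_le.trans_lt (by exact_mod_cast Nat.two_pow_pos p.e)

end Complete

theorem Par.eval₂_modulus {F : Type*} [Field F] (p : Par) (ψ : ZMod p.n →+* F) (z : F) :
    eval₂ ψ z p.modulus = z ^ 2 ^ p.e - ψ p.c3 * z ^ 2 ^ (p.e - 1) - ψ p.c1 := by
  rw [Par.modulus, eval₂_sub, eval₂_sub, eval₂_mul, eval₂_C, eval₂_C, eval₂_X_pow, eval₂_X_pow]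

/-- Only values at roots of the modulus in a field are used later. So the modulus need not be
irreducible, and it may be a square, as it is for im = 0. -/
theorem LinearTest.eval {F : Type*} [Field F] {p : Par} (ψ : ZMod p.n →+* F) {z : F} {N e : ℕ}
    (h : LinearTest p N e) (hz : eval₂ ψ z p.modulus = 0) : (z + e) ^ N = z ^ N + e := by
  have hmod : ∀ f : (ZMod p.n)[X], eval₂ ψ z (f %ₘ p.modulus) = eval₂ ψ z f := fun f => by
    have h1 := congrArg (eval₂ ψ z) (modByMonic_add_div f p.modulus)
    rwa [eval₂_add, eval₂_mul, hz, zero_mul, add_zero] at h1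
  have h2 := congrArg (eval₂ ψ z) h
  rwa [eval₂_add, hmod, hmod, eval₂_pow, eval₂_add, eval₂_X, eval₂_C, eval₂_X_pow, map_natCast] at h2

/-- The identities that the inputs of the test satisfy. -/
structure TestInput (n re im N h K m u : ℕ) : Prop where
  two_le : 2 ≤ n
  re_lt : re < n
  im_lt : im < n
  N_eq : N = n ^ h
  h_pos : 0 < h
  h_le : h ≤ 2
  im_eq : h = 1 → im = 0
  N_eq' : N = 2 ^ K * m + 1
  odd : Odd m
  two_le_K : 2 ≤ K
  u_pos : 1 ≤ u
  u_le : u ≤ K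
  dvd : (n : GaussianInt) ∣ (⟨re, im⟩ : GaussianInt) ^ (m * 2 ^ (K - u)) - (-1)

namespace TestInput

variable {n re im N h K m u : ℕ} (hI : TestInput n re im N h K m u)
include hI

theorem false_of_accepts {p r S c pr : ℕ} (hp : p.Prime) (hr : r.Prime) (hrp : r ≠ p) (hrn : r ∣ n) (hpn : p ∣ n)
    (hS : 2 ^ u * (16 * len n ^ 2) ≤ 2 ^ S) {L H : ℕ → ℕ}
    (hC : Cands n (K + 1 - u) (max (2 ^ S / 2 ^ (K + 1 - u)) 1) (2 ^ S) c pr L H)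
    (hc : max (2 ^ S / 2 ^ (K + 1 - u)) 1 ≤ c) (hpr : (pr : ZMod n) ^ (n - 1) = 1)
    (hlin : ∀ i < c, LinearTest (par n re im S) N (L i)) : False := by
  classical
  have : Fact p.Prime := ⟨hp⟩
  -- A square root i of -1 in the closure defines a homomorphism from ℤ[i] that kills n. It carries
  -- the hypothesis on α to A^(m·2^(K-u)) = -1.
  let F := AlgebraicClosure (ZMod p)
  have : CharP F p := charP_of_injective_algebraMap (algebraMap (ZMod p) F).injective p
  obtain ⟨i, hi⟩ : ∃ i : F, i ^ 2 = -1 := IsAlgClosed.exists_pow_nat_eq _ (by norm_num)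
  let φ : GaussianInt →+* F := Zsqrtd.lift ⟨i, by rw [← sq, hi]; simp⟩
  obtain ⟨A, hA⟩ : ∃ A : F, A = re + im * i := ⟨_, rfl⟩
  have hφA : φ ⟨re, im⟩ = A := by simp [φ, hA]
  obtain ⟨ζ, hζ⟩ : ∃ ζ : F, ζ ^ 2 ^ S = A := IsAlgClosed.exists_pow_nat_eq _ (by positivity)
  have hcast : ∀ a : ℕ, (a : F) = 0 ↔ p ∣ a := fun a => CharP.cast_eq_zero_iff F p a
  -- As n - 1 > 0, a power of pr that is 1 modulo n cannot vanish modulo p.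
  have hppr : ¬ p ∣ pr := by
    intro h
    have h1 := congrArg (ZMod.castHom hpn (ZMod p)) hpr
    rw [map_pow, map_natCast, map_one, (ZMod.natCast_eq_zero_iff pr p).2 h, zero_pow] at h1
    · exact zero_ne_one h1
    · have := hI.two_le; omega
  obtain ⟨hs1, hs2⟩ := hC.sound p hp hpn hppr
  have hLinj : Set.InjOn L (Finset.range c) := by
    intro a ha b hb hab
    rw [Finset.coe_range, Set.mem_Iio] at ha hb
    refine hC.inj a ha b hb ?_
    rw [(hC.mem a ha).2.2, (hC.mem b hb).2.2, hab]
  have hmod : ∀ a < c, ((L a : ℕ) : F) ^ 2 ^ (K + 1 - u) = (H a : F) := by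
    intro a ha
    rw [(hC.mem a ha).2.2, ← Nat.cast_pow]
    have h1 : L a ^ 2 ^ (K + 1 - u) % n ≡ L a ^ 2 ^ (K + 1 - u) [MOD p] := (Nat.mod_modEq _ n).of_dvd hpn
    exact ((CharP.natCast_eq_natCast F p).2 h1).symm
  have hA1 : A ^ (m * 2 ^ (K - u)) = -1 := by
    obtain ⟨z, hz⟩ := hI.dvd
    have h1 := congrArg φ hz
    rw [map_sub, map_pow, hφA, map_neg, map_one, map_mul, map_natCast, (hcast n).2 hpn, zero_mul] at h1
    linear_combination h1
  have hnat : ∀ a : ℕ, (a : F) ^ p = a := fun a => by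
    rw [← map_natCast (algebraMap (ZMod p) F), ← map_pow, ZMod.pow_card]
  -- For h = 1 the element A lies in the prime field, since im = 0. For h = 2 it suffices that i is
  -- fixed by the power p², because i^p is i or -i.
  have hAp : A ^ p ^ h = A := by
    have hh := hI.h_le
    have hh' := hI.h_pos
    obtain rfl | rfl : h = 1 ∨ h = 2 := by omega
    · rw [hA, hI.im_eq rfl, Nat.cast_zero, zero_mul, add_zero, pow_one, hnat]
    · have hip : (i ^ p ^ 2 : F) = i := by
        have h1 : (i ^ p) ^ 2 = -1 := by
          rw [← pow_mul, mul_comm, pow_mul, hi]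
          rcases hp.eq_two_or_odd' with h2 | h2
          · subst h2
            have : (2 : F) = 0 := by exact_mod_cast (hcast 2).2 dvd_rfl
            linear_combination this
          · exact h2.neg_one_pow
        have h2 : (i ^ p - i) * (i ^ p + i) = 0 := by linear_combination h1 - hi
        rw [sq, pow_mul]
        rcases mul_eq_zero.1 h2 with h3 | h3
        · rw [sub_eq_zero.1 h3, sub_eq_zero.1 h3]
        · have h4 : i ^ p = -i := by linear_combination h3
          rw [h4, neg_pow, h4]
          rcases hp.eq_two_or_odd' with h2 | h2
          · subst h2
            have : (2 : F) = 0 := by exact_mod_cast (hcast 2).2 dvd_rfl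
            linear_combination (-i) * this
          · rw [h2.neg_one_pow]; ring
      rw [hA, add_pow_char_pow, mul_pow, hip, sq, pow_mul, hnat, hnat, pow_mul, hnat, hnat]
  have huS : u ≤ S := by
    have h1 : 2 ^ u * 1 ≤ 2 ^ u * (16 * len n ^ 2) := Nat.mul_le_mul_left _ (by
      have : 0 < len n ^ 2 := pow_pos (Nat.succ_pos _) 2
      omega)
    exact (Nat.pow_le_pow_iff_right (show 1 < 2 by norm_num)).1 (by omega)
  refine BinomialTest.false_of_two_prime_factors (K := F) (p := p) (ζ := ζ) (A := A) (n := n) (h := h) (r := r) (k := K) (m := m)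
    (u := u) (S := S) (L := len n) (Es := (Finset.range c).image L) hI.h_pos hI.h_le hr hrp hrn hpn hI.two_le_K hI.odd
    (hI.N_eq ▸ hI.N_eq') hI.u_pos hI.u_le huS (Nat.succ_pos _) (lt_two_pow_len n) hS hζ hA1 hAp ?_ ?_ ?_ ?_
  · rw [Finset.card_image_of_injOn hLinj, Finset.card_range]
    -- If K+1-u ≤ S, the quotient in `vv` is an exact power of two, so c·2^(K+1-u) ≥ 2^S; otherwise
    -- a single e with its 2^S shifts is enough.
    rcases le_total (K + 1 - u) S with hle | hle
    · rw [min_eq_left hle]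
      have h1 : 2 ^ S / 2 ^ (K + 1 - u) = 2 ^ (S - (K + 1 - u)) := Nat.pow_div hle (by norm_num)
      calc 2 ^ S = 2 ^ (S - (K + 1 - u)) * 2 ^ (K + 1 - u) := by rw [← pow_add, Nat.sub_add_cancel hle]
        _ ≤ c * 2 ^ (K + 1 - u) := Nat.mul_le_mul_right _ (h1 ▸ (le_max_left _ _).trans hc)
    · rw [min_eq_right hle]
      exact Nat.le_mul_of_pos_left _ (lt_of_lt_of_le (lt_max_of_lt_right one_pos) hc)
  · intro e he
    obtain ⟨a, ha, rfl⟩ := Finset.mem_image.1 he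
    rw [Finset.mem_range] at ha
    exact fun h0 => hs1 _ (hC.mem a ha).1 (hC.mem a ha).2.1 ((hcast _).1 h0)
  · intro x hx y hy hxy
    obtain ⟨a, ha, rfl⟩ := Finset.mem_image.1 hx
    obtain ⟨b, hb, rfl⟩ := Finset.mem_image.1 hy
    rw [Finset.mem_range] at ha hb
    by_contra hne
    refine hs2 a ha b hb (fun hab => hne (by rw [hab])) ?_
    simp only [hmod a ha, hmod b hb] at hxy
    exact (CharP.natCast_eq_natCast F p).1 hxy
  · intro e he z hz
    obtain ⟨a, ha, rfl⟩ := Finset.mem_image.1 he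
    rw [Finset.mem_range] at ha
    have hl := hlin a ha
    generalize L a = e at hl ⊢
    let ψ : ZMod n →+* F := (algebraMap (ZMod p) F).comp (ZMod.castHom hpn (ZMod p))
    have hre : ψ ((re + re) % n : ℕ) = re + re := by
      rw [ZMod.natCast_mod, map_natCast, Nat.cast_add]
    have hc1 : ψ (n - (re * re + im * im) % n : ℕ) = -(re * re + im * im) := by
      rw [Nat.cast_sub (Nat.mod_lt _ (by have := hI.two_le; omega)).le, ZMod.natCast_mod, ZMod.natCast_self, zero_sub,
        map_neg, map_natCast]
      push_cast; rfl
    have hmodulus : eval₂ (show ZMod (par n re im S).n →+* F from ψ) z (par n re im S).modulus = 0 := by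
      rw [Par.eval₂_modulus]
      -- The modulus is (X^D - α)(X^D - ᾱ), and z^D = A is the image of α.
      have h1 : z ^ 2 ^ (S + 1) - ψ ((re + re) % n : ℕ) * z ^ 2 ^ S - ψ (n - (re * re + im * im) % n : ℕ) = 0 := by
        rw [hre, hc1, pow_succ, pow_mul, hz, hA]
        linear_combination (im : F) ^ 2 * hi
      exact h1
    rw [← hI.N_eq, add_comm (e : F) z, hl.eval _ hmodulus, add_comm]

theorem testCorrect : TestCorrect n re im N K u := by
  intro S a hS hSn hV
  obtain ⟨-, c, pr, L, H, hC, hiff⟩ := hV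
  have hn0 : 0 < n := by have := hI.two_le; omega
  have hok : (par n re im S).Ok (len (2 * (4 * len n + 8) * 2 ^ (S + 1)) + 2) := par_ok hn0 hSn le_rfl
  rw [hiff]
  constructor
  · rintro ⟨h1, h2, h3, h4⟩
    by_contra hnp
    obtain ⟨p, hp, hpn⟩ := Nat.exists_prime_and_dvd (show n ≠ 1 by have := hI.two_le; omega)
    -- With p as its only prime factor, n would be p^j; here j = 1 means that n is prime, and j ≥ 2
    -- that it is a perfect power.
    have h5 : ∃ r, r.Prime ∧ r ≠ p ∧ r ∣ n := by
      by_contra hne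
      push Not at hne
      have h6 := Nat.eq_prime_pow_of_unique_prime_dvd hn0.ne' (p := p) fun {d} hd hdn => by
        by_contra hdp
        exact hne d hd hdp hdn
      generalize n.primeFactorsList.length = j at h6
      have : j ≠ 0 := by rintro rfl; have := hI.two_le; rw [pow_zero] at h6; omega
      have : j ≠ 1 := by rintro rfl; rw [pow_one] at h6; exact hnp (h6 ▸ hp)
      exact h1 ⟨p, j, by omega, h6.symm⟩
    obtain ⟨r, hr, hrp, hrn⟩ := h5
    exact hI.false_of_accepts hp hr hrp hrn hpn hS hC h2 h3 h4
  · intro hp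
    have : Fact n.Prime := ⟨hp⟩
    refine ⟨?_, le_of_prime hp hSn hC, ?_, fun i hi => ?_⟩
    · rintro ⟨x, j, hj, hx⟩
      have := Nat.Prime.eq_one_of_pow (hx ▸ hp)
      omega
    · refine ZMod.pow_card_sub_one_eq_one fun h0 => hC.prime hp ((ZMod.natCast_eq_zero_iff pr n).1 h0)
    · rw [hI.N_eq]
      exact linearTest_of_prime hok hp h _

end TestInput

end RAM

/-! ### The bounds in terms of n, k and u. -/

namespace RAM

section Bounds

/-- The part of the cost of the tests that depends on `n` only. -/
noncomputable def polylogCost (n : ℕ) : ℝ :=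
  1800000000 * 64 * 257 * ((len n : ℝ) ^ 4 * (3 * len (len n) + 20 : ℝ) ^ 3)

theorem len_le_two_logb {n : ℕ} (hn : 2 ≤ n) : (len n : ℝ) ≤ 2 * Real.logb 2 n := by
  have h1 : 1 ≤ Nat.log 2 n := Nat.log_pos (by norm_num) hn
  have h2 := Real.natLog_le_logb n 2
  have h3 : (1 : ℝ) ≤ (Nat.log 2 n : ℝ) := by exact_mod_cast h1
  unfold len
  push_cast at h2 ⊢
  linarith

theorem one_le_logb {n : ℕ} (hn : 2 ≤ n) : 1 ≤ Real.logb 2 n := by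
  rw [Real.le_logb_iff_rpow_le (by norm_num) (by positivity), Real.rpow_one]
  exact_mod_cast hn

theorem logb_sq_le_two_zpow_sParam {n : ℕ} (hn : 2 ≤ n) : Real.logb 2 n ^ 2 ≤ (2 : ℝ) ^ sParam n := by
  have h1 : 0 < Real.logb 2 n := one_pos.trans_le (one_le_logb hn)
  calc Real.logb 2 n ^ 2 = (2 : ℝ) ^ (2 * Real.logb 2 (Real.logb 2 n)) := by
        rw [mul_comm, Real.rpow_mul (by norm_num), Real.rpow_logb (by norm_num) (by norm_num) h1]
        norm_cast
    _ ≤ (2 : ℝ) ^ (sParam n : ℝ) := Real.rpow_le_rpow_of_exponent_le (by norm_num) (Int.le_ceil _)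
    _ = _ := Real.rpow_intCast _ _

/-- One has L² ≤ 4(log n)² ≤ 4·2^s, and 2^(s+u)/2^(K+1-u) = 2·2^(s+2(u-1)-K). This gives 256 =
32·4·2; the additional test makes 257. -/
theorem testBound_le {n k K u : ℕ} (hn : 2 ≤ n) (hk : k ≤ K) (hu : u ≤ K) :
    (testBound n K u : ℝ) ≤ 257 * (2 : ℝ) ^ max (sParam n + 2 * ((u : ℤ) - 1) - k) 0 := by
  have h1 : ((2 ^ u * (32 * len n ^ 2) / 2 ^ (K + 1 - u) : ℕ) : ℝ) ≤
      256 * (2 : ℝ) ^ (sParam n + 2 * ((u : ℤ) - 1) - k) := by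
    refine Nat.cast_div_le.trans ?_
    rw [div_le_iff₀ (by positivity)]
    have h2 : (len n : ℝ) ^ 2 ≤ 4 * (2 : ℝ) ^ sParam n := by
      have := logb_sq_le_two_zpow_sParam hn
      have h3 : (len n : ℝ) ^ 2 ≤ (2 * Real.logb 2 n) ^ 2 := by gcongr; exact len_le_two_logb hn
      linarith
    have h4 : (2 : ℝ) ^ sParam n * 2 ^ u ≤
        2 * ((2 : ℝ) ^ (sParam n + 2 * ((u : ℤ) - 1) - k) * 2 ^ (K + 1 - u)) := by
      rw [← zpow_natCast, ← zpow_natCast, ← zpow_add₀ two_ne_zero, ← zpow_add₀ two_ne_zero, ← zpow_one_add₀ two_ne_zero]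
      refine zpow_le_zpow_right₀ (by norm_num) ?_
      push_cast [Nat.cast_sub (show u ≤ K + 1 by omega)]
      omega
    push_cast
    calc (2 : ℝ) ^ u * (32 * (len n : ℝ) ^ 2) ≤ 2 ^ u * (32 * (4 * (2 : ℝ) ^ sParam n)) := by gcongr
      _ = 128 * ((2 : ℝ) ^ sParam n * 2 ^ u) := by ring
      _ ≤ 128 * (2 * ((2 : ℝ) ^ (sParam n + 2 * ((u : ℤ) - 1) - k) * 2 ^ (K + 1 - u))) := by gcongr
      _ = _ := by ring
  have h5 : (2 : ℝ) ^ (sParam n + 2 * ((u : ℤ) - 1) - k) ≤ 2 ^ max (sParam n + 2 * ((u : ℤ) - 1) - k) 0 :=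
    zpow_le_zpow_right₀ (by norm_num) (le_max_left _ _)
  have h6 : (1 : ℝ) ≤ 2 ^ max (sParam n + 2 * ((u : ℤ) - 1) - k) 0 :=
    one_le_zpow₀ (by norm_num) (le_max_right _ _)
  unfold testBound
  push_cast at h1 ⊢
  linarith

/-- The bound for the logarithms contains u; its cube is paid for by the gap between 2^u and 2^(2u).
-/
theorem succ_pow_three_le (u : ℕ) : (u + 1) ^ 3 ≤ 16 * 2 ^ u := by
  induction u with
  | zero => norm_num
  | succ u ih =>
    rcases Nat.lt_or_ge u 3 with h | h
    · interval_cases u <;> norm_num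
    · rw [pow_succ 2]
      nlinarith [Nat.mul_le_mul h h, Nat.mul_le_mul (Nat.mul_le_mul h h) h]

/-- After u has been split off from the logarithms, 2^u·(u+1)³ ≤ 16·2^(2u) = 64·2^(2(u-1)). Allowing
k ≤ K lets the same estimate serve K = k and K = k+1. -/
theorem cost_le {n k K u : ℕ} (hn : 2 ≤ n) (hk : k ≤ K) (hu1 : 1 ≤ u) (hu : u ≤ K) :
    ((1800000000 * (testBound n K u * 2 ^ u * len n ^ 4 * logBound n u ^ 3) : ℕ) : ℝ) ≤
      (2 : ℝ) ^ (2 * (u - 1)) * (2 : ℝ) ^ max (sParam n + 2 * ((u : ℤ) - 1) - k) 0 * polylogCost n := by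
  have h1 := testBound_le hn hk hu
  have h2 : 2 ^ u * logBound n u ^ 3 ≤ 64 * 2 ^ (2 * (u - 1)) * (3 * len (len n) + 20) ^ 3 := by
    calc 2 ^ u * logBound n u ^ 3 ≤ 2 ^ u * ((u + 1) * (3 * len (len n) + 20)) ^ 3 := by
          gcongr
          unfold logBound
          nlinarith
      _ = 2 ^ u * (u + 1) ^ 3 * (3 * len (len n) + 20) ^ 3 := by ring
      _ ≤ 2 ^ u * (16 * 2 ^ u) * (3 * len (len n) + 20) ^ 3 := by
          gcongr
          exact succ_pow_three_le u
      _ = _ := by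
          obtain ⟨v, rfl⟩ := Nat.exists_eq_add_of_le' hu1
          rw [Nat.add_sub_cancel, pow_succ 2 v, pow_mul']
          ring
  have h3 : ((2 ^ u * logBound n u ^ 3 : ℕ) : ℝ) ≤ ((64 * 2 ^ (2 * (u - 1)) * (3 * len (len n) + 20) ^ 3 : ℕ) : ℝ) := by
    exact_mod_cast h2
  unfold polylogCost
  push_cast at h3 ⊢
  calc (1800000000 : ℝ) * (testBound n K u * 2 ^ u * (len n : ℝ) ^ 4 * (logBound n u : ℝ) ^ 3)
      = 1800000000 * (len n : ℝ) ^ 4 * (testBound n K u * (2 ^ u * (logBound n u : ℝ) ^ 3)) := by ring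
    _ ≤ 1800000000 * (len n : ℝ) ^ 4 * ((257 * (2 : ℝ) ^ max (sParam n + 2 * ((u : ℤ) - 1) - k) 0) *
        (64 * 2 ^ (2 * (u - 1)) * (3 * (len (len n) : ℝ) + 20) ^ 3)) := by gcongr
    _ = _ := by ring

theorem isSoftO_polylogCost : IsSoftO polylogCost fun n => Real.logb 2 n ^ 4 := by
  refine ⟨3, Asymptotics.IsBigO.of_bound (1800000000 * 64 * 257 * (16 * 29 ^ 3)) ?_⟩
  filter_upwards [Filter.eventually_ge_atTop 4] with n hn
  have hn2 : 2 ≤ n := by omega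
  have hx : 2 ≤ Real.logb 2 n := by
    rw [Real.le_logb_iff_rpow_le (by norm_num) (by positivity)]
    norm_num
    exact_mod_cast hn
  have hL := len_le_two_logb hn2
  generalize Real.logb 2 n = x at hx hL
  have hL0 : 0 < len n := Nat.succ_pos _
  have hy : 1 ≤ Real.logb 2 x := by
    rw [Real.le_logb_iff_rpow_le (by norm_num) (by positivity), Real.rpow_one]
    exact hx
  have hlen : (len (len n) : ℝ) ≤ Real.logb 2 x + 2 := by
    have h1 := Real.natLog_le_logb (len n) 2
    have h2 : Real.logb 2 (len n) ≤ Real.logb 2 (2 * x) :=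
      Real.logb_le_logb_of_le (by norm_num) (by exact_mod_cast hL0) hL
    rw [Real.logb_mul (by norm_num) (by positivity), Real.logb_self_eq_one (by norm_num)] at h2
    rw [len]
    push_cast at h1 ⊢
    linarith
  have hlog : Real.logb 2 x ≤ Real.log (x ^ 4) := by
    rw [Real.log_pow, Real.logb, div_le_iff₀ (by positivity)]
    have h1 := Real.log_two_gt_d9
    have h2 : 0 ≤ Real.log x := Real.log_nonneg (by linarith)
    push_cast
    nlinarith
  -- With y = log₂ x, 3(y + 2) + 20 = 3y + 26 ≤ 29y by 1 ≤ y, and y ≤ log(x⁴) because log 2 > 1/4.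
  have h3 : 3 * (len (len n) : ℝ) + 20 ≤ 29 * Real.log (x ^ 4) := by linarith
  rw [polylogCost, Real.norm_of_nonneg (by positivity), Real.norm_of_nonneg (by
    have : 0 ≤ Real.log (x ^ 4) := by linarith
    positivity)]
  calc _ ≤ 1800000000 * 64 * 257 * ((2 * x) ^ 4 * (29 * Real.log (x ^ 4)) ^ 3) := by gcongr
    _ = _ := by ring

end Bounds

end RAM

/-! ### From the hypotheses of the two tests to the data of the common test. -/

namespace RAM

theorem exists_eq_two_pow_mul_odd {x : ℕ} (hx : x ≠ 0) : ∃ m, Odd m ∧ x = 2 ^ padicValNat 2 x * m := by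
  obtain ⟨m, hm⟩ := pow_padicValNat_dvd (p := 2) (n := x)
  refine ⟨m, Nat.not_even_iff_odd.1 fun h => ?_, hm⟩
  refine pow_succ_padicValNat_not_dvd (p := 2) hx ?_
  rw [pow_succ]
  nth_rewrite 2 [hm]
  exact Nat.mul_dvd_mul_left _ h.two_dvd

theorem two_pow_mul_div {K m u : ℕ} (hu : u ≤ K) : 2 ^ K * m / 2 ^ u = m * 2 ^ (K - u) := by
  obtain ⟨v, rfl⟩ := Nat.exists_eq_add_of_le hu
  rw [pow_add, mul_assoc, Nat.mul_div_cancel_left _ (by positivity), Nat.add_sub_cancel_left, mul_comm]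

theorem cast_emod_toNat {n : ℕ} (hn : 0 < n) (a : ℤ) : ((a % n).toNat : ℤ) = a % n :=
  Int.toNat_of_nonneg (Int.emod_nonneg _ (by omega))

theorem emod_toNat_lt {n : ℕ} (hn : 0 < n) (a : ℤ) : (a % n).toNat < n := by
  have := cast_emod_toNat hn a
  have := Int.emod_lt_of_pos a (show (0 : ℤ) < n by omega)
  omega

theorem dvd_residue_sub {n : ℕ} (hn : 0 < n) (α : GaussianInt) :
    (n : GaussianInt) ∣ (⟨(α.re % n).toNat, (α.im % n).toNat⟩ : GaussianInt) - α := by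
  have h1 : (n : GaussianInt) = ((n : ℤ) : GaussianInt) := by simp
  rw [h1, Zsqrtd.intCast_dvd]
  simp only [Zsqrtd.re_sub, Zsqrtd.im_sub, cast_emod_toNat hn]
  exact ⟨(Int.mod_modEq _ _).symm.dvd, (Int.mod_modEq _ _).symm.dvd⟩

theorem dvd_residue_pow_sub {n e : ℕ} (hn : 0 < n) {α : GaussianInt} (h : (n : GaussianInt) ∣ α ^ e - (-1)) :
    (n : GaussianInt) ∣ (⟨(α.re % n).toNat, (α.im % n).toNat⟩ : GaussianInt) ^ e - (-1) := by
  have := ((dvd_residue_sub hn α).trans (sub_dvd_pow_sub_pow _ _ e)).add h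
  rwa [sub_add_sub_cancel] at this

end RAM

/-- Integers are treated as Gaussian integers with imaginary part 0, and K = k ≥ 2 because n ≡ 1
modulo 4. -/
theorem HypA.testInput {n k u : ℕ} {a : ℤ} (h : HypA n k u a) :
    ∃ m, RAM.TestInput n (a % n).toNat 0 n 1 k m u := by
  obtain ⟨h1, h2, hk, hu, huk, h3⟩ := h
  obtain ⟨m, hm, hx⟩ := RAM.exists_eq_two_pow_mul_odd (show n - 1 ≠ 0 by omega)
  rw [← hk] at hx
  have h4 : 4 ∣ n - 1 := (Nat.modEq_iff_dvd' h1.le).1 h2.symm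
  refine ⟨m, by omega, RAM.emod_toNat_lt (by omega) a, by omega, (pow_one n).symm, one_pos, one_le_two, fun _ => rfl,
    by omega, hm, ?_, hu, huk, ?_⟩
  · rw [hk]
    exact (padicValNat_dvd_iff_le (p := 2) (by omega)).1 h4
  · have h5 : (n : GaussianInt) ∣ (a : GaussianInt) ^ (m * 2 ^ (k - u)) - (-1) := by
      rw [← RAM.two_pow_mul_div huk, ← hx]
      obtain ⟨z, hz⟩ := h3.symm.dvd
      refine ⟨z, ?_⟩
      exact_mod_cast congrArg (Int.cast : ℤ → GaussianInt) hz
    simpa using RAM.dvd_residue_pow_sub (by omega) h5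

theorem HypB.mod_four {n k u : ℕ} {α : GaussianInt} (h : HypB n k u α) : 3 ≤ n ∧ n % 4 = 3 := by
  have h1 := h.1
  unfold Int.ModEq at h1
  omega

/-- In n² - 1 = (n+1)(n-1) the second factor is twice an odd number, so K = k+1. This is why u may
go up to k+1. -/
theorem HypB.testInput {n k u : ℕ} {α : GaussianInt} (h : HypB n k u α) :
    ∃ m, RAM.TestInput n (α.re % n).toNat (α.im % n).toNat (n ^ 2) 2 (k + 1) m u := by
  obtain ⟨hn3, hn4⟩ := h.mod_four
  obtain ⟨-, hk, hu, huk, h3⟩ := h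
  obtain ⟨m, hm, hx⟩ := RAM.exists_eq_two_pow_mul_odd (show n + 1 ≠ 0 by omega)
  rw [← hk] at hx
  obtain ⟨j, hj⟩ : ∃ j, n = 4 * j + 3 := ⟨n / 4, by omega⟩
  have h5 : n ^ 2 - 1 = 2 ^ (k + 1) * (m * (2 * j + 1)) := by
    have : n ^ 2 - 1 = (n + 1) * (n - 1) := by simpa using Nat.sq_sub_sq n 1
    rw [this, hx, show n - 1 = 2 * (2 * j + 1) by omega]
    ring
  refine ⟨m * (2 * j + 1), by omega, RAM.emod_toNat_lt (by omega) _, RAM.emod_toNat_lt (by omega) _, rfl, two_pos, le_rfl,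
    by omega, ?_, hm.mul ⟨j, rfl⟩, ?_, hu, huk, ?_⟩
  · rw [← h5, Nat.sub_add_cancel (Nat.one_le_pow _ _ (by omega))]
  · have : 1 ≤ k := by
      rw [hk]
      exact (padicValNat_dvd_iff_le (p := 2) (by omega)).1 (show 2 ^ 1 ∣ n + 1 by omega)
    omega
  · rw [h5, RAM.two_pow_mul_div huk] at h3
    exact RAM.dvd_residue_pow_sub (by omega) h3

/-! ### The two programs meet their time bounds. -/

namespace RAM

theorem TestInput.lt_two_pow {n re im N h K m u : ℕ} (hI : TestInput n re im N h K m u) :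
    u < 2 ^ (4 * len n + 8) ∧ n < 2 ^ (4 * len n + 8) := by
  have h1 : n < 2 ^ (2 * len n) :=
    (lt_two_pow_len n).trans_le (Nat.pow_le_pow_right (by norm_num) (by omega))
  have h2 : u < N := by
    calc u ≤ K := hI.u_le
      _ < 2 ^ K := Nat.lt_two_pow_self
      _ ≤ 2 ^ K * m := Nat.le_mul_of_pos_right _ hI.odd.pos
      _ < N := by rw [hI.N_eq']; exact Nat.lt_succ_self _
  have h3 : N < 2 ^ (2 * len n) := by
    calc N = n ^ h := hI.N_eq
      _ ≤ n ^ 2 := Nat.pow_le_pow_right (by have := hI.two_le; omega) hI.h_le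
      _ < (2 ^ len n) ^ 2 := Nat.pow_lt_pow_left (lt_two_pow_len n) (by norm_num)
      _ = _ := by rw [← pow_mul, mul_comm]
  have h4 : 2 ^ (2 * len n) ≤ 2 ^ (4 * len n + 8) := Nat.pow_le_pow_right (by norm_num) (by omega)
  omega

theorem TestInput.decides {n re im N h K m u : ℕ} (hI : TestInput n re im N h K m u) (l : List Prim)
    (hl : l.length ≤ 6) (input : List ℕ) (hin : input.length ≤ 4)
    (hs : Smalls (4 * len n + 8) l (.start input)) (h1 : (runs l (.start input)).v .one = 1)
    (hσn : (runs l (.start input)).v .n = n) (hσre : (runs l (.start input)).v .re = re)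
    (hσim : (runs l (.start input)).v .im = im) (hσN : (runs l (.start input)).v .ex = N)
    (hσu : (runs l (.start input)).v .u = u) :
    DecidesWithin ((Stmt.prims l ;; coreTest).compile 0) input n.Prime
      (1800000000 * (testBound n K u * 2 ^ u * len n ^ 4 * logBound n u ^ 3) : ℕ) := by
  refine decides_of_testCorrect hI.two_le hI.re_lt hI.im_lt ?_ hI.N_eq' hI.odd hI.u_le hI.testCorrect l hl input hin hs h1
    hσn hσre hσim hσN hσu
  rw [hI.N_eq]
  exact Nat.pow_le_pow_right (by have := hI.two_le; omega) hI.h_le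

theorem DecidesWithin.mono {P : Program} {input : List ℕ} {p : Prop} {T T' : ℝ} (h : DecidesWithin P input p T)
    (hT : T ≤ T') : DecidesWithin P input p T' := by
  obtain ⟨t, C, h1, h2, h3⟩ := h
  exact ⟨t, C, h1, h2.trans hT, h3⟩

end RAM

theorem HypA.decides {n k u : ℕ} {a : ℤ} (h : HypA n k u a) :
    RAM.DecidesWithin (RAM.intTest.compile 0) [n, (a % n).toNat, u] n.Prime
      ((2 : ℝ) ^ (2 * (u - 1)) * (2 : ℝ) ^ max (sParam n + 2 * ((u : ℤ) - 1) - k) 0 * RAM.polylogCost n) := by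
  obtain ⟨m, hI⟩ := h.testInput
  obtain ⟨hu, hn⟩ := hI.lt_two_pow
  have hre := hI.re_lt
  refine (hI.decides _ (by simp) _ (by simp) ?_ rfl rfl rfl rfl rfl rfl).mono (RAM.cost_le hI.two_le le_rfl hI.u_pos hI.u_le)
  have h1 : 1 < 2 ^ (4 * RAM.len n + 8) := Nat.one_lt_two_pow (by omega)
  simp only [RAM.Smalls, RAM.Prim.Small, RAM.St.start]
  refine ⟨?_, ?_, ?_, ?_, ?_, trivial⟩ <;> first | exact h1 | exact hu | exact hn | exact hre.trans hn

theorem HypB.decides {n k u : ℕ} {α : GaussianInt} (h : HypB n k u α) :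
    RAM.DecidesWithin (RAM.gaussTest.compile 0) [n, (α.re % n).toNat, (α.im % n).toNat, u] n.Prime
      ((2 : ℝ) ^ (2 * u) * (2 : ℝ) ^ max (sParam n + 2 * ((u : ℤ) - 1) - k) 0 * RAM.polylogCost n) := by
  obtain ⟨m, hI⟩ := h.testInput
  obtain ⟨hu, hn⟩ := hI.lt_two_pow
  have hre := hI.re_lt
  have him := hI.im_lt
  have hex : (RAM.runs [.copy .n .i0, .copy .re .i1, .copy .im .i2, .copy .u .i3, .mul .ex .i0 .i0, .const .one 1]
      (.start [n, (α.re % n).toNat, (α.im % n).toNat, u])).v .ex = n ^ 2 := (sq n).symm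
  -- Here K = k+1. The common estimate has the factor 2^(2(u-1)), which is weakened to 2^(2u).
  refine (hI.decides _ (by simp) _ (by simp) ?_ rfl rfl rfl rfl hex rfl).mono
    ((RAM.cost_le hI.two_le (Nat.le_succ k) hI.u_pos hI.u_le).trans ?_)
  · have h1 : 1 < 2 ^ (4 * RAM.len n + 8) := Nat.one_lt_two_pow (by omega)
    simp only [RAM.Smalls, RAM.Prim.Small, RAM.St.start]
    refine ⟨?_, ?_, ?_, ?_, ?_, ?_, trivial⟩ <;>
      first | exact h1 | exact hu | exact hn | exact hre.trans hn | exact him.trans hn | exact ⟨hn, hn⟩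
  · have : 0 ≤ RAM.polylogCost n := by unfold RAM.polylogCost; positivity
    gcongr
    · norm_num
    · omega

/-- `B` tests primality of the numbers `n ≡ -1 (mod 4)`, and `A` is the corresponding test for the
numbers `n ≡ 1 (mod 4)`. The given `α`, resp. `a`, enters the machine through its residue modulo `n`.
Both time bounds have the same factor `g n = Õ((log n) ^ 4)`, so that, as functions of `n`, `k`, `u`,
the bound for `B` is four times the bound for `A`. -/
theorem corollary5p2 :
    ∃ (B A : RAM.Program) (g : ℕ → ℝ),
      IsSoftO g (fun n => Real.logb 2 n ^ 4) ∧
      (∀ (n k u : ℕ) (α : GaussianInt), HypB n k u α →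
        RAM.DecidesWithin B [n, (α.re % n).toNat, (α.im % n).toNat, u] n.Prime
          ((2 : ℝ) ^ (2 * u) * (2 : ℝ) ^ max (sParam n + 2 * ((u : ℤ) - 1) - k) 0 * g n)) ∧
      (∀ (n k u : ℕ) (a : ℤ), HypA n k u a →
        RAM.DecidesWithin A [n, (a % n).toNat, u] n.Prime
          ((2 : ℝ) ^ (2 * (u - 1)) * (2 : ℝ) ^ max (sParam n + 2 * ((u : ℤ) - 1) - k) 0 * g n)) :=
  ⟨RAM.gaussTest.compile 0, RAM.intTest.compile 0, RAM.polylogCost, RAM.isSoftO_polylogCost,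
    fun _ _ _ _ h => h.decides, fun _ _ _ _ h => h.decides⟩
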